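/- **Setting.** Let $G=(V,A_1\sqcup A_2)$ be a digraph (possibly infinite) whose edges are coloured red ($A_1$) and green ($A_2$). Consider first (K0) for $i=1,2$ every weakly connected component of $(V,A_i)$ is a finite simple directed path. These components are called $i$-strings (red strings for $i=1$, green strings for $i=2$). For a vertex $v$ let $t_i(v)$ and $h_i(v)$ be the numbers of edges of its $i$-string before and after $v$. A red edge $(x,y)$ has the label $h_2(y)-h_2(x)$, and a green edge $(p,q)$ has the label $\frac12\,(h_1(q)-h_1(p))$. Write $x\xrightarrow{r,a}y$ and $x\xrightarrow{g,a}y$ for a red, respectively green, edge with label $a$. $G$ is an *R-graph of $B_2$-type* if (K0) and the following axioms hold. (K1) $t_2(x)-t_2(y)+h_2(y)-h_2(x)=1$ for red $(x,y)$; $t_1(p)-t_1(q)+h_1(q)-h_1(p)=2$ for green $(p,q)$. (K2) $t_2(x)\ge t_2(y)$ and $h_2(y)\ge h_2(x)$ for red $(x,y)$; $t_1(p)\ge t_1(q)$ and $h_1(q)\ge h_1(p)$ for green $(p,q)$. (So red labels lie in $\{0,1\}$ and green labels in $\{0,\frac12,1\}$.) (K3) Along every string the labels do not decrease. (K4) If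 $x\xrightarrow{r,a}y\xrightarrow{g,b}z$, then $a\ne b$, and if $a<b$, then $a=0$, $b=1$ and $x\xrightarrow{g,1}y'\xrightarrow{r,0}z$ for some $y'$. If $x\xrightarrow{g,b}y\xrightarrow{r,a}z$, then $a\neq b$, and if $b<a$, then $b=0$, $a=1$ and $x\xrightarrow{r,1}y'\xrightarrow{g,0}z$ for some $y'$. (K5) The following implications hold, and so do their duals, obtained by reversing all edges and replacing each label $a$ by $1-a$: (a) if $p\xrightarrow{g,1}q$ and $p\xrightarrow{r,1}p'\xrightarrow{g,0}s$, then there are $s',m,n,c$ with $s\xrightarrow{g,1}s'\xrightarrow{r,0}c$ and $q\xrightarrow{r,0}m\xrightarrow{r,1}n\xrightarrow{g,0}c$; (b) if $p\xrightarrow{g,1}q\xrightarrow{r,0}q'$ and $s\xrightarrow{g,1/2}q'$, then there are $u,v,z,m$ with $u\xrightarrow{r,1}v\xrightarrow{g,0}p$ and $u\xrightarrow{g,1/2}z\xrightarrow{r,0}m\xrightarrow{r,1}s$; (c) if $p\xrightarrow{g,1}q\xrightarrow{r,0}q_1\xrightarrow{r,0}q_2$ and $p\xrightarrow{r,1}p'\xrightarrow{g,1/2}s$,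 then there are $w_0,w_1,w_2,s'$ with $w_0\xrightarrow{r,1}w_1\xrightarrow{r,1}w_2$, $w_1\xrightarrow{g,1/2}q_1$, $w_2\xrightarrow{g,0}s'$ and $s\xrightarrow{r,0}s'$; (d) if $p\xrightarrow{g,1}q\xrightarrow{r,0}q_1\xrightarrow{r,1}q_2$ and $p\xrightarrow{r,1}p'\xrightarrow{g,1/2}s$, then there are vertices with $q_2\xrightarrow{g,0}d\xrightarrow{r,1}d_1\xrightarrow{g,1/2}d_2\xrightarrow{r,0}c$ and $s\xrightarrow{r,0}b\xrightarrow{g,1}b_1\xrightarrow{r,0}b_2\xrightarrow{r,1}b_3\xrightarrow{g,0}c$. **View from the sky.** In an R-graph each red string has exactly one *critical* vertex $c$: the red edges before $c$ are labelled $0$ and those after $c$ are labelled $1$. The view from the sky $\hat G$ of an R-graph $G$ is the following digraph with labelled edges and vertices. Its vertices are the red strings of $G$. A red string carries the label $(X,Y)=(t_1(c),h_1(c))$, where $c$ is its critical vertex. There is an edge labelled $a$ from $P$ to $P'$ iff some green edge of $G$ labelled $a$ goes from a vertex of $P$ to a vertex of $P'$. **The sails and $\hat K(H,A)$.** Let $H,A\ge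 0$ be integers. - $\hat K(H,0)$ has the vertices $(k,l)$ with $k,l\ge0$, $2k+l\le H$, and $(k,l)$ has the vertex label $(l,H-2k-l)$. Its edges are, whenever both ends exist, $(k,l)\to(k,l+1)$ labelled $\frac12$, $(k,l)\to(k+1,l)$ labelled $0$, and $(k+1,l)\to(k,l+2)$ labelled $1$. Its diagonal is $\{k=0\}$. - $\hat K(0,A)$ has the vertices $(k,i)$ with $k,i\ge 0$, $k+i\le A$, and $(k,i)$ has the vertex label $(k,k)$. Its edges are, whenever both ends exist, $(k,i)\to(k+1,i)$ labelled $1$ and $(k+1,i)\to(k,i+1)$ labelled $0$. Its diagonal is $\{k=0\}$. - Let $S$ and $T$ be the diagonals of $\hat K(H,0)$ and $\hat K(0,A)$. Then $\hat K(H,A)=\hat K(H,0)\boxtimes\hat K(0,A)$ is obtained from disjoint copies $\hat K(H,0)_t$ ($t\in T$) and $\hat K(0,A)_s$ ($s\in S$) by identifying the vertex $s$ of $\hat K(H,0)_t$ with the vertex $t$ of $\hat K(0,A)_s$, for all $s\in S$, $t\in T$. Edge labels are kept. Vertices of the copies of $\hat K(H,0)$ keep their labels, and $(l,H-l)$ is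 added to the labels of the copy of $\hat K(0,A)$ attached at $s=(0,l)$. An R-graph is called *a $K(H,A)$* if its view from the sky is isomorphic to $\hat K(H,A)$ as an edge- and vertex-labelled digraph. **Proposition 1.** 1. Every connected R-graph $G$ of $B_2$-type has exactly one source $s$ (vertex without ingoing edges), and $G$ is a $K(H,A)$ with $H=h_1(s)$ and $A=h_2(s)$, the lengths of the red and green strings emanating from $s$. That is, $\hat G\cong\hat K(H,0)\boxtimes\hat K(0,A)$. 2. Conversely, for all integers $H,A\ge 0$ a $K(H,A)$ exists. Every $K(H,A)$ is connected, and the red and green strings emanating from its source have lengths $H$ and $A$. 3. An R-graph is reconstructed from its view from the sky: for R-graphs $G,G'$, every isomorphism $\hat G\to\hat G'$ of edge- and vertex-labelled digraphs is induced by exactly one isomorphism $G\to G'$ of edge-2-coloured digraphs. In particular $K(H,A)$ is unique up to isomorphism. -/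

import Mathlib

universe u v

/-- A digraph on `V` whose edge set is split into red edges (colour 1) and green edges (colour 2). -/
structure BiDigraph (V : Type u) where
  red : V → V → Prop
  green : V → V → Prop

/-- Number of vertices strictly after `x` along directed edges of `R`. When the component of `x`
is a finite path, this is the number of edges of the part of the path from `x` to its end. -/
noncomputable def outLen {V : Type u} (R : V → V → Prop) (x : V) : ℕ :=
  {y | Relation.TransGen R x y}.ncard

/-- Number of vertices strictly before `x` along directed edges of `R`. -/
noncomputable def inLen {V : Type u} (R : V → V → Prop) (x : V) : ℕ :=
  {y | Relation.TransGen R y x}.ncard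

/-- Each weakly connected component of the digraph `R` is a finite simple directed path
`p 0 → p 1 → ⋯ → p k`, with no other edge. -/
def ComponentsAreFinitePaths {V : Type u} (R : V → V → Prop) : Prop :=
  ∀ x : V, ∃ (k : ℕ) (p : Fin (k + 1) → V),
    Function.Injective p ∧ Set.range p = {y | Relation.EqvGen R x y} ∧
      ∀ i j : Fin (k + 1), R (p i) (p j) ↔ (j : ℕ) = (i : ℕ) + 1

namespace BiDigraph

variable {V : Type u} (G : BiDigraph V)

/-- Lengths of the parts of the monochromatic strings after (`h`) and before (`t`) a vertex. -/
noncomputable def h1 (x : V) : ℕ := outLen G.red x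
noncomputable def t1 (x : V) : ℕ := inLen G.red x
noncomputable def h2 (x : V) : ℕ := outLen G.green x
noncomputable def t2 (x : V) : ℕ := inLen G.green x

/-- Label of a red edge `(x, y)`. -/
noncomputable def redLabel (x y : V) : ℚ := (G.h2 y : ℚ) - (G.h2 x : ℚ)

/-- Label of a green edge `(x, y)`. -/
noncomputable def greenLabel (x y : V) : ℚ := ((G.h1 y : ℚ) - (G.h1 x : ℚ)) / 2

/-- `G.RedE a x y`: there is a red edge from `x` to `y`, and its label is `a`. -/
def RedE (a : ℚ) (x y : V) : Prop := G.red x y ∧ G.redLabel x y = a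

/-- `G.GreenE a x y`: there is a green edge from `x` to `y`, and its label is `a`. -/
def GreenE (a : ℚ) (x y : V) : Prop := G.green x y ∧ G.greenLabel x y = a

end BiDigraph

/-- The four local implications at a green edge labelled `1`, for labelled red edges `r` and
labelled green edges `g` (`r a x y`: a red edge labelled `a` from `x` to `y`). -/
structure LocalRelations {V : Type u} (r g : ℚ → V → V → Prop) : Prop where
  rel_a : ∀ p q p' s, g 1 p q → r 1 p p' → g 0 p' s →
    ∃ s' m n c, g 1 s s' ∧ r 0 s' c ∧ r 0 q m ∧ r 1 m n ∧ g 0 n c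
  rel_b : ∀ p q q' s, g 1 p q → r 0 q q' → g (1 / 2) s q' →
    ∃ u v z m, r 1 u v ∧ g 0 v p ∧ g (1 / 2) u z ∧ r 0 z m ∧ r 1 m s
  rel_c : ∀ p q q₁ q₂ p' s, g 1 p q → r 0 q q₁ → r 0 q₁ q₂ → r 1 p p' → g (1 / 2) p' s →
    ∃ w₀ w₁ w₂ s', r 1 w₀ w₁ ∧ r 1 w₁ w₂ ∧ g (1 / 2) w₁ q₁ ∧ g 0 w₂ s' ∧ r 0 s s'
  rel_verma : ∀ p q q₁ q₂ p' s, g 1 p q → r 0 q q₁ → r 1 q₁ q₂ → r 1 p p' → g (1 / 2) p' s →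
    ∃ d d₁ d₂ b b₁ b₂ b₃ c,
      g 0 q₂ d ∧ r 1 d d₁ ∧ g (1 / 2) d₁ d₂ ∧ r 0 d₂ c ∧
      r 0 s b ∧ g 1 b b₁ ∧ r 0 b₁ b₂ ∧ r 1 b₂ b₃ ∧ g 0 b₃ c

namespace BiDigraph

variable {V : Type u} (G : BiDigraph V)

/-- Axioms (K0)-(K5): `G` is an R-graph of `B₂`-type. -/
structure IsRGraph : Prop where
  k0_red : ComponentsAreFinitePaths G.red
  k0_green : ComponentsAreFinitePaths G.green
  k1_red : ∀ x y, G.red x y →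
    (G.t2 x : ℤ) - (G.t2 y : ℤ) + (G.h2 y : ℤ) - (G.h2 x : ℤ) = 1
  k1_green : ∀ p q, G.green p q →
    (G.t1 p : ℤ) - (G.t1 q : ℤ) + (G.h1 q : ℤ) - (G.h1 p : ℤ) = 2
  k2_red : ∀ x y, G.red x y → G.t2 y ≤ G.t2 x ∧ G.h2 x ≤ G.h2 y
  k2_green : ∀ p q, G.green p q → G.t1 q ≤ G.t1 p ∧ G.h1 p ≤ G.h1 q
  k3_red : ∀ x y z, G.red x y → G.red y z → G.redLabel x y ≤ G.redLabel y z
  k3_green : ∀ x y z, G.green x y → G.green y z → G.greenLabel x y ≤ G.greenLabel y z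
  k4_red_green : ∀ (a b : ℚ) (x y z : V), G.RedE a x y → G.GreenE b y z →
    a ≠ b ∧ (a < b → a = 0 ∧ b = 1 ∧ ∃ y', G.GreenE 1 x y' ∧ G.RedE 0 y' z)
  k4_green_red : ∀ (a b : ℚ) (x y z : V), G.GreenE b x y → G.RedE a y z →
    a ≠ b ∧ (b < a → a = 1 ∧ b = 0 ∧ ∃ y', G.RedE 1 x y' ∧ G.GreenE 0 y' z)
  k5 : LocalRelations G.RedE G.GreenE
  /-- The dual implications: all edges are reversed and each label `a` is replaced by `1 - a`. -/
  k5_dual : LocalRelations (fun a x y => G.RedE (1 - a) y x) (fun a x y => G.GreenE (1 - a) y x)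

/-- (Weak) connectedness of the whole graph. -/
def IsConnected : Prop :=
  Nonempty V ∧ ∀ x y : V, Relation.EqvGen (fun p q => G.red p q ∨ G.green p q) x y

/-- A source: a vertex without ingoing edges. -/
def IsSource (s : V) : Prop := ∀ x : V, ¬ G.red x s ∧ ¬ G.green x s

/-- Isomorphisms of edge-2-coloured digraphs. -/
structure Iso {V : Type u} {W : Type v} (G : BiDigraph V) (G' : BiDigraph W) extends V ≃ W where
  red_iff : ∀ x y, G'.red (toFun x) (toFun y) ↔ G.red x y
  green_iff : ∀ x y, G'.green (toFun x) (toFun y) ↔ G.green x y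

/-- A vertex of a red string at which the labels switch from `0` to `1`. -/
def IsCritical (c : V) : Prop :=
  (∀ x, G.red x c → G.redLabel x c = 0) ∧ (∀ y, G.red c y → G.redLabel c y = 1)

/-- The red strings: the weakly connected components of the red graph. -/
abbrev RedString : Type u := Quot G.red

/-- The critical vertex of a red string. -/
noncomputable def criticalVertex (q : G.RedString) : V :=
  haveI : Nonempty V := ⟨q.out⟩
  Classical.epsilon fun c : V => Quot.mk G.red c = q ∧ G.IsCritical c

end BiDigraph

/-- A digraph with edge labels in `ℚ` (`E x a y`: an edge labelled `a` from `x` to `y`) and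
a pair `(X, Y)` of vertex labels. -/
structure SkyGraph (W : Type u) where
  E : W → ℚ → W → Prop
  X : W → ℕ
  Y : W → ℕ

/-- Isomorphisms of edge- and vertex-labelled digraphs. -/
structure SkyGraph.Iso {W : Type u} {W' : Type v} (S : SkyGraph W) (S' : SkyGraph W')
    extends W ≃ W' where
  edge_iff : ∀ x a y, S'.E (toFun x) a (toFun y) ↔ S.E x a y
  X_eq : ∀ x, S'.X (toFun x) = S.X x
  Y_eq : ∀ x, S'.Y (toFun x) = S.Y x

/-- The view from the sky on `G` along red strings. -/
noncomputable def BiDigraph.view {V : Type u} (G : BiDigraph V) : SkyGraph G.RedString where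
  E p a q := ∃ x y : V, Quot.mk G.red x = p ∧ Quot.mk G.red y = q ∧ G.GreenE a x y
  X q := G.t1 (G.criticalVertex q)
  Y q := G.h1 (G.criticalVertex q)

/-- Vertices `(k, l)` of the upper sail `K̂(H,0)`: the `l`-th vertex at the etage `k`. -/
abbrev UpperVertex (H : ℕ) : Type := {x : ℕ × ℕ // 2 * x.1 + x.2 ≤ H}

/-- The upper sail `K̂(H,0)`; the vertex `(k, l)` is the red path `(l, H - 2k - l)`. -/
def upperSail (H : ℕ) : SkyGraph (UpperVertex H) where
  E x a y :=
    (a = 1 / 2 ∧ y.1.1 = x.1.1 ∧ y.1.2 = x.1.2 + 1) ∨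
    (a = 0 ∧ y.1.1 = x.1.1 + 1 ∧ y.1.2 = x.1.2) ∨
    (a = 1 ∧ x.1.1 = y.1.1 + 1 ∧ y.1.2 = x.1.2 + 2)
  X x := x.1.2
  Y x := H - 2 * x.1.1 - x.1.2

/-- The diagonal of the upper sail: its ground floor. -/
def upperDiagonal (H : ℕ) : Set (UpperVertex H) := {x | x.1.1 = 0}

/-- Vertices `(k, i)` of the lower sail `K̂(0,A)`: the `i`-th vertex at depth `k`. -/
abbrev LowerVertex (A : ℕ) : Type := {x : ℕ × ℕ // x.1 + x.2 ≤ A}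

/-- The lower sail `K̂(0,A)`, a triangular grid; the vertex `(k, i)` is the red path `(k, k)`. -/
def lowerSail (A : ℕ) : SkyGraph (LowerVertex A) where
  E x a y :=
    (a = 1 ∧ y.1.1 = x.1.1 + 1 ∧ y.1.2 = x.1.2) ∨
    (a = 0 ∧ x.1.1 = y.1.1 + 1 ∧ y.1.2 = x.1.2 + 1)
  X x := x.1.1
  Y x := x.1.1

/-- The diagonal of the lower sail: its top etage. -/
def lowerDiagonal (A : ℕ) : Set (LowerVertex A) := {x | x.1.1 = 0}

section Glue

variable {V : Type u} {W : Type v} (S : Set V) (T : Set W)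

/-- Identification of the vertex `s` of the copy `V_t` with the vertex `t` of the copy `W_s`. -/
inductive GlueRel : (V × T) ⊕ (W × S) → (V × T) ⊕ (W × S) → Prop
  | glue (s : S) (t : T) : GlueRel (Sum.inl (s.1, t)) (Sum.inr (t.1, s))

/-- Vertices of the glued product: `|T|` copies of `V` and `|S|` copies of `W`, identified. -/
abbrev GlueVertex : Type (max u v) := Quot (GlueRel S T)

/-- Edges of the glued product `(V, S) ⊠ (W, T)`: those of all the copies. -/
def glueEdge (E : V → ℚ → V → Prop) (F : W → ℚ → W → Prop)
    (p : GlueVertex S T) (a : ℚ) (q : GlueVertex S T) : Prop :=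
  (∃ (t : T) (x y : V), E x a y ∧
    p = Quot.mk _ (Sum.inl (x, t)) ∧ q = Quot.mk _ (Sum.inl (y, t))) ∨
  (∃ (s : S) (x y : W), F x a y ∧
    p = Quot.mk _ (Sum.inr (x, s)) ∧ q = Quot.mk _ (Sum.inr (y, s)))

end Glue

/-- Vertices of `K̂(H,A)`. -/
abbrev SkyVertex (H A : ℕ) : Type := GlueVertex (upperDiagonal H) (lowerDiagonal A)

/-- `K̂(H,A) = K̂(H,0) ⊠ K̂(0,A)`. A vertex of a copy of `K̂(H,0)` keeps its label, and
`(l, H - l)` is added to the labels of the copy of `K̂(0,A)` attached to the `l`-th vertex of the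
diagonal of `K̂(H,0)`. -/
def skyK (H A : ℕ) : SkyGraph (SkyVertex H A) where
  E := glueEdge (upperDiagonal H) (lowerDiagonal A) (upperSail H).E (lowerSail A).E
  X := Quot.lift
    (Sum.elim (fun x => (upperSail H).X x.1) (fun y => (lowerSail A).X y.1 + y.2.1.1.2))
    (by
      rintro _ _ ⟨⟨⟨⟨k, l⟩, hx⟩, hs⟩, ⟨⟨⟨k', i⟩, hy⟩, ht⟩⟩
      simp only [lowerDiagonal, Set.mem_ofPred_eq] at ht
      simp [upperSail, lowerSail, ht])
  Y := Quot.lift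
    (Sum.elim (fun x => (upperSail H).Y x.1) (fun y => (lowerSail A).Y y.1 + (H - y.2.1.1.2)))
    (by
      rintro _ _ ⟨⟨⟨⟨k, l⟩, hx⟩, hs⟩, ⟨⟨⟨k', i⟩, hy⟩, ht⟩⟩
      simp only [lowerDiagonal, Set.mem_ofPred_eq] at ht
      simp only [upperDiagonal, Set.mem_ofPred_eq] at hs
      simp [upperSail, lowerSail, ht, hs])

/-- `G` is (a copy of) `K(H,A)`: an R-graph whose view from the sky is `K̂(H,A)`. -/
def IsK {V : Type u} (H A : ℕ) (G : BiDigraph V) : Prop :=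
  G.IsRGraph ∧ Nonempty (SkyGraph.Iso G.view (skyK H A))

-- By (K0) a vertex is known from its red string and its position `t1` there. (K1)-(K3) make the red
-- labels 0 up to one critical vertex and 1 after it. (K4) then forces label 1 on green edges
-- leaving vertices up to the critical one and label 0 on green edges entering vertices from the
-- critical one on; it also lets these edges slide in parallel along a string. The relations (K5)
-- pin an edge labelled 1/2 to one place: it leaves the vertex just after a critical vertex and
-- enters the vertex just before one (`Gh_source`, `Gh_target`). Hence the green edges can be read
-- off the view from the sky (`green_iff`), which gives the reconstruction statement
-- `existsUnique_iso`.
--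
-- The view satisfies a short list of axioms, `SkySystem`: each label defines a partial injection;
-- an edge changes X, Y and the numbers A, B of green edges before and after the critical vertex in
-- a prescribed way; edges exist when these ranks permit; and (K5) becomes a set of relations
-- between strings. An edge labelled 1 belongs to an upper sail exactly when its head is also
-- entered by an edge labelled 1/2, and dually for label 0. From a string with X = A = 0, following
-- edges produces all vertices and edges of the sky graph in coordinates. The ranks separate these
-- vertices and the image is closed under edges in both directions, so connectedness makes it
-- everything (`coordIso`). A weighted rank that can always be lowered yields sources; there is only
-- one because the sky graph has a single vertex without ingoing edges.
--
-- For existence, `modelK` adds a position `j` on the string to the coordinates of the sky graph.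
-- Its axioms are linear arithmetic, and an edge-reversing involution supplies the dual half of
-- (K5). Its view need not be computed: the model has one source, and the classification of
-- connected R-graphs applies to it.

universe w

/-! ### Disjoint unions of finite paths, described by two rank functions. -/

lemma Relation.ReflTransGen.eqvGen {V : Type u} {R : V → V → Prop} {x y : V}
    (h : Relation.ReflTransGen R x y) : Relation.EqvGen R x y := by
  induction h with
  | refl => exact .refl _
  | tail _ h ih => exact .trans _ _ _ ih (.rel _ _ h)

/-- `R` is a partial injection along which the rank `t` grows and the rank `h` falls by one,
and which is defined as long as the ranks permit. -/
structure RankedPaths {V : Type u} (R : V → V → Prop) (t h : V → ℕ) : Prop where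
  func : ∀ {x y z}, R x y → R x z → y = z
  inj : ∀ {x y z}, R x z → R y z → x = y
  out_rank : ∀ {x y}, R x y → h x = h y + 1
  in_rank : ∀ {x y}, R x y → t y = t x + 1
  exists_out : ∀ {x}, 0 < h x → ∃ y, R x y
  exists_in : ∀ {x}, 0 < t x → ∃ y, R y x

namespace RankedPaths

variable {V : Type u} {R : V → V → Prop} {t h : V → ℕ}

lemma swap (H : RankedPaths R t h) : RankedPaths (fun x y => R y x) h t where
  func := fun a b => H.inj a b
  inj := fun a b => H.func a b
  out_rank := fun a => H.in_rank a
  in_rank := fun a => H.out_rank a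
  exists_out := fun a => H.exists_in a
  exists_in := fun a => H.exists_out a

lemma lt_of_transGen (H : RankedPaths R t h) {x y : V} (hxy : Relation.TransGen R x y) :
    t x < t y := by
  induction hxy with
  | single h => have := H.in_rank h; omega
  | tail _ h ih => have := H.in_rank h; omega

lemma transGen_finite_ncard (H : RankedPaths R t h) (n : ℕ) : ∀ x, h x = n →
    {y | Relation.TransGen R x y}.Finite ∧ {y | Relation.TransGen R x y}.ncard = n := by
  induction n with
  | zero =>
    intro x hx
    have : {y | Relation.TransGen R x y} = ∅ := by
      ext y
      simp only [Set.mem_ofPred_eq, Set.mem_empty_iff_false, iff_false]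
      intro hy
      obtain ⟨z, hz, -⟩ := (Relation.TransGen.head'_iff).1 hy
      have := H.out_rank hz
      omega
    rw [this]
    simp
  | succ n ih =>
    intro x hx
    obtain ⟨y, hy⟩ := H.exists_out (x := x) (by omega)
    have hyn : h y = n := by have := H.out_rank hy; omega
    obtain ⟨hf, hc⟩ := ih y hyn
    have heq : {z | Relation.TransGen R x z} = insert y {z | Relation.TransGen R y z} := by
      ext z
      simp only [Set.mem_ofPred_eq, Set.mem_insert_iff]
      constructor
      · intro hz
        obtain ⟨w, hw, hwz⟩ := (Relation.TransGen.head'_iff).1 hz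
        obtain rfl := H.func hy hw
        rcases Relation.reflTransGen_iff_eq_or_transGen.1 hwz with h | h
        · exact Or.inl h
        · exact Or.inr h
      · rintro (rfl | hz)
        · exact Relation.TransGen.single hy
        · exact Relation.TransGen.head hy hz
    rw [heq]
    refine ⟨hf.insert _, ?_⟩
    rw [Set.ncard_insert_of_notMem _ hf, hc]
    intro hyy
    exact lt_irrefl _ (H.lt_of_transGen hyy)

/-- The relation determines its ranks. Ranks given by a formula or carried over by an isomorphism
are thereby recognized as the counted lengths. -/
lemma outLen_eq (H : RankedPaths R t h) (x : V) : outLen R x = h x :=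
  (H.transGen_finite_ncard _ x rfl).2

lemma inLen_eq (H : RankedPaths R t h) (x : V) : inLen R x = t x := by
  have := (H.swap.transGen_finite_ncard _ x rfl).2
  rw [← this]
  unfold inLen
  congr 1
  ext y
  exact (Relation.transGen_swap (r := R)).symm

lemma add_eq_of_eqvGen (H : RankedPaths R t h) {x y : V} (hxy : Relation.EqvGen R x y) :
    t x + h x = t y + h y := by
  induction hxy with
  | rel x y h => have := H.in_rank h; have := H.out_rank h; omega
  | refl => rfl
  | symm _ _ _ ih => exact ih.symm
  | trans _ _ _ _ _ h1 h2 => exact h1.trans h2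

lemma exists_forward (H : RankedPaths R t h) (n : ℕ) : ∀ x, n ≤ h x →
    ∃ y, Relation.ReflTransGen R x y ∧ t y = t x + n := by
  induction n with
  | zero => exact fun x _ => ⟨x, .refl, rfl⟩
  | succ n ih =>
    intro x hx
    obtain ⟨y, hy, hty⟩ := ih x (by omega)
    have := H.add_eq_of_eqvGen hy.eqvGen
    obtain ⟨z, hz⟩ := H.exists_out (x := y) (by omega)
    exact ⟨z, hy.tail hz, by rw [H.in_rank hz, hty]; rfl⟩

lemma exists_start (H : RankedPaths R t h) (n : ℕ) : ∀ x, t x = n →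
    ∃ y, Relation.ReflTransGen R y x ∧ t y = 0 := by
  induction n with
  | zero => exact fun x hx => ⟨x, .refl, hx⟩
  | succ n ih =>
    intro x hx
    obtain ⟨y, hy⟩ := H.exists_in (x := x) (by omega)
    obtain ⟨z, hz, h0⟩ := ih y (by have := H.in_rank hy; omega)
    exact ⟨z, hz.tail hy, h0⟩

/-- A backward step retraces the path from `s` by injectivity, and no such step leaves `s` because
its rank is zero. So the set reached from `s` is a whole weak component. -/
lemma reflTransGen_total (H : RankedPaths R t h) {s x y : V} (hx : Relation.ReflTransGen R s x)
    (hxy : R x y ∨ R y x) (hs : t s = 0) : Relation.ReflTransGen R s y := by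
  rcases hxy with hxy | hxy
  · exact hx.tail hxy
  · rcases Relation.ReflTransGen.cases_tail hx with rfl | ⟨z, hz, hzx⟩
    · have := H.in_rank hxy; omega
    · rwa [H.inj hxy hzx]

lemma reflTransGen_of_eqvGen (H : RankedPaths R t h) {x y : V} (hxy : Relation.EqvGen R x y) :
    ∀ s, t s = 0 → (Relation.ReflTransGen R s x ↔ Relation.ReflTransGen R s y) := by
  induction hxy with
  | rel x y h =>
    exact fun s hs => ⟨fun a => H.reflTransGen_total a (.inl h) hs,
      fun a => H.reflTransGen_total a (.inr h) hs⟩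
  | refl => exact fun _ _ => Iff.rfl
  | symm _ _ _ ih => exact fun s hs => (ih s hs).symm
  | trans _ _ _ _ _ h1 h2 => exact fun s hs => (h1 s hs).trans (h2 s hs)

lemma eq_of_reflTransGen (H : RankedPaths R t h) {s x : V} (hx : Relation.ReflTransGen R s x) :
    ∀ y, Relation.ReflTransGen R s y → t x = t y → x = y := by
  induction hx with
  | refl =>
    intro y hy hty
    rcases Relation.reflTransGen_iff_eq_or_transGen.1 hy with h | h
    · exact h.symm
    · have := H.lt_of_transGen h; omega
  | @tail b c hb hbc ih =>
    intro y hy hty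
    rcases Relation.ReflTransGen.cases_tail hy with rfl | ⟨z, hz, hzy⟩
    · have := H.lt_of_transGen (Relation.TransGen.tail' hb hbc); omega
    · have := H.in_rank hbc
      have := H.in_rank hzy
      obtain rfl := ih z hz (by omega)
      exact H.func hbc hzy

/-- Both vertices are reached from a common start, and along a functional relation the rank fixes
the vertex. Position is thus a coordinate on each component, and most identifications of vertices
below rest on this. -/
lemma eq_of_eqvGen (H : RankedPaths R t h) {x y : V} (hxy : Relation.EqvGen R x y)
    (ht : t x = t y) : x = y := by
  obtain ⟨s, hs, hs0⟩ := H.exists_start _ x rfl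
  exact H.eq_of_reflTransGen hs y ((H.reflTransGen_of_eqvGen hxy s hs0).1 hs) ht

lemma exists_eqvGen (H : RankedPaths R t h) (x : V) {j : ℕ} (hj : j ≤ t x + h x) :
    ∃ y, Relation.EqvGen R x y ∧ t y = j := by
  obtain ⟨s, hs, hs0⟩ := H.exists_start _ x rfl
  have := H.add_eq_of_eqvGen hs.eqvGen
  obtain ⟨y, hy, hty⟩ := H.exists_forward j s (by omega)
  exact ⟨y, .trans _ _ _ (.symm _ _ hs.eqvGen) hy.eqvGen, by omega⟩

lemma componentsAreFinitePaths (H : RankedPaths R t h) : ComponentsAreFinitePaths R := by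
  intro x
  have hex : ∀ i : Fin (t x + h x + 1), ∃ y, Relation.EqvGen R x y ∧ t y = i :=
    fun i => H.exists_eqvGen x (by omega)
  choose p hp hpt using hex
  refine ⟨t x + h x, p, fun i j hij => ?_, ?_, fun i j => ⟨fun hR => ?_, fun hij => ?_⟩⟩
  · ext
    rw [← hpt i, ← hpt j, hij]
  · ext y
    simp only [Set.mem_range, Set.mem_ofPred_eq]
    constructor
    · rintro ⟨i, rfl⟩; exact hp i
    · intro hy
      have := H.add_eq_of_eqvGen hy
      exact ⟨⟨t y, by omega⟩, H.eq_of_eqvGen (.trans _ _ _ (.symm _ _ (hp _)) hy) (hpt _)⟩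
  · have := H.in_rank hR
    rw [hpt, hpt] at this
    exact this
  · have := H.add_eq_of_eqvGen (hp i)
    have h1 := hpt i
    obtain ⟨y, hy⟩ := H.exists_out (x := p i) (by omega)
    have h2 := H.in_rank hy
    have : p j = y := H.eq_of_eqvGen
      (.trans _ _ _ (.trans _ _ _ (.symm _ _ (hp j)) (hp i)) (.rel _ _ hy)) (by
        rw [hpt, h2, hpt, hij])
    rwa [this]

end RankedPaths

lemma ComponentsAreFinitePaths.rankedPaths {V : Type u} {R : V → V → Prop}
    (hR : ComponentsAreFinitePaths R) : RankedPaths R (inLen R) (outLen R) := by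
  -- With the component of `x` indexed as a path, the ranks at index `j` are `j` and `k - j`, and
  -- all fields become statements about indices.
  have key : ∀ x : V, ∃ (k : ℕ) (p : Fin (k + 1) → V) (i : Fin (k + 1)), p i = x ∧
      Function.Injective p ∧ (∀ j y, R (p j) y ↔ ∃ m, p m = y ∧ (m : ℕ) = j + 1) ∧
      (∀ j y, R y (p j) ↔ ∃ m, p m = y ∧ (j : ℕ) = m + 1) ∧
      (∀ j, inLen R (p j) = j) ∧ (∀ j, outLen R (p j) = k - j) := by
    intro x
    obtain ⟨k, p, hinj, hrange, hp⟩ := hR x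
    have hmem : ∀ j, Relation.EqvGen R x (p j) := fun j => by
      have : p j ∈ Set.range p := ⟨j, rfl⟩
      rwa [hrange] at this
    have hran : ∀ y, Relation.EqvGen R x y → ∃ m, p m = y := fun y hy => by
      have : y ∈ {y | Relation.EqvGen R x y} := hy
      rwa [← hrange] at this
    obtain ⟨i, hi⟩ := hran x (.refl x)
    have hout : ∀ j y, R (p j) y ↔ ∃ m, p m = y ∧ (m : ℕ) = j + 1 := by
      refine fun j y => ⟨fun h => ?_, ?_⟩
      · obtain ⟨m, rfl⟩ := hran y (.trans _ _ _ (hmem j) (.rel _ _ h))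
        exact ⟨m, rfl, (hp _ _).1 h⟩
      · rintro ⟨m, rfl, h⟩
        exact (hp _ _).2 h
    have hin : ∀ j y, R y (p j) ↔ ∃ m, p m = y ∧ (j : ℕ) = m + 1 := by
      refine fun j y => ⟨fun h => ?_, ?_⟩
      · obtain ⟨m, rfl⟩ := hran y (.trans _ _ _ (hmem j) (.symm _ _ (.rel _ _ h)))
        exact ⟨m, rfl, (hp _ _).1 h⟩
      · rintro ⟨m, rfl, h⟩
        exact (hp _ _).2 h
    have hlt : ∀ (n : ℕ) (j m : Fin (k + 1)), (m : ℕ) = j + (n + 1) →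
        Relation.TransGen R (p j) (p m) := by
      intro n
      induction n with
      | zero => exact fun j m h => .single ((hp _ _).2 h)
      | succ n ih =>
        intro j m h
        exact .tail (ih j ⟨j + (n + 1), by omega⟩ rfl) ((hp _ _).2 (by simp only []; omega))
    have htr : ∀ j y, Relation.TransGen R (p j) y → ∃ m, p m = y ∧ j < m := by
      intro j y h
      induction h with
      | single h =>
        obtain ⟨m, rfl, h⟩ := (hout _ _).1 h
        exact ⟨m, rfl, by omega⟩
      | tail _ h ih =>
        obtain ⟨m, rfl, hm⟩ := ih
        obtain ⟨m', rfl, h⟩ := (hout _ _).1 h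
        exact ⟨m', rfl, by omega⟩
    have htr' : ∀ j y, Relation.TransGen R y (p j) → ∃ m, p m = y ∧ m < j := by
      intro j y h
      induction h using Relation.TransGen.head_induction_on with
      | single h =>
        obtain ⟨m, rfl, h⟩ := (hin _ _).1 h
        exact ⟨m, rfl, by omega⟩
      | head h _ ih =>
        obtain ⟨m, rfl, hm⟩ := ih
        obtain ⟨m', rfl, h⟩ := (hin _ _).1 h
        exact ⟨m', rfl, by omega⟩
    refine ⟨k, p, i, hi, hinj, hout, hin, fun j => ?_, fun j => ?_⟩
    · have : {y | Relation.TransGen R y (p j)} = p '' (Set.Iio j) := by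
        ext y
        simp only [Set.mem_ofPred_eq, Set.mem_image, Set.mem_Iio]
        constructor
        · intro h
          obtain ⟨m, hm, hlt⟩ := htr' j y h
          exact ⟨m, hlt, hm⟩
        · rintro ⟨m, hm, rfl⟩
          exact hlt (j - m - 1) m j (by omega)
      rw [inLen, this, Set.ncard_image_of_injective _ hinj, ← Finset.coe_Iio,
        Set.ncard_coe_finset, Fin.card_Iio]
    · have : {y | Relation.TransGen R (p j) y} = p '' (Set.Ioi j) := by
        ext y
        simp only [Set.mem_ofPred_eq, Set.mem_image, Set.mem_Ioi]
        constructor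
        · intro h
          obtain ⟨m, hm, hlt⟩ := htr j y h
          exact ⟨m, hlt, hm⟩
        · rintro ⟨m, hm, rfl⟩
          exact hlt (m - j - 1) j m (by omega)
      rw [outLen, this, Set.ncard_image_of_injective _ hinj, ← Finset.coe_Ioi,
        Set.ncard_coe_finset, Fin.card_Ioi]
      omega
  constructor
  · intro x y z hy hz
    obtain ⟨k, p, i, rfl, -, hout, -⟩ := key x
    obtain ⟨m, rfl, hm⟩ := (hout _ _).1 hy
    obtain ⟨m', rfl, hm'⟩ := (hout _ _).1 hz
    congr 1
    omega
  · intro x y z hx hy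
    obtain ⟨k, p, i, rfl, -, -, hin, -⟩ := key z
    obtain ⟨m, rfl, hm⟩ := (hin _ _).1 hx
    obtain ⟨m', rfl, hm'⟩ := (hin _ _).1 hy
    congr 1
    omega
  · intro x y hy
    obtain ⟨k, p, i, rfl, -, hout, -, -, ho⟩ := key x
    obtain ⟨m, rfl, hm⟩ := (hout _ _).1 hy
    rw [ho, ho]
    omega
  · intro x y hy
    obtain ⟨k, p, i, rfl, -, hout, -, hi, -⟩ := key x
    obtain ⟨m, rfl, hm⟩ := (hout _ _).1 hy
    rw [hi, hi]
    omega
  · intro x hx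
    obtain ⟨k, p, i, rfl, -, hout, -, -, ho⟩ := key x
    rw [ho] at hx
    exact ⟨p ⟨i + 1, by omega⟩, (hout _ _).2 ⟨_, rfl, rfl⟩⟩
  · intro x hx
    obtain ⟨k, p, i, rfl, -, -, hin, hi, -⟩ := key x
    rw [hi] at hx
    exact ⟨p ⟨i - 1, by omega⟩, (hin _ _).2 ⟨_, rfl, by simp only []; omega⟩⟩

/-! ### Integral labels, reversal of edges, and critical vertices. -/

namespace BiDigraph

variable {V : Type u} (G : BiDigraph V)

/-- Red edges labelled `0` and `1`, and green edges labelled `0`, `1/2` and `1`, without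
rational numbers. -/
def R0 (x y : V) : Prop := G.red x y ∧ G.h2 y = G.h2 x
def R1 (x y : V) : Prop := G.red x y ∧ G.h2 y = G.h2 x + 1
def G0 (x y : V) : Prop := G.green x y ∧ G.h1 y = G.h1 x
def Gh (x y : V) : Prop := G.green x y ∧ G.h1 y = G.h1 x + 1
def G1 (x y : V) : Prop := G.green x y ∧ G.h1 y = G.h1 x + 2

variable {G}

lemma redE_zero {x y : V} : G.RedE 0 x y ↔ G.R0 x y := by
  unfold RedE R0 redLabel
  refine and_congr_right fun _ => ?_
  rw [sub_eq_zero]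
  exact Nat.cast_inj

lemma redE_one {x y : V} : G.RedE 1 x y ↔ G.R1 x y := by
  unfold RedE R1 redLabel
  refine and_congr_right fun _ => ?_
  rw [sub_eq_iff_eq_add, add_comm]
  exact_mod_cast Iff.rfl

lemma greenE_zero {x y : V} : G.GreenE 0 x y ↔ G.G0 x y := by
  unfold GreenE G0 greenLabel
  refine and_congr_right fun _ => ?_
  rw [div_eq_zero_iff, sub_eq_zero]
  simp

lemma greenE_half {x y : V} : G.GreenE (1 / 2) x y ↔ G.Gh x y := by
  unfold GreenE Gh greenLabel
  refine and_congr_right fun _ => ?_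
  rw [div_left_inj' two_ne_zero, sub_eq_iff_eq_add, add_comm]
  exact_mod_cast Iff.rfl

lemma greenE_one {x y : V} : G.GreenE 1 x y ↔ G.G1 x y := by
  unfold GreenE G1 greenLabel
  refine and_congr_right fun _ => ?_
  rw [div_eq_one_iff_eq two_ne_zero, sub_eq_iff_eq_add, add_comm]
  exact_mod_cast Iff.rfl

variable (G) in
/-- The digraph with all edges reversed. -/
def op : BiDigraph V where
  red x y := G.red y x
  green x y := G.green y x

lemma outLen_swap (R : V → V → Prop) (x : V) : outLen (fun x y => R y x) x = inLen R x := by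
  unfold inLen outLen
  congr 1
  ext y
  exact Relation.transGen_swap (r := R)

lemma inLen_swap (R : V → V → Prop) (x : V) : inLen (fun x y => R y x) x = outLen R x :=
  (outLen_swap (fun x y => R y x) x).symm

@[simp] lemma op_h1 (x : V) : G.op.h1 x = G.t1 x := outLen_swap _ _
@[simp] lemma op_t1 (x : V) : G.op.t1 x = G.h1 x := inLen_swap _ _
@[simp] lemma op_h2 (x : V) : G.op.h2 x = G.t2 x := outLen_swap _ _
@[simp] lemma op_t2 (x : V) : G.op.t2 x = G.h2 x := inLen_swap _ _

lemma isCritical_iff {c : V} :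
    G.IsCritical c ↔ (∀ x, G.red x c → G.R0 x c) ∧ (∀ y, G.red c y → G.R1 c y) := by
  refine and_congr (forall_congr' fun x => ?_) (forall_congr' fun x => ?_)
  · rw [← redE_zero]
    exact ⟨fun h h' => ⟨h', h h'⟩, fun h h' => (h h').2⟩
  · rw [← redE_one]
    exact ⟨fun h h' => ⟨h', h h'⟩, fun h h' => (h h').2⟩

namespace IsRGraph

variable (hG : G.IsRGraph)
include hG

lemma red_paths : RankedPaths G.red G.t1 G.h1 := hG.k0_red.rankedPaths

lemma green_paths : RankedPaths G.green G.t2 G.h2 := hG.k0_green.rankedPaths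

/-- By (K1) the gain of `h2` and the loss of `t2` along a red edge add up to 1, and reversal
exchanges the two. -/
lemma op_redE (a : ℚ) (x y : V) : G.op.RedE a x y ↔ G.RedE (1 - a) y x := by
  unfold RedE redLabel
  refine and_congr_right fun h => ?_
  have := hG.k1_red _ _ h
  have h' : (G.t2 y : ℚ) - G.t2 x + G.h2 x - G.h2 y = 1 := by exact_mod_cast this
  rw [op_h2, op_h2]
  constructor <;> intro h2 <;> linarith

lemma op_greenE (a : ℚ) (x y : V) : G.op.GreenE a x y ↔ G.GreenE (1 - a) y x := by
  unfold GreenE greenLabel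
  refine and_congr_right fun h => ?_
  have := hG.k1_green _ _ h
  have h' : (G.t1 y : ℚ) - G.t1 x + G.h1 x - G.h1 y = 2 := by exact_mod_cast this
  rw [op_h1, op_h1]
  constructor <;> intro h2 <;> linarith

/-- The axioms are self-dual, so later facts about label 0, or about the part of a string before its
critical vertex, come from those about label 1 and the part after it, and conversely. -/
lemma op : G.op.IsRGraph where
  k0_red := hG.red_paths.swap.componentsAreFinitePaths
  k0_green := hG.green_paths.swap.componentsAreFinitePaths
  k1_red x y h := by
    have := hG.k1_red _ _ h
    simp only [op_h2, op_t2]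
    omega
  k1_green x y h := by
    have := hG.k1_green _ _ h
    simp only [op_h1, op_t1]
    omega
  k2_red x y h := by
    have := hG.k2_red _ _ h
    simp only [op_h2, op_t2]
    omega
  k2_green x y h := by
    have := hG.k2_green _ _ h
    simp only [op_h1, op_t1]
    omega
  k3_red x y z h h' := by
    have h1 := hG.k3_red _ _ _ h' h
    have h2 := (hG.op_redE _ _ _).1 ⟨h, rfl⟩
    have h3 := (hG.op_redE _ _ _).1 ⟨h', rfl⟩
    have := h2.2
    have := h3.2
    linarith
  k3_green x y z h h' := by
    have h1 := hG.k3_green _ _ _ h' h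
    have h2 := (hG.op_greenE _ _ _).1 ⟨h, rfl⟩
    have h3 := (hG.op_greenE _ _ _).1 ⟨h', rfl⟩
    have := h2.2
    have := h3.2
    linarith
  k4_red_green a b x y z h h' := by
    rw [hG.op_redE] at h
    rw [hG.op_greenE] at h'
    obtain ⟨h1, h2⟩ := hG.k4_green_red _ _ _ _ _ h' h
    refine ⟨fun hab => h1 (by rw [hab]), fun hab => ?_⟩
    obtain ⟨ha, hb, y', h3, h4⟩ := h2 (by linarith)
    refine ⟨by linarith, by linarith, y', ?_, ?_⟩
    · rw [hG.op_greenE]; simpa using h4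
    · rw [hG.op_redE]; simpa using h3
  k4_green_red a b x y z h h' := by
    rw [hG.op_redE] at h'
    rw [hG.op_greenE] at h
    obtain ⟨h1, h2⟩ := hG.k4_red_green _ _ _ _ _ h' h
    refine ⟨fun hab => h1 (by rw [hab]), fun hab => ?_⟩
    obtain ⟨ha, hb, y', h3, h4⟩ := h2 (by linarith)
    refine ⟨by linarith, by linarith, y', ?_, ?_⟩
    · rw [hG.op_redE]; simpa using h4
    · rw [hG.op_greenE]; simpa using h3
  k5 := by
    have h1 : G.op.RedE = fun a x y => G.RedE (1 - a) y x := by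
      funext a x y; exact propext (hG.op_redE a x y)
    have h2 : G.op.GreenE = fun a x y => G.GreenE (1 - a) y x := by
      funext a x y; exact propext (hG.op_greenE a x y)
    rw [h1, h2]
    exact hG.k5_dual
  k5_dual := by
    have h1 : (fun a x y => G.op.RedE (1 - a) y x) = G.RedE := by
      funext a x y
      rw [hG.op_redE, sub_sub_cancel]
    have h2 : (fun a x y => G.op.GreenE (1 - a) y x) = G.GreenE := by
      funext a x y
      rw [hG.op_greenE, sub_sub_cancel]
    rw [h1, h2]
    exact hG.k5

lemma op_R0 {x y : V} : G.op.R0 x y ↔ G.R1 y x := by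
  rw [← redE_zero, ← redE_one, hG.op_redE, sub_zero]

lemma op_R1 {x y : V} : G.op.R1 x y ↔ G.R0 y x := by
  rw [← redE_zero, ← redE_one, hG.op_redE, sub_self]

lemma op_G0 {x y : V} : G.op.G0 x y ↔ G.G1 y x := by
  rw [← greenE_zero, ← greenE_one, hG.op_greenE, sub_zero]

lemma op_G1 {x y : V} : G.op.G1 x y ↔ G.G0 y x := by
  rw [← greenE_zero, ← greenE_one, hG.op_greenE, sub_self]

lemma op_Gh {x y : V} : G.op.Gh x y ↔ G.Gh y x := by
  rw [← greenE_half, ← greenE_half, hG.op_greenE]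
  norm_num

lemma red_cases {x y : V} (h : G.red x y) : G.R0 x y ∨ G.R1 x y := by
  have := hG.k1_red _ _ h
  have := hG.k2_red _ _ h
  have : G.h2 y = G.h2 x ∨ G.h2 y = G.h2 x + 1 := by omega
  exact this.imp (⟨h, ·⟩) (⟨h, ·⟩)

lemma green_cases {x y : V} (h : G.green x y) : G.G0 x y ∨ G.Gh x y ∨ G.G1 x y := by
  have := hG.k1_green _ _ h
  have := hG.k2_green _ _ h
  have : G.h1 y = G.h1 x ∨ G.h1 y = G.h1 x + 1 ∨ G.h1 y = G.h1 x + 2 := by omega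
  exact this.imp (⟨h, ·⟩) (Or.imp (⟨h, ·⟩) (⟨h, ·⟩))

lemma R0_rank {x y : V} (h : G.R0 x y) :
    G.h2 y = G.h2 x ∧ G.t2 x = G.t2 y + 1 ∧ G.t1 y = G.t1 x + 1 ∧ G.h1 x = G.h1 y + 1 := by
  have := hG.k1_red _ _ h.1
  have := h.2
  exact ⟨h.2, by omega, hG.red_paths.in_rank h.1, hG.red_paths.out_rank h.1⟩

lemma R1_rank {x y : V} (h : G.R1 x y) :
    G.h2 y = G.h2 x + 1 ∧ G.t2 x = G.t2 y ∧ G.t1 y = G.t1 x + 1 ∧ G.h1 x = G.h1 y + 1 := by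
  have := hG.k1_red _ _ h.1
  have := h.2
  exact ⟨h.2, by omega, hG.red_paths.in_rank h.1, hG.red_paths.out_rank h.1⟩

lemma G0_rank {x y : V} (h : G.G0 x y) :
    G.h1 y = G.h1 x ∧ G.t1 x = G.t1 y + 2 ∧ G.t2 y = G.t2 x + 1 ∧ G.h2 x = G.h2 y + 1 := by
  have := hG.k1_green _ _ h.1
  have := h.2
  exact ⟨h.2, by omega, hG.green_paths.in_rank h.1, hG.green_paths.out_rank h.1⟩

lemma Gh_rank {x y : V} (h : G.Gh x y) :
    G.h1 y = G.h1 x + 1 ∧ G.t1 x = G.t1 y + 1 ∧ G.t2 y = G.t2 x + 1 ∧ G.h2 x = G.h2 y + 1 := by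
  have := hG.k1_green _ _ h.1
  have := h.2
  exact ⟨h.2, by omega, hG.green_paths.in_rank h.1, hG.green_paths.out_rank h.1⟩

lemma G1_rank {x y : V} (h : G.G1 x y) :
    G.h1 y = G.h1 x + 2 ∧ G.t1 x = G.t1 y ∧ G.t2 y = G.t2 x + 1 ∧ G.h2 x = G.h2 y + 1 := by
  have := hG.k1_green _ _ h.1
  have := h.2
  exact ⟨h.2, by omega, hG.green_paths.in_rank h.1, hG.green_paths.out_rank h.1⟩

lemma R0_G0 {x y z : V} (h : G.R0 x y) : ¬ G.G0 y z := fun h' =>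
  (hG.k4_red_green _ _ _ _ _ (redE_zero.2 h) (greenE_zero.2 h')).1 rfl

lemma R1_G1 {x y z : V} (h : G.R1 x y) : ¬ G.G1 y z := fun h' =>
  (hG.k4_red_green _ _ _ _ _ (redE_one.2 h) (greenE_one.2 h')).1 rfl

/-- In (K4) a red label below the following green one forces the green one to be 1. -/
lemma R0_Gh {x y z : V} (h : G.R0 x y) : ¬ G.Gh y z := fun h' => by
  have := ((hG.k4_red_green _ _ _ _ _ (redE_zero.2 h) (greenE_half.2 h')).2 (by norm_num)).2.1
  norm_num at this

lemma R0_G1 {x y z : V} (h : G.R0 x y) (h' : G.G1 y z) : ∃ y', G.G1 x y' ∧ G.R0 y' z := by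
  obtain ⟨y', h1, h2⟩ :=
    ((hG.k4_red_green _ _ _ _ _ (redE_zero.2 h) (greenE_one.2 h')).2 (by norm_num)).2.2
  exact ⟨y', greenE_one.1 h1, redE_zero.1 h2⟩

lemma op_isCritical {c : V} : G.op.IsCritical c ↔ G.IsCritical c := by
  rw [isCritical_iff, isCritical_iff, and_comm]
  refine and_congr (forall_congr' fun x => ?_) (forall_congr' fun x => ?_)
  · rw [hG.op_R1]; rfl
  · rw [hG.op_R0]; rfl

/-- Walk backwards along edges labelled 1 until the string begins or an edge labelled 0 comes in.
The end of a string satisfies the hypothesis trivially. -/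
lemma exists_isCritical_of_out (n : ℕ) : ∀ x, G.t1 x = n → (∀ y, G.red x y → G.R1 x y) →
    ∃ c, Relation.EqvGen G.red x c ∧ G.IsCritical c := by
  induction n with
  | zero =>
    intro x hx hout
    refine ⟨x, .refl _, isCritical_iff.2 ⟨fun y hy => ?_, hout⟩⟩
    have := hG.red_paths.in_rank hy
    omega
  | succ n ih =>
    intro x hx hout
    obtain ⟨y, hy⟩ := hG.red_paths.exists_in (x := x) (by omega)
    have := hG.red_paths.in_rank hy
    rcases hG.red_cases hy with h | h
    · refine ⟨x, .refl _, isCritical_iff.2 ⟨fun z hz => ?_, hout⟩⟩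
      rwa [hG.red_paths.inj hz hy]
    · obtain ⟨c, hc, hcc⟩ := ih y (by omega) (fun z hz => by rwa [hG.red_paths.func hz hy])
      exact ⟨c, .trans _ _ _ (.symm _ _ (.rel _ _ hy)) hc, hcc⟩

lemma exists_isCritical (n : ℕ) : ∀ x, G.h1 x = n →
    ∃ c, Relation.EqvGen G.red x c ∧ G.IsCritical c := by
  induction n with
  | zero =>
    intro x hx
    refine hG.exists_isCritical_of_out _ x rfl fun y hy => ?_
    have := hG.red_paths.out_rank hy
    omega
  | succ n ih =>
    intro x hx
    obtain ⟨y, hy⟩ := hG.red_paths.exists_out (x := x) (by omega)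
    obtain ⟨c, hc, hcc⟩ := ih y (by have := hG.red_paths.out_rank hy; omega)
    exact ⟨c, .trans _ _ _ (.rel _ _ hy) hc, hcc⟩

lemma R1_of_R1_red {x y z : V} (h : G.R1 x y) (h' : G.red y z) : G.R1 y z := by
  rcases hG.red_cases h' with h2 | h2
  · have h3 := hG.k3_red _ _ _ h.1 h'
    rw [(redE_one.2 h).2, (redE_zero.2 h2).2] at h3
    norm_num at h3
  · exact h2

lemma ranks_after_critical {c : V} (hc : G.IsCritical c) (n : ℕ) : ∀ x,
    Relation.EqvGen G.red c x → G.t1 x = G.t1 c + n →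
    (∀ y, G.red x y → G.R1 x y) ∧ G.t2 x = G.t2 c ∧ G.h2 x = G.h2 c + n := by
  induction n with
  | zero =>
    intro x hx ht
    obtain rfl := hG.red_paths.eq_of_eqvGen hx ht.symm
    exact ⟨(isCritical_iff.1 hc).2, rfl, rfl⟩
  | succ n ih =>
    intro x hx ht
    obtain ⟨y, hy⟩ := hG.red_paths.exists_in (x := x) (by omega)
    obtain ⟨h1, h2, h3⟩ := ih y (.trans _ _ _ hx (.symm _ _ (.rel _ _ hy)))
      (by have := hG.red_paths.in_rank hy; omega)
    have := hG.R1_rank (h1 x hy)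
    exact ⟨fun z hz => hG.R1_of_R1_red (h1 x hy) hz, by omega, by omega⟩

end IsRGraph

/-! ### Ranks along a red string, relative to its critical vertex. -/

variable (G) in
/-- Two vertices on the same red string. -/
def Same (x y : V) : Prop := Relation.EqvGen G.red x y

lemma same_iff {x y : V} : G.Same x y ↔ Quot.mk G.red x = Quot.mk G.red y :=
  Quot.eq.symm

lemma Same.refl (x : V) : G.Same x x := Relation.EqvGen.refl x
lemma Same.symm {x y : V} (h : G.Same x y) : G.Same y x := Relation.EqvGen.symm _ _ h
lemma Same.trans {x y z : V} (h : G.Same x y) (h' : G.Same y z) : G.Same x z :=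
  Relation.EqvGen.trans _ _ _ h h'
lemma Same.of_red {x y : V} (h : G.red x y) : G.Same x y := .rel _ _ h
lemma R0.same {x y : V} (h : G.R0 x y) : G.Same x y := .rel _ _ h.1
lemma R1.same {x y : V} (h : G.R1 x y) : G.Same x y := .rel _ _ h.1

lemma op_same {x y : V} : G.op.Same x y ↔ G.Same x y := by
  have key : ∀ G : BiDigraph V, G.op.Same x y → G.Same x y := fun G h => by
    induction h with
    | rel x y h => exact Same.symm (Same.of_red (G := G) h)
    | refl => exact Same.refl _
    | symm _ _ _ ih => exact ih.symm
    | trans _ _ _ _ _ h1 h2 => exact h1.trans h2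
  exact ⟨key G, key G.op⟩

variable (G) in
/-- The critical vertex of the red string through a vertex. -/
noncomputable def crit (x : V) : V := G.criticalVertex (Quot.mk G.red x)

variable (G) in
/-- The ranks of the critical vertex of the red string through a vertex. -/
noncomputable def cX (x : V) : ℕ := G.t1 (G.crit x)
variable (G) in
noncomputable def cY (x : V) : ℕ := G.h1 (G.crit x)
variable (G) in
noncomputable def cA (x : V) : ℕ := G.t2 (G.crit x)
variable (G) in
noncomputable def cB (x : V) : ℕ := G.h2 (G.crit x)

lemma Same.crit_eq {x y : V} (h : G.Same x y) : G.crit x = G.crit y := by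
  unfold crit
  rw [same_iff.1 h]

namespace IsRGraph

variable (hG : G.IsRGraph)
include hG

lemma crit_spec (x : V) : G.Same x (G.crit x) ∧ G.IsCritical (G.crit x) := by
  obtain ⟨c, hc, hcc⟩ := hG.exists_isCritical _ x rfl
  have : Quot.mk G.red (G.crit x) = Quot.mk G.red x ∧ G.IsCritical (G.crit x) := by
    unfold crit criticalVertex
    exact Classical.epsilon_spec (p := fun c => Quot.mk G.red c = Quot.mk G.red x ∧
      G.IsCritical c) ⟨c, (same_iff.1 hc).symm, hcc⟩
  exact ⟨same_iff.2 this.1.symm, this.2⟩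

lemma same_crit (x : V) : G.Same x (G.crit x) := (hG.crit_spec x).1

lemma isCritical_crit (x : V) : G.IsCritical (G.crit x) := (hG.crit_spec x).2

/-- The edge into the later of two critical vertices would be labelled 0 by criticality of its head,
and 1 because by (K3) the label 1 persists after the earlier one. -/
lemma eq_of_isCritical {c d : V} (hc : G.IsCritical c) (hd : G.IsCritical d) (h : G.Same c d) :
    c = d := by
  have key : ∀ c d, G.IsCritical c → G.IsCritical d → G.Same c d → ¬ G.t1 c < G.t1 d := by
    intro c d hc hd h hlt
    obtain ⟨y, hy⟩ := hG.red_paths.exists_in (x := d) (by omega)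
    obtain ⟨n, hn⟩ := Nat.exists_eq_add_of_le (Nat.le_of_lt_succ
      (hlt.trans_eq (hG.red_paths.in_rank hy)))
    have h1 := (hG.ranks_after_critical hc n y (h.trans (Same.of_red hy).symm) hn).1 d hy
    have h2 := (isCritical_iff.1 hd).1 y hy
    have := h1.2
    have := h2.2
    omega
  have h1 := key c d hc hd h
  have h2 := key d c hd hc h.symm
  exact hG.red_paths.eq_of_eqvGen h (by omega)

lemma crit_eq {x c : V} (h : G.Same x c) (hc : G.IsCritical c) : G.crit x = c :=
  hG.eq_of_isCritical (hG.isCritical_crit x) hc ((hG.same_crit x).symm.trans h)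

lemma op_crit (x : V) : G.op.crit x = G.crit x :=
  hG.op.crit_eq (op_same.2 (hG.same_crit x)) (hG.op_isCritical.2 (hG.isCritical_crit x))

lemma op_cX (x : V) : G.op.cX x = G.cY x := by simp [cX, cY, hG.op_crit]
lemma op_cY (x : V) : G.op.cY x = G.cX x := by simp [cX, cY, hG.op_crit]
lemma op_cA (x : V) : G.op.cA x = G.cB x := by simp [cA, cB, hG.op_crit]
lemma op_cB (x : V) : G.op.cB x = G.cA x := by simp [cA, cB, hG.op_crit]

lemma t1_add_h1 (x : V) : G.t1 x + G.h1 x = G.cX x + G.cY x :=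
  hG.red_paths.add_eq_of_eqvGen (hG.same_crit x)

lemma ranks_of_ge {x : V} (h : G.cX x ≤ G.t1 x) :
    (∀ y, G.red x y → G.R1 x y) ∧ G.t2 x = G.cA x ∧ G.h2 x + G.cX x = G.cB x + G.t1 x := by
  obtain ⟨n, hn⟩ := Nat.exists_eq_add_of_le h
  obtain ⟨h1, h2, h3⟩ :=
    hG.ranks_after_critical (hG.isCritical_crit x) n x (hG.same_crit x).symm hn
  refine ⟨h1, h2, ?_⟩
  rw [hn, h3, cB]
  omega

/-- Reversal turns the part up to the critical vertex into the part from it on. Together with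
`ranks_of_ge` this gives both green ranks at every position of a string. -/
lemma ranks_of_le {x : V} (h : G.t1 x ≤ G.cX x) :
    (∀ y, G.red y x → G.R0 y x) ∧ G.h2 x = G.cB x ∧ G.t2 x + G.t1 x = G.cA x + G.cX x := by
  have h0 := hG.t1_add_h1 x
  obtain ⟨h1, h2, h3⟩ := hG.op.ranks_of_ge (x := x) (by
    rw [hG.op_cX, op_t1]; omega)
  rw [hG.op_cA, op_t2] at h2
  rw [hG.op_cX, hG.op_cB, op_h2, op_t1] at h3
  exact ⟨fun y hy => hG.op_R1.1 (h1 y hy), h2, by omega⟩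

lemma R0_of_lt {x y : V} (h : G.red x y) (hlt : G.t1 x < G.cX x) : G.R0 x y := by
  refine (hG.ranks_of_le (x := y) ?_).1 x h
  rw [cX, ← (Same.of_red h).crit_eq, hG.red_paths.in_rank h]
  exact hlt

lemma R1_of_ge {x y : V} (h : G.red x y) (hle : G.cX x ≤ G.t1 x) : G.R1 x y :=
  (hG.ranks_of_ge hle).1 y h

lemma R0_lt {x y : V} (h : G.R0 x y) : G.t1 x < G.cX x := by
  by_contra hlt
  have h1 := hG.R1_of_ge h.1 (not_lt.1 hlt)
  have := h.2
  have := h1.2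
  omega

lemma R1_ge {x y : V} (h : G.R1 x y) : G.cX x ≤ G.t1 x := by
  by_contra hlt
  have h1 := hG.R0_of_lt h.1 (not_le.1 hlt)
  have := h.2
  have := h1.2
  omega

end IsRGraph

end BiDigraph

/-! ### Where green edges of each label may begin and end. -/

namespace BiDigraph

variable {V : Type u} {G : BiDigraph V}

namespace Same

variable {x y : V} (h : G.Same x y)
include h

lemma cX_eq : G.cX x = G.cX y := by rw [cX, cX, h.crit_eq]
lemma cY_eq : G.cY x = G.cY y := by rw [cY, cY, h.crit_eq]
lemma cA_eq : G.cA x = G.cA y := by rw [cA, cA, h.crit_eq]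
lemma cB_eq : G.cB x = G.cB y := by rw [cB, cB, h.crit_eq]

end Same

namespace IsRGraph

variable (hG : G.IsRGraph)
include hG

lemma eq_of_same {x y : V} (h : G.Same x y) (ht : G.t1 x = G.t1 y) : x = y :=
  hG.red_paths.eq_of_eqvGen h ht

lemma exists_same (x : V) {j : ℕ} (hj : j ≤ G.cX x + G.cY x) : ∃ y, G.Same x y ∧ G.t1 y = j :=
  hG.red_paths.exists_eqvGen x (by rwa [hG.t1_add_h1])

/-- If a red edge enters `x`, it has label 0, and (K4) leaves only the green label 1. If `x` starts
its string, labels 0 and 1/2 would lower `t1` below zero. -/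
lemma G1_of_le {x y : V} (h : G.green x y) (hle : G.t1 x ≤ G.cX x) : G.G1 x y := by
  rcases Nat.eq_zero_or_pos (G.t1 x) with h0 | h0
  · rcases hG.green_cases h with h1 | h1 | h1
    · have := hG.G0_rank h1; omega
    · have := hG.Gh_rank h1; omega
    · exact h1
  · obtain ⟨w, hw⟩ := hG.red_paths.exists_in h0
    have hw0 := (hG.ranks_of_le hle).1 w hw
    rcases hG.green_cases h with h1 | h1 | h1
    · exact absurd h1 (hG.R0_G0 hw0)
    · exact absurd h1 (hG.R0_Gh hw0)
    · exact h1

lemma G1_le {x y : V} (h : G.G1 x y) : G.t1 x ≤ G.cX x := by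
  by_contra hlt
  obtain ⟨w, hw⟩ := hG.red_paths.exists_in (x := x) (by omega)
  have := hG.red_paths.in_rank hw
  have hc := (Same.of_red hw).cX_eq
  exact hG.R1_G1 (hG.R1_of_ge hw (by omega)) h

lemma G0_of_ge {x y : V} (h : G.green x y) (hle : G.cX y ≤ G.t1 y) : G.G0 x y := by
  have h0 := hG.t1_add_h1 y
  exact hG.op_G1.1 (hG.op.G1_of_le (x := y) (y := x) h (by rw [op_t1, hG.op_cX]; omega))

lemma G0_ge {x y : V} (h : G.G0 x y) : G.cX y ≤ G.t1 y := by
  have h0 := hG.t1_add_h1 y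
  have := hG.op.G1_le (hG.op_G1.2 h)
  rw [op_t1, hG.op_cX] at this
  omega

/-- From the critical vertex on, every incoming green edge has label 0, by the dual of `G1_of_le`.
-/
lemma G1_lt {x y : V} (h : G.G1 x y) : G.t1 y < G.cX y := by
  by_contra hle
  have h1 := (hG.G0_of_ge h.1 (not_lt.1 hle)).2
  have h2 := h.2
  omega

lemma G0_lt {x y : V} (h : G.G0 x y) : G.cX x < G.t1 x := by
  by_contra hle
  have h1 := (hG.G1_of_le h.1 (not_lt.1 hle)).2
  have h2 := h.2
  omega

lemma Gh_lt {x y : V} (h : G.Gh x y) : G.cX x < G.t1 x ∧ G.t1 y < G.cX y := by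
  constructor
  · by_contra hle
    have h1 := (hG.G1_of_le h.1 (not_lt.1 hle)).2
    have h2 := h.2
    omega
  · by_contra hle
    have h1 := (hG.G0_of_ge h.1 (not_lt.1 hle)).2
    have h2 := h.2
    omega

lemma G1_step_back {x y w : V} (h : G.G1 x y) (hw : G.red w x) :
    ∃ z, G.G1 w z ∧ G.R0 z y :=
  hG.R0_G1 ((hG.ranks_of_le (hG.G1_le h)).1 w hw) h

/-- A red edge labelled 0 keeps `h2`, so a green edge also leaves `w`; it has label 1, and the
square of (K4) makes it parallel to the given one. -/
lemma G1_step {x y w : V} (h : G.G1 x y) (hw : G.R0 x w) : ∃ z, G.G1 w z ∧ G.R0 y z := by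
  have h1 := hG.G1_rank h
  have h2 := hG.R0_rank hw
  obtain ⟨z, hz⟩ := hG.green_paths.exists_out (x := w) (by omega)
  have hlt := hG.R0_lt hw
  have := hw.same.cX_eq
  have hz1 := hG.G1_of_le hz (by omega)
  obtain ⟨y', hy', hyz⟩ := hG.R0_G1 hw hz1
  obtain rfl := hG.green_paths.func h.1 hy'.1
  exact ⟨z, hz1, hyz⟩

lemma G1_transport_up (n : ℕ) : ∀ {x y x' : V}, G.G1 x y → G.Same x x' → G.t1 x' = G.t1 x + n →
    G.t1 x' ≤ G.cX x → ∃ y', G.Same y y' ∧ G.G1 x' y' := by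
  induction n with
  | zero =>
    intro x y x' h hs ht _
    obtain rfl := hG.eq_of_same hs ht.symm
    exact ⟨y, Same.refl y, h⟩
  | succ n ih =>
    intro x y x' h hs ht hle
    obtain ⟨w, hw⟩ := hG.red_paths.exists_in (x := x') (by omega)
    have h1 := hG.red_paths.in_rank hw
    have hsw := hs.trans (Same.of_red hw).symm
    obtain ⟨z, hyz, hz⟩ := ih h hsw (by omega) (by omega)
    obtain ⟨z', hz', hzz⟩ := hG.G1_step hz (hG.R0_of_lt hw (by rw [← hsw.cX_eq]; omega))
    exact ⟨z', hyz.trans hzz.same, hz'⟩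

lemma G1_transport_down (n : ℕ) : ∀ {x y x' : V}, G.G1 x y → G.Same x x' →
    G.t1 x = G.t1 x' + n → ∃ y', G.Same y y' ∧ G.G1 x' y' := by
  induction n with
  | zero =>
    intro x y x' h hs ht
    obtain rfl := hG.eq_of_same hs ht
    exact ⟨y, Same.refl y, h⟩
  | succ n ih =>
    intro x y x' h hs ht
    obtain ⟨w, hw⟩ := hG.red_paths.exists_in (x := x) (by omega)
    have h1 := hG.red_paths.in_rank hw
    obtain ⟨z, hz, hzy⟩ := hG.G1_step_back h hw
    obtain ⟨y', hy', h'⟩ := ih hz ((Same.of_red hw).trans hs) (by omega)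
    exact ⟨y', hzy.same.symm.trans hy', h'⟩

/-- The green edges labelled `1` that leave a red string are parallel: they leave exactly the
vertices up to the critical one. -/
lemma G1_transport {x y x' : V} (h : G.G1 x y) (hs : G.Same x x') (hle : G.t1 x' ≤ G.cX x) :
    ∃ y', G.Same y y' ∧ G.G1 x' y' := by
  rcases le_total (G.t1 x) (G.t1 x') with h1 | h1
  · obtain ⟨n, hn⟩ := Nat.exists_eq_add_of_le h1
    exact hG.G1_transport_up n h hs hn hle
  · obtain ⟨n, hn⟩ := Nat.exists_eq_add_of_le h1
    exact hG.G1_transport_down n h hs hn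

/-- In the target string, the heads of green edges labelled `1` form an initial segment. -/
lemma G1_initial {x y y' : V} (h : G.G1 x y) (hs : G.Same y y') (hle : G.t1 y' ≤ G.t1 y) :
    ∃ x', G.Same x x' ∧ G.G1 x' y' := by
  have h1 := hG.G1_rank h
  have h2 := hG.G1_le h
  obtain ⟨x', hx, hx'⟩ := hG.exists_same x (j := G.t1 y') (by omega)
  obtain ⟨y'', hy, hxy⟩ := hG.G1_transport h hx (by omega)
  have h3 := hG.G1_rank hxy
  obtain rfl := hG.eq_of_same (hs.symm.trans hy) (by omega)
  exact ⟨x', hx, hxy⟩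

lemma G1_target_unique {x y x' y' : V} (h : G.G1 x y) (h' : G.G1 x' y') (hs : G.Same x x') :
    G.Same y y' := by
  have h1 := hG.G1_le h'
  have h2 := hs.cX_eq
  obtain ⟨z, hz, hz'⟩ := hG.G1_transport h hs (by omega)
  rwa [hG.green_paths.func h'.1 hz'.1]

lemma G1_source_unique {x y x' y' : V} (h : G.G1 x y) (h' : G.G1 x' y') (hs : G.Same y y') :
    G.Same x x' := by
  rcases le_total (G.t1 y) (G.t1 y') with h1 | h1
  · obtain ⟨z, hz, hz'⟩ := hG.G1_initial h' hs.symm h1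
    rw [hG.green_paths.inj h.1 hz'.1]
    exact hz.symm
  · obtain ⟨z, hz, hz'⟩ := hG.G1_initial h hs h1
    rwa [hG.green_paths.inj h'.1 hz'.1]

lemma G0_target_unique {x y x' y' : V} (h : G.G0 x y) (h' : G.G0 x' y') (hs : G.Same x x') :
    G.Same y y' :=
  op_same.1 (hG.op.G1_source_unique (hG.op_G1.2 h) (hG.op_G1.2 h') (op_same.2 hs))

lemma rel_a {p q p' s : V} (h1 : G.G1 p q) (h2 : G.R1 p p') (h3 : G.G0 p' s) :
    ∃ s' m n c, G.G1 s s' ∧ G.R0 s' c ∧ G.R0 q m ∧ G.R1 m n ∧ G.G0 n c := by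
  simpa only [redE_zero, redE_one, greenE_zero, greenE_one] using
    hG.k5.rel_a p q p' s (greenE_one.2 h1) (redE_one.2 h2) (greenE_zero.2 h3)

lemma rel_b {p q q' s : V} (h1 : G.G1 p q) (h2 : G.R0 q q') (h3 : G.Gh s q') :
    ∃ u v z m, G.R1 u v ∧ G.G0 v p ∧ G.Gh u z ∧ G.R0 z m ∧ G.R1 m s := by
  simpa only [redE_zero, redE_one, greenE_zero, greenE_one, greenE_half] using
    hG.k5.rel_b p q q' s (greenE_one.2 h1) (redE_zero.2 h2) (greenE_half.2 h3)

lemma rel_c {p q q₁ q₂ p' s : V} (h1 : G.G1 p q) (h2 : G.R0 q q₁) (h3 : G.R0 q₁ q₂)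
    (h4 : G.R1 p p') (h5 : G.Gh p' s) :
    ∃ w₀ w₁ w₂ s', G.R1 w₀ w₁ ∧ G.R1 w₁ w₂ ∧ G.Gh w₁ q₁ ∧ G.G0 w₂ s' ∧ G.R0 s s' := by
  simpa only [redE_zero, redE_one, greenE_zero, greenE_one, greenE_half] using
    hG.k5.rel_c p q q₁ q₂ p' s (greenE_one.2 h1) (redE_zero.2 h2) (redE_zero.2 h3)
      (redE_one.2 h4) (greenE_half.2 h5)

lemma rel_verma {p q q₁ q₂ p' s : V} (h1 : G.G1 p q) (h2 : G.R0 q q₁) (h3 : G.R1 q₁ q₂)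
    (h4 : G.R1 p p') (h5 : G.Gh p' s) :
    ∃ d d₁ d₂ b b₁ b₂ b₃ c, G.G0 q₂ d ∧ G.R1 d d₁ ∧ G.Gh d₁ d₂ ∧ G.R0 d₂ c ∧
      G.R0 s b ∧ G.G1 b b₁ ∧ G.R0 b₁ b₂ ∧ G.R1 b₂ b₃ ∧ G.G0 b₃ c := by
  simpa only [redE_zero, redE_one, greenE_zero, greenE_one, greenE_half] using
    hG.k5.rel_verma p q q₁ q₂ p' s (greenE_one.2 h1) (redE_zero.2 h2) (redE_one.2 h3)
      (redE_one.2 h4) (greenE_half.2 h5)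

lemma exists_R0 {x : V} (h : G.t1 x < G.cX x) : ∃ y, G.R0 x y := by
  have := hG.t1_add_h1 x
  obtain ⟨y, hy⟩ := hG.red_paths.exists_out (x := x) (by omega)
  exact ⟨y, hG.R0_of_lt hy h⟩

lemma exists_R1 {x : V} (h : G.cX x ≤ G.t1 x) (h' : 0 < G.h1 x) : ∃ y, G.R1 x y := by
  obtain ⟨y, hy⟩ := hG.red_paths.exists_out h'
  exact ⟨y, hG.R1_of_ge hy h⟩

lemma t1_eq_of_R0_R1 {x y z : V} (h : G.R0 x y) (h' : G.R1 y z) : G.t1 y = G.cX y := by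
  have h1 := hG.R0_lt h
  have h2 := hG.R1_ge h'
  have h3 := hG.R0_rank h
  have h4 := h.same.cX_eq
  omega

/-- Relation (b) of (K5) produces red edges labelled 0 and then 1 ending at `s`, so the predecessor
of `s` is critical. -/
lemma Gh_source_of_G1 {p q q' s : V} (h1 : G.G1 p q) (h2 : G.red q q') (h3 : G.Gh s q') :
    G.t1 s = G.cX s + 1 := by
  obtain ⟨u, v, z, m, -, -, -, h4, h5⟩ := hG.rel_b h1 (hG.R0_of_lt h2 (hG.G1_lt h1)) h3
  have h6 := hG.t1_eq_of_R0_R1 h4 h5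
  have h7 := hG.R1_rank h5
  have h8 := h5.same.cX_eq
  omega

/-- The predecessor `p` of `x` is critical, and `2 ≤ h2 x` leaves it an outgoing green edge,
necessarily labelled 1. This is the configuration of relations (c) and (d) of (K5). -/
lemma Gh_target_of_source {x y : V} (h : G.Gh x y) (hx : G.t1 x = G.cX x + 1)
    (h2 : 2 ≤ G.h2 x) : G.t1 y + 1 = G.cX y := by
  have hlt := hG.Gh_lt h
  obtain ⟨p, hp⟩ := hG.red_paths.exists_in (x := x) (by omega)
  have hpx := hG.red_paths.in_rank hp
  have hps := (Same.of_red hp).cX_eq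
  have hp1 := hG.R1_of_ge hp (by omega)
  have hp2 := hG.R1_rank hp1
  obtain ⟨q, hq⟩ := hG.green_paths.exists_out (x := p) (by omega)
  have hq1 := hG.G1_of_le hq (by omega)
  have hq2 := hG.G1_rank hq1
  obtain ⟨q₁, hqq⟩ := hG.exists_R0 (hG.G1_lt hq1)
  have hq3 := hG.R0_rank hqq
  obtain ⟨q₂, hq4⟩ := hG.red_paths.exists_out (x := q₁) (by omega)
  -- In the first case relation (c) supplies an edge labelled 0 into the successor of `y`; its head
  -- cannot lie before the critical vertex, while the red edge leaving `y` is labelled 0.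
  rcases hG.red_cases hq4 with h0 | h0
  · obtain ⟨w₀, w₁, w₂, s', -, -, -, hw, hs⟩ := hG.rel_c hq1 hqq h0 hp1 h
    have := hG.G0_ge hw
    have := hG.R0_rank hs
    have := hs.same.cX_eq
    omega
  · obtain ⟨d, d₁, d₂, b, b₁, b₂, b₃, c, -, -, -, -, hb, hb1, hb2, hb3, -⟩ :=
      hG.rel_verma hq1 hqq h0 hp1 h
    have hcr := hG.t1_eq_of_R0_R1 hb2 hb3
    have hbr := hG.R0_rank hb
    have hbs := hb.same.cX_eq
    -- If the successor `b` of `y` were not critical, sliding the edge `b → b₁` one step forward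
    -- would give an edge labelled 1 into the critical vertex `b₂`.
    by_contra hne
    obtain ⟨b', hbb⟩ := hG.exists_R0 (x := b) (by omega)
    obtain ⟨z, hz, hzz⟩ := hG.G1_step hb1 hbb
    obtain rfl := hG.red_paths.func hzz.1 hb2.1
    have := hG.G1_lt hz
    omega

/-- Move down the target string. Before the critical vertex every vertex is entered by a green edge
labelled 1/2 or 1; at the first 1, `Gh_source_of_G1` applies to the edge just above. At the start of
the string the ranks leave only one possible source position. -/
lemma exists_first_Gh (n : ℕ) : ∀ {x y : V}, G.Gh x y → G.t1 y = n →
    ∃ x' y', G.Same y y' ∧ G.t1 y' ≤ G.t1 y ∧ G.Gh x' y' ∧ G.t1 x' = G.cX x' + 1 := by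
  induction n with
  | zero =>
    intro x y h ht
    have := hG.Gh_rank h
    have := hG.Gh_lt h
    exact ⟨x, y, Same.refl y, le_rfl, h, by omega⟩
  | succ n ih =>
    intro x y h ht
    have hlt := hG.Gh_lt h
    obtain ⟨w, hw⟩ := hG.red_paths.exists_in (x := y) (by omega)
    have hwr := hG.red_paths.in_rank hw
    have hws := (Same.of_red hw).cX_eq
    have hw2 := (hG.ranks_of_le (x := w) (by omega)).2.2
    obtain ⟨z, hz⟩ := hG.green_paths.exists_in (x := w) (by omega)
    rcases hG.green_cases hz with h1 | h1 | h1
    · have := hG.G0_ge h1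
      omega
    · obtain ⟨x', y', h2, h3, h4, h5⟩ := ih h1 (by omega)
      exact ⟨x', y', (Same.of_red hw).symm.trans h2, by omega, h4, h5⟩
    · exact ⟨x, y, Same.refl y, le_rfl, h, hG.Gh_source_of_G1 h1 hw h⟩

/-- A green edge labelled `1/2` leaves the vertex next to the critical one. -/
lemma Gh_source {x y : V} (h : G.Gh x y) : G.t1 x = G.cX x + 1 := by
  obtain ⟨x', y', h1, h2, h3, h4⟩ := hG.exists_first_Gh _ h rfl
  have hlt := hG.Gh_lt h
  -- If `x` is not next to its critical vertex, then `2 ≤ h2 x`. Since `h2` is constant before the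
  -- critical vertex of the target string, also `2 ≤ h2 x'`, and `y'` is just before that critical
  -- vertex. As `y` lies between the two, `y = y'`, hence `x = x'`.
  by_contra hne
  have h5 := (hG.ranks_of_ge (x := x) (by omega)).2.2
  have h6 := hG.Gh_rank h
  have h7 := (hG.ranks_of_le hlt.2.le).2.1
  have h8 := (hG.ranks_of_le (x := y') (by rw [← h1.cX_eq]; omega)).2.1
  have h9 := h1.cB_eq
  have h10 := hG.Gh_rank h3
  have h11 := hG.Gh_target_of_source h3 h4 (by omega)
  have h12 := h1.cX_eq
  obtain rfl := hG.eq_of_same h1 (by omega)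
  obtain rfl := hG.green_paths.inj h.1 h3.1
  exact hne h4

/-- A green edge labelled `1/2` enters the vertex just before the critical one. -/
lemma Gh_target {x y : V} (h : G.Gh x y) : G.t1 y + 1 = G.cX y := by
  have h0 := hG.t1_add_h1 y
  have h1 := hG.op.Gh_source (hG.op_Gh.2 h)
  rw [op_t1, hG.op_cX] at h1
  omega

end IsRGraph

end BiDigraph

/-! ### Edges, ranks and relations of the view from the sky. -/

namespace BiDigraph

variable {V : Type u} (G : BiDigraph V)

/-- Edges labelled `1`, `1/2` and `0` of the view from the sky, between the red strings
through two given vertices. -/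
def SkyOne (x y : V) : Prop := ∃ x' y', G.Same x x' ∧ G.Same y y' ∧ G.G1 x' y'
def SkyHalf (x y : V) : Prop := ∃ x' y', G.Same x x' ∧ G.Same y y' ∧ G.Gh x' y'
def SkyZero (x y : V) : Prop := ∃ x' y', G.Same x x' ∧ G.Same y y' ∧ G.G0 x' y'

variable {G}

lemma G1.sky {x y : V} (h : G.G1 x y) : G.SkyOne x y := ⟨x, y, .refl x, .refl y, h⟩
lemma Gh.sky {x y : V} (h : G.Gh x y) : G.SkyHalf x y := ⟨x, y, .refl x, .refl y, h⟩
lemma G0.sky {x y : V} (h : G.G0 x y) : G.SkyZero x y := ⟨x, y, .refl x, .refl y, h⟩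

lemma SkyOne.congr {x y x' y' : V} (h : G.SkyOne x y) (hx : G.Same x x') (hy : G.Same y y') :
    G.SkyOne x' y' := by
  obtain ⟨a, b, h1, h2, h3⟩ := h
  exact ⟨a, b, hx.symm.trans h1, hy.symm.trans h2, h3⟩

lemma SkyHalf.congr {x y x' y' : V} (h : G.SkyHalf x y) (hx : G.Same x x') (hy : G.Same y y') :
    G.SkyHalf x' y' := by
  obtain ⟨a, b, h1, h2, h3⟩ := h
  exact ⟨a, b, hx.symm.trans h1, hy.symm.trans h2, h3⟩

lemma SkyZero.congr {x y x' y' : V} (h : G.SkyZero x y) (hx : G.Same x x') (hy : G.Same y y') :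
    G.SkyZero x' y' := by
  obtain ⟨a, b, h1, h2, h3⟩ := h
  exact ⟨a, b, hx.symm.trans h1, hy.symm.trans h2, h3⟩

namespace IsRGraph

variable (hG : G.IsRGraph)
include hG

lemma op_skyOne {x y : V} : G.op.SkyOne x y ↔ G.SkyZero y x := by
  simp only [SkyOne, SkyZero, op_same, hG.op_G1]
  exact ⟨fun ⟨a, b, h1, h2, h3⟩ => ⟨b, a, h2, h1, h3⟩, fun ⟨a, b, h1, h2, h3⟩ => ⟨b, a, h2, h1, h3⟩⟩

lemma op_skyZero {x y : V} : G.op.SkyZero x y ↔ G.SkyOne y x := by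
  simp only [SkyOne, SkyZero, op_same, hG.op_G0]
  exact ⟨fun ⟨a, b, h1, h2, h3⟩ => ⟨b, a, h2, h1, h3⟩, fun ⟨a, b, h1, h2, h3⟩ => ⟨b, a, h2, h1, h3⟩⟩

lemma op_skyHalf {x y : V} : G.op.SkyHalf x y ↔ G.SkyHalf y x := by
  simp only [SkyHalf, op_same, hG.op_Gh]
  exact ⟨fun ⟨a, b, h1, h2, h3⟩ => ⟨b, a, h2, h1, h3⟩, fun ⟨a, b, h1, h2, h3⟩ => ⟨b, a, h2, h1, h3⟩⟩

lemma skyOne_target {x y x' y' : V} (h : G.SkyOne x y) (h' : G.SkyOne x' y') (hs : G.Same x x') :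
    G.Same y y' := by
  obtain ⟨a, b, h1, h2, h3⟩ := h
  obtain ⟨a', b', h1', h2', h3'⟩ := h'
  exact h2.trans ((hG.G1_target_unique h3 h3' (h1.symm.trans (hs.trans h1'))).trans h2'.symm)

lemma skyZero_target {x y x' y' : V} (h : G.SkyZero x y) (h' : G.SkyZero x' y')
    (hs : G.Same x x') : G.Same y y' := by
  obtain ⟨a, b, h1, h2, h3⟩ := h
  obtain ⟨a', b', h1', h2', h3'⟩ := h'
  exact h2.trans ((hG.G0_target_unique h3 h3' (h1.symm.trans (hs.trans h1'))).trans h2'.symm)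

lemma skyHalf_target {x y x' y' : V} (h : G.SkyHalf x y) (h' : G.SkyHalf x' y')
    (hs : G.Same x x') : G.Same y y' := by
  obtain ⟨a, b, h1, h2, h3⟩ := h
  obtain ⟨a', b', h1', h2', h3'⟩ := h'
  have hab := h1.symm.trans (hs.trans h1')
  have h4 := hG.Gh_source h3
  have h5 := hG.Gh_source h3'
  have h6 := hab.cX_eq
  obtain rfl := hG.eq_of_same hab (by omega)
  obtain rfl := hG.green_paths.func h3.1 h3'.1
  exact h2.trans h2'.symm

lemma skyOne_source {x y x' y' : V} (h : G.SkyOne x y) (h' : G.SkyOne x' y') (hs : G.Same y y') :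
    G.Same x x' :=
  op_same.1 (hG.op.skyZero_target (hG.op_skyZero.2 h) (hG.op_skyZero.2 h') (op_same.2 hs))

lemma skyZero_source {x y x' y' : V} (h : G.SkyZero x y) (h' : G.SkyZero x' y')
    (hs : G.Same y y') : G.Same x x' :=
  op_same.1 (hG.op.skyOne_target (hG.op_skyOne.2 h) (hG.op_skyOne.2 h') (op_same.2 hs))

lemma skyHalf_source {x y x' y' : V} (h : G.SkyHalf x y) (h' : G.SkyHalf x' y')
    (hs : G.Same y y') : G.Same x x' :=
  op_same.1 (hG.op.skyHalf_target (hG.op_skyHalf.2 h) (hG.op_skyHalf.2 h') (op_same.2 hs))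

lemma SkyOne_G1 {x y p : V} (h : G.SkyOne x y) (hs : G.Same x p) (hle : G.t1 p ≤ G.cX x) :
    ∃ q, G.Same y q ∧ G.G1 p q := by
  obtain ⟨a, b, h1, h2, h3⟩ := h
  obtain ⟨q, hq, hq'⟩ := hG.G1_transport h3 (h1.symm.trans hs) (by rwa [← h1.cX_eq])
  exact ⟨q, h2.trans hq, hq'⟩

lemma green_in_cases {x w : V} (h : G.green w x) (hlt : G.t1 x < G.cX x) :
    G.Gh w x ∨ G.G1 w x := by
  rcases hG.green_cases h with h1 | h1 | h1
  · have := hG.G0_ge h1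
    omega
  · exact Or.inl h1
  · exact Or.inr h1

lemma exists_green_in {x : V} (hlt : G.t1 x < G.cX x) : ∃ w, G.Gh w x ∨ G.G1 w x := by
  have := (hG.ranks_of_le hlt.le).2.2
  obtain ⟨w, hw⟩ := hG.green_paths.exists_in (x := x) (by omega)
  exact ⟨w, hG.green_in_cases hw hlt⟩

lemma Gh_G1 {x y z : V} (h : G.Gh x z) (h' : G.G1 y z) : False := by
  obtain rfl := hG.green_paths.inj h.1 h'.1
  have := h.2
  have := h'.2
  omega

lemma not_skyHalf_of_G1 {x y : V} (h : G.G1 x y) (hy : G.t1 y + 1 = G.cX y) (z : V) :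
    ¬ G.SkyHalf z y := by
  rintro ⟨a, b, -, h2, h3⟩
  have h4 := hG.Gh_target h3
  have h5 := h2.cX_eq
  obtain rfl := hG.eq_of_same h2 (by omega)
  exact hG.Gh_G1 h3 h

/-- The first alternative is an edge of a lower sail, the second one of an upper sail. The last
green edge labelled 1 between the strings leaves the critical vertex of `x`, so its head has
position `cX x`; the question is whether this is one or two places before the critical vertex of
`y`. -/
lemma skyOne_ranks {x y : V} (h : G.SkyOne x y) :
    (G.cX y = G.cX x + 1 ∧ G.cY y = G.cY x + 1 ∧ G.cA y = G.cA x ∧ G.cB x = G.cB y + 1 ∧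
      ¬ ∃ z, G.SkyHalf z y) ∨
    (G.cX y = G.cX x + 2 ∧ G.cY y = G.cY x ∧ G.cA x = G.cA y + 1 ∧ G.cB x = G.cB y + 1 ∧
      ∃ z, G.SkyHalf z y) := by
  obtain ⟨p, hxp, hp⟩ := hG.exists_same x (j := G.cX x) (by omega)
  obtain ⟨q, hyq, hpq⟩ := hG.SkyOne_G1 h hxp (by omega)
  have h1 := hG.G1_rank hpq
  have h2 := hG.G1_lt hpq
  have h3 := hxp.cX_eq
  have h4 := hyq.cX_eq
  have h5 := hG.t1_add_h1 p
  have h6 := hG.t1_add_h1 q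
  have h7 := hxp.cY_eq
  have h8 := hyq.cY_eq
  have h9 := (hG.ranks_of_le (x := p) (by omega)).2
  have h10 := (hG.ranks_of_le (x := q) (by omega)).2
  have h11 := hxp.cA_eq
  have h12 := hyq.cA_eq
  have h13 := hxp.cB_eq
  have h14 := hyq.cB_eq
  -- The green edge entering the vertex just before the critical one decides: label 1 means that
  -- this vertex is `q`; label 1/2 means that the edges labelled 1 stop one place earlier.
  obtain ⟨z, hyz, hz⟩ := hG.exists_same y (j := G.cX y - 1) (by omega)
  have hz1 := hyz.cX_eq
  obtain ⟨w, hw | hw⟩ := hG.exists_green_in (x := z) (by omega)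
  · right
    have hne : q ≠ z := by
      rintro rfl
      exact hG.Gh_G1 hw hpq
    have hne' : G.t1 q ≠ G.t1 z := fun he => hne (hG.eq_of_same (hyq.symm.trans hyz) he)
    obtain ⟨z', hyz', hz'⟩ := hG.exists_same y (j := G.cX y - 2) (by omega)
    have hz1' := hyz'.cX_eq
    obtain ⟨w', hw' | hw'⟩ := hG.exists_green_in (x := z') (by omega)
    · have := hG.Gh_target hw'
      omega
    · have h15 := hG.G1_source_unique hw' hpq (hyz'.symm.trans hyq)
      have h16 := h15.cX_eq
      have h17 := hG.G1_le hw'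
      have h18 := hG.G1_rank hw'
      exact ⟨by omega, by omega, by omega, by omega, w, w, z, .refl w, hyz, hw⟩
  · left
    have h15 := hG.G1_source_unique hw hpq (hyz.symm.trans hyq)
    have h16 := h15.cX_eq
    have h17 := hG.G1_le hw
    have h18 := hG.G1_rank hw
    refine ⟨by omega, by omega, by omega, by omega, ?_⟩
    rintro ⟨v, hv⟩
    exact hG.not_skyHalf_of_G1 hw (by omega) v (hv.congr (.refl v) hyz)

lemma skyZero_ranks {x y : V} (h : G.SkyZero x y) :
    (G.cX x = G.cX y + 1 ∧ G.cY x = G.cY y + 1 ∧ G.cA y = G.cA x + 1 ∧ G.cB y = G.cB x ∧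
      ¬ ∃ z, G.SkyHalf x z) ∨
    (G.cX y = G.cX x ∧ G.cY x = G.cY y + 2 ∧ G.cA y = G.cA x + 1 ∧ G.cB y = G.cB x + 1 ∧
      ∃ z, G.SkyHalf x z) := by
  have := hG.op.skyOne_ranks (hG.op_skyOne.2 h)
  simp only [hG.op_cX, hG.op_cY, hG.op_cA, hG.op_cB, hG.op_skyHalf] at this
  rcases this with ⟨h1, h2, h3, h4, h5⟩ | ⟨h1, h2, h3, h4, h5⟩
  · exact Or.inl ⟨h2, h1, h4, h3.symm, h5⟩
  · exact Or.inr ⟨h2.symm, h1, h4, h3, h5⟩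

lemma skyHalf_ranks {x y : V} (h : G.SkyHalf x y) :
    G.cX y = G.cX x + 1 ∧ G.cY x = G.cY y + 1 ∧ G.cA y = G.cA x ∧ G.cB y = G.cB x := by
  obtain ⟨p, q, h1, h2, h3⟩ := h
  rw [h1.cX_eq, h1.cY_eq, h1.cA_eq, h1.cB_eq, h2.cX_eq, h2.cY_eq, h2.cA_eq, h2.cB_eq]
  have h4 := hG.Gh_source h3
  have h5 := hG.Gh_target h3
  have h6 := hG.Gh_rank h3
  have h7 := hG.t1_add_h1 p
  have h8 := hG.t1_add_h1 q
  have h9 := (hG.ranks_of_ge (x := p) (by omega)).2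
  have h10 := (hG.ranks_of_le (x := q) (by omega)).2
  omega

lemma exists_skyOne {x : V} (h : 0 < G.cB x) : ∃ y, G.SkyOne x y := by
  obtain ⟨y, hy⟩ := hG.green_paths.exists_out h
  have h1 := (hG.same_crit x).cX_eq
  exact ⟨y, (hG.G1_of_le hy (by rw [← h1]; exact le_rfl)).sky.congr (hG.same_crit x).symm (.refl y)⟩

lemma exists_skyHalf_or_skyOne {x : V} (h : 0 < G.cX x) :
    (∃ y, G.SkyHalf y x) ∨ ∃ y, G.SkyOne y x := by
  obtain ⟨z, hz, hz'⟩ := hG.exists_same x (j := G.cX x - 1) (by omega)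
  have h1 := hz.cX_eq
  obtain ⟨w, hw | hw⟩ := hG.exists_green_in (x := z) (by omega)
  · exact Or.inl ⟨w, hw.sky.congr (.refl w) hz.symm⟩
  · exact Or.inr ⟨w, hw.sky.congr (.refl w) hz.symm⟩

lemma exists_skyOne_in {x : V} (h : 2 ≤ G.cX x) : ∃ y, G.SkyOne y x := by
  obtain ⟨z, hz, hz'⟩ := hG.exists_same x (j := G.cX x - 2) (by omega)
  have h1 := hz.cX_eq
  obtain ⟨w, hw | hw⟩ := hG.exists_green_in (x := z) (by omega)
  · have := hG.Gh_target hw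
    omega
  · exact ⟨w, hw.sky.congr (.refl w) hz.symm⟩

lemma exists_skyZero_in {x : V} (h : 0 < G.cA x) : ∃ y, G.SkyZero y x := by
  obtain ⟨y, hy⟩ := hG.op.exists_skyOne (x := x) (by rwa [hG.op_cB])
  exact ⟨y, hG.op_skyOne.1 hy⟩

lemma exists_skyHalf_or_skyZero {x : V} (h : 0 < G.cY x) :
    (∃ y, G.SkyHalf x y) ∨ ∃ y, G.SkyZero x y := by
  have := hG.op.exists_skyHalf_or_skyOne (x := x) (by rwa [hG.op_cX])
  simpa only [hG.op_skyHalf, hG.op_skyOne] using this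

lemma exists_skyZero {x : V} (h : 2 ≤ G.cY x) : ∃ y, G.SkyZero x y := by
  obtain ⟨y, hy⟩ := hG.op.exists_skyOne_in (x := x) (by rwa [hG.op_cX])
  exact ⟨y, hG.op_skyOne.1 hy⟩

lemma skyZero_G0 {x y p : V} (h : G.SkyZero x y) (hs : G.Same x p)
    (hp : G.cX x + 1 < G.t1 p ∨ G.cX x < G.t1 p ∧ ¬ ∃ z, G.SkyHalf x z) :
    ∃ q, G.Same y q ∧ G.G0 p q := by
  have h1 := (hG.ranks_of_ge (x := p) (by rw [← hs.cX_eq]; omega)).2.2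
  have h2 := hs.cX_eq
  obtain ⟨q, hq⟩ := hG.green_paths.exists_out (x := p) (by omega)
  rcases hG.green_cases hq with h3 | h3 | h3
  · exact ⟨q, hG.skyZero_target h h3.sky hs, h3⟩
  · have h4 := hG.Gh_source h3
    rcases hp with hp | hp
    · omega
    · exact absurd ⟨q, h3.sky.congr hs.symm (.refl q)⟩ hp.2
  · have := hG.G1_le h3
    omega

lemma skyHalf_Gh {x y p : V} (h : G.SkyHalf x y) (hs : G.Same x p) (hp : G.t1 p = G.cX x + 1) :
    ∃ q, G.Same y q ∧ G.Gh p q := by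
  obtain ⟨a, b, h1, h2, h3⟩ := h
  have h4 := hG.Gh_source h3
  have h5 := h1.cX_eq
  obtain rfl := hG.eq_of_same (h1.symm.trans hs) (by omega)
  exact ⟨b, h2, h3⟩

/-- The green edges of an R-graph, in terms of its view from the sky. -/
lemma green_iff {x y : V} : G.green x y ↔
    (G.SkyOne x y ∧ G.t1 x ≤ G.cX x ∧ G.t1 y = G.t1 x) ∨
    (G.SkyHalf x y ∧ G.t1 x = G.cX x + 1 ∧ G.t1 x = G.t1 y + 1) ∨
    (G.SkyZero x y ∧ (G.cX x + 1 < G.t1 x ∨ G.cX x < G.t1 x ∧ ¬ ∃ z, G.SkyHalf x z) ∧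
      G.t1 x = G.t1 y + 2) := by
  constructor
  · intro h
    rcases hG.green_cases h with h1 | h1 | h1
    · refine Or.inr (Or.inr ⟨h1.sky, ?_, (hG.G0_rank h1).2.1⟩)
      -- An edge labelled 1/2 from this string would leave the vertex right after the critical one,
      -- which is `x`; but only one green edge leaves `x`.
      by_contra hcon
      simp only [not_or, not_lt, not_and, not_not] at hcon
      have h2 := hG.G0_lt h1
      obtain ⟨z, hz⟩ := hcon.2 h2
      obtain ⟨q, hq, hxq⟩ := hG.skyHalf_Gh hz (.refl x) (by omega)
      obtain rfl := hG.green_paths.func h hxq.1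
      have := h1.2
      have := hxq.2
      omega
    · exact Or.inr (Or.inl ⟨h1.sky, hG.Gh_source h1, (hG.Gh_rank h1).2.1⟩)
    · exact Or.inl ⟨h1.sky, hG.G1_le h1, (hG.G1_rank h1).2.1.symm⟩
  · rintro (⟨h1, h2, h3⟩ | ⟨h1, h2, h3⟩ | ⟨h1, h2, h3⟩)
    · obtain ⟨q, hq, hxq⟩ := hG.SkyOne_G1 h1 (.refl x) h2
      have := hG.G1_rank hxq
      obtain rfl := hG.eq_of_same hq (by omega)
      exact hxq.1
    · obtain ⟨q, hq, hxq⟩ := hG.skyHalf_Gh h1 (.refl x) h2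
      have := hG.Gh_rank hxq
      obtain rfl := hG.eq_of_same hq (by omega)
      exact hxq.1
    · obtain ⟨q, hq, hxq⟩ := hG.skyZero_G0 h1 (.refl x) h2
      have := hG.G0_rank hxq
      obtain rfl := hG.eq_of_same hq (by omega)
      exact hxq.1

/-- Relation (a) is applied at the critical vertex. Absence of an edge labelled 1/2 lets label 0
begin at its successor, and the conclusion puts `q` just before a critical vertex, leaving no place
for a 1/2 edge into that string. -/
lemma sky_rel_a {x y s : V} (h1 : G.SkyOne x y) (h2 : G.SkyZero x s)
    (h3 : ¬ ∃ z, G.SkyHalf x z) :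
    ∃ c, G.SkyOne s c ∧ G.SkyZero y c ∧ ¬ ∃ z, G.SkyHalf z y := by
  have hr := hG.skyZero_ranks h2
  have hY : 0 < G.cY x := by omega
  have hp := hG.same_crit x
  obtain ⟨p', hpp⟩ := hG.exists_R1 (x := G.crit x) hp.symm.cX_eq.le hY
  obtain ⟨q, hyq, hq⟩ := hG.SkyOne_G1 h1 hp le_rfl
  have hpr := hG.R1_rank hpp
  obtain ⟨s₁, hs₁, hps⟩ := hG.skyZero_G0 h2 (hp.trans hpp.same)
    (Or.inr ⟨by rw [hpr.2.2.1]; exact Nat.lt_succ_self _, h3⟩)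
  obtain ⟨s', m, n, c, e1, e2, e3, e4, e5⟩ := hG.rel_a hq hpp hps
  refine ⟨c, e1.sky.congr hs₁.symm e2.same,
    e5.sky.congr (hyq.trans (e3.same.trans e4.same)).symm (.refl c), ?_⟩
  rintro ⟨z, hz⟩
  have h4 := hG.t1_eq_of_R0_R1 e3 e4
  have h5 := hG.R0_rank e3
  have h6 := e3.same.cX_eq
  exact hG.not_skyHalf_of_G1 hq (by omega) z (hz.congr (.refl z) hyq)

/-- An incoming 1/2 edge makes `SkyOne x y` of upper type. So the successor of the head of the last
edge labelled 1 is exactly the vertex entered by the 1/2 edge, as relation (b) requires. -/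
lemma sky_rel_b {x y s : V} (h1 : G.SkyOne x y) (h2 : G.SkyHalf s y) :
    ∃ c, G.SkyZero c x ∧ G.SkyHalf c s := by
  obtain ⟨s₁, q', hs, hy, hsq⟩ := h2
  have hr := hG.skyOne_ranks h1
  have hr : G.cX y = G.cX x + 2 := by
    rcases hr with hr | hr
    · exact absurd ⟨s₁, hsq.sky.congr (.refl _) hy.symm⟩ hr.2.2.2.2
    · exact hr.1
  have hp := hG.same_crit x
  obtain ⟨q, hyq, hq⟩ := hG.SkyOne_G1 h1 hp le_rfl
  have h3 := hG.G1_rank hq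
  have h4 : G.cX x = G.t1 (G.crit x) := rfl
  have h5 := hG.Gh_target hsq
  have h6 := hy.cX_eq
  have h7 := hyq.cX_eq
  obtain ⟨q'', hqq⟩ := hG.exists_R0 (x := q) (by omega)
  have h8 := hG.R0_rank hqq
  obtain rfl := hG.eq_of_same (hy.symm.trans (hyq.trans hqq.same)) (by omega)
  obtain ⟨u, v, z, m, e1, e2, e3, e4, e5⟩ := hG.rel_b hq hqq hsq
  exact ⟨u, e2.sky.congr e1.same.symm hp.symm,
    e3.sky.congr (.refl u) (e4.same.trans (e5.same.trans hs.symm))⟩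

lemma sky_rel_c {x y s : V} (h1 : G.SkyOne x y) (h2 : ∃ z, G.SkyHalf z y)
    (h3 : G.SkyHalf x s) : ∃ w, G.SkyHalf w y ∧ G.SkyZero w s := by
  have hr : G.cX y = G.cX x + 2 := by
    rcases hG.skyOne_ranks h1 with hr | hr
    · exact absurd h2 hr.2.2.2.2
    · exact hr.1
  have hr3 := hG.skyHalf_ranks h3
  have hp := hG.same_crit x
  have h4 : G.cX x = G.t1 (G.crit x) := rfl
  obtain ⟨p', hpp⟩ := hG.exists_R1 (x := G.crit x) hp.symm.cX_eq.le (by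
    have : G.cY x = G.h1 (G.crit x) := rfl
    omega)
  have hpr := hG.R1_rank hpp
  obtain ⟨q, hyq, hq⟩ := hG.SkyOne_G1 h1 hp le_rfl
  have h5 := hG.G1_rank hq
  have h7 := hyq.cX_eq
  obtain ⟨q₁, hqq⟩ := hG.exists_R0 (x := q) (by omega)
  have h8 := hG.R0_rank hqq
  have h9 := hqq.same.cX_eq
  obtain ⟨q₂, hqq₂⟩ := hG.exists_R0 (x := q₁) (by omega)
  obtain ⟨s₁, hs₁, hps⟩ := hG.skyHalf_Gh h3 (hp.trans hpp.same) (by omega)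
  obtain ⟨w₀, w₁, w₂, s', e1, e2, e3, e4, e5⟩ := hG.rel_c hq hqq hqq₂ hpp hps
  exact ⟨w₁, e3.sky.congr (.refl _) (hyq.trans hqq.same).symm,
    e4.sky.congr e2.same.symm (hs₁.trans e5.same).symm⟩

lemma sky_rel_verma {x y s : V} (h1 : G.SkyOne x y) (h2 : ¬ ∃ z, G.SkyHalf z y)
    (h3 : G.SkyHalf x s) : ∃ d e b, G.SkyZero y d ∧ G.SkyHalf d e ∧ G.SkyOne s b ∧
      (¬ ∃ z, G.SkyHalf z b) ∧ G.SkyZero b e := by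
  have hr : G.cX y = G.cX x + 1 ∧ G.cY y = G.cY x + 1 := by
    rcases hG.skyOne_ranks h1 with hr | hr
    · exact ⟨hr.1, hr.2.1⟩
    · exact absurd hr.2.2.2.2 h2
  have hr3 := hG.skyHalf_ranks h3
  have hp := hG.same_crit x
  have h4 : G.cX x = G.t1 (G.crit x) := rfl
  obtain ⟨p', hpp⟩ := hG.exists_R1 (x := G.crit x) hp.symm.cX_eq.le (by
    have : G.cY x = G.h1 (G.crit x) := rfl
    omega)
  have hpr := hG.R1_rank hpp
  obtain ⟨q, hyq, hq⟩ := hG.SkyOne_G1 h1 hp le_rfl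
  have h5 := hG.G1_rank hq
  have h7 := hyq.cX_eq
  have h7' := hyq.cY_eq
  have hth := hG.t1_add_h1 q
  obtain ⟨q₁, hqq⟩ := hG.exists_R0 (x := q) (by omega)
  have h8 := hG.R0_rank hqq
  have h9 := hqq.same.cX_eq
  obtain ⟨q₂, hqq₂⟩ := hG.exists_R1 (x := q₁) (by omega) (by omega)
  obtain ⟨s₁, hs₁, hps⟩ := hG.skyHalf_Gh h3 (hp.trans hpp.same) (by omega)
  obtain ⟨d, d₁, d₂, b, b₁, b₂, b₃, c, e1, e2, e3, e4, e5, e6, e7, e8, e9⟩ :=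
    hG.rel_verma hq hqq hqq₂ hpp hps
  refine ⟨d, c, b₁, e1.sky.congr (hyq.trans (hqq.same.trans hqq₂.same)).symm (.refl _),
    e3.sky.congr e2.same.symm e4.same, e6.sky.congr (hs₁.trans e5.same).symm (.refl _), ?_,
    e9.sky.congr (e7.same.trans e8.same).symm (.refl _)⟩
  rintro ⟨z, hz⟩
  have g1 := hG.t1_eq_of_R0_R1 e7 e8
  have g2 := hG.R0_rank e7
  have g3 := e7.same.cX_eq
  exact hG.not_skyHalf_of_G1 e6 (by omega) z hz

lemma sky_rel_b_op {x y s : V} (h1 : G.SkyZero y x) (h2 : G.SkyHalf y s) :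
    ∃ c, G.SkyOne x c ∧ G.SkyHalf s c := by
  have := hG.op.sky_rel_b (hG.op_skyOne.2 h1) (hG.op_skyHalf.2 h2)
  simpa only [hG.op_skyHalf, hG.op_skyZero] using this

lemma sky_rel_c_op {x y s : V} (h1 : G.SkyZero y x) (h2 : ∃ z, G.SkyHalf y z)
    (h3 : G.SkyHalf s x) : ∃ w, G.SkyHalf y w ∧ G.SkyOne s w := by
  have := hG.op.sky_rel_c (hG.op_skyOne.2 h1) (by simpa only [hG.op_skyHalf] using h2)
    (hG.op_skyHalf.2 h3)
  simpa only [hG.op_skyHalf, hG.op_skyZero] using this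

end IsRGraph

end BiDigraph

/-! ### Isomorphisms of sky graphs and coordinates on the glued product. -/

namespace SkyGraph

/-- Composition of isomorphisms. -/
def Iso.trans {W : Type u} {W' : Type v} {W'' : Type w} {S : SkyGraph W} {S' : SkyGraph W'}
    {S'' : SkyGraph W''} (φ : Iso S S') (ψ : Iso S' S'') : Iso S S'' where
  toEquiv := φ.toEquiv.trans ψ.toEquiv
  edge_iff _ _ _ := (ψ.edge_iff _ _ _).trans (φ.edge_iff _ _ _)
  X_eq _ := (ψ.X_eq _).trans (φ.X_eq _)
  Y_eq _ := (ψ.Y_eq _).trans (φ.Y_eq _)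

/-- The inverse isomorphism. -/
def Iso.symm {W : Type u} {W' : Type v} {S : SkyGraph W} {S' : SkyGraph W'}
    (φ : Iso S S') : Iso S' S where
  toEquiv := φ.toEquiv.symm
  edge_iff x a y := by
    have := φ.edge_iff (φ.toEquiv.symm x) a (φ.toEquiv.symm y)
    refine this.symm.trans (iff_of_eq ?_)
    congr 1
    · exact φ.toEquiv.apply_symm_apply x
    · exact φ.toEquiv.apply_symm_apply y
  X_eq x := by
    exact (φ.X_eq _).symm.trans (congrArg S'.X (φ.toEquiv.apply_symm_apply x))
  Y_eq x := by
    exact (φ.Y_eq _).symm.trans (congrArg S'.Y (φ.toEquiv.apply_symm_apply x))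

end SkyGraph

/-- Coordinates on `K̂(H,A)`: `(u, 0, l, i)` is the vertex `(u, l)` of the `i`-th copy of the upper
sail, and `(0, d, l, i)` is the vertex `(d, i)` of the `l`-th copy of the lower sail. -/
@[ext] structure SkyCoord (H N : ℕ) where
  u : ℕ
  d : ℕ
  l : ℕ
  i : ℕ
  u_or_d : u = 0 ∨ d = 0
  upper_le : 2 * u + l ≤ H
  lower_le : d + i ≤ N

/-- `K̂(H,A)` in coordinates. -/
def coordSky (H N : ℕ) : SkyGraph (SkyCoord H N) where
  E x a y :=
    (a = 1 / 2 ∧ x.d = 0 ∧ y.d = 0 ∧ y.u = x.u ∧ y.l = x.l + 1 ∧ y.i = x.i) ∨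
    (a = 0 ∧ x.d = 0 ∧ y.d = 0 ∧ y.u = x.u + 1 ∧ y.l = x.l ∧ y.i = x.i) ∨
    (a = 1 ∧ x.d = 0 ∧ y.d = 0 ∧ x.u = y.u + 1 ∧ y.l = x.l + 2 ∧ y.i = x.i) ∨
    (a = 1 ∧ x.u = 0 ∧ y.u = 0 ∧ y.d = x.d + 1 ∧ y.l = x.l ∧ y.i = x.i) ∨
    (a = 0 ∧ x.u = 0 ∧ y.u = 0 ∧ x.d = y.d + 1 ∧ y.l = x.l ∧ y.i = x.i + 1)
  X x := x.l + x.d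
  Y x := H - 2 * x.u - x.l + x.d

namespace SkyCoord

variable {H N : ℕ}

/-- The coordinates of a vertex of `K̂(H,A)`. -/
def ofSky : SkyVertex H N → SkyCoord H N :=
  Quot.lift
    (Sum.elim
      (fun x => ⟨x.1.1.1, 0, x.1.1.2, x.2.1.1.2, Or.inr rfl, x.1.2, by
        have := x.2.1.2; omega⟩)
      (fun y => ⟨0, y.1.1.1, y.2.1.1.2, y.1.1.2, Or.inl rfl, by
        have := y.2.1.2; omega, y.1.2⟩))
    (by
      rintro _ _ ⟨⟨⟨⟨k, l⟩, hx⟩, hs⟩, ⟨⟨⟨k', i⟩, hy⟩, ht⟩⟩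
      simp only [lowerDiagonal, Set.mem_ofPred_eq] at ht
      simp only [upperDiagonal, Set.mem_ofPred_eq] at hs
      simp [hs, ht])

/-- A vertex of a copy of the upper sail. -/
def upper (u l i : ℕ) (h : 2 * u + l ≤ H) (h' : i ≤ N) : SkyVertex H N :=
  Quot.mk _ (Sum.inl (⟨(u, l), h⟩, ⟨⟨(0, i), by simpa using h'⟩, rfl⟩))

/-- A vertex of a copy of the lower sail. -/
def lower (d l i : ℕ) (h : l ≤ H) (h' : d + i ≤ N) : SkyVertex H N :=
  Quot.mk _ (Sum.inr (⟨(d, i), h'⟩, ⟨⟨(0, l), by simpa using h⟩, rfl⟩))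

lemma upper_eq_lower (l i : ℕ) (h : 2 * 0 + l ≤ H) (h' : i ≤ N) :
    (upper 0 l i h h' : SkyVertex H N) = lower 0 l i (by omega) (by omega) :=
  Quot.sound (GlueRel.glue (⟨⟨(0, l), h⟩, rfl⟩ : upperDiagonal H)
    (⟨⟨(0, i), by simpa using h'⟩, rfl⟩ : lowerDiagonal N))

/-- The vertex of `K̂(H,A)` with given coordinates. -/
def toSky (c : SkyCoord H N) : SkyVertex H N :=
  if c.d = 0 then upper c.u c.l c.i c.upper_le (by have := c.lower_le; omega)
  else lower c.d c.l c.i (by have := c.upper_le; omega) c.lower_le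

lemma toSky_of_d {c : SkyCoord H N} (h : c.d = 0) : c.toSky =
    upper c.u c.l c.i c.upper_le (by have := c.lower_le; omega) := if_pos h

/-- On the diagonal a vertex has an upper and a lower description, and the gluing identifies them.
-/
lemma toSky_of_u {c : SkyCoord H N} (h : c.u = 0) : c.toSky =
    lower c.d c.l c.i (by have := c.upper_le; omega) c.lower_le := by
  by_cases hd : c.d = 0
  · obtain ⟨u, d, l, i, h1, h2, h3⟩ := c
    simp only at hd h
    subst hd h
    rw [toSky_of_d rfl, upper_eq_lower]
  · exact if_neg hd

lemma ofSky_toSky (c : SkyCoord H N) : ofSky c.toSky = c := by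
  by_cases h : c.d = 0
  · rw [toSky_of_d h]
    ext <;> simp [ofSky, upper, h]
  · have hu : c.u = 0 := c.u_or_d.resolve_right h
    rw [toSky_of_u hu]
    ext <;> simp [ofSky, lower, hu]

lemma toSky_ofSky (p : SkyVertex H N) : (ofSky p).toSky = p := by
  induction p using Quot.ind with
  | mk p =>
    rcases p with ⟨⟨⟨k, l⟩, hx⟩, ⟨⟨⟨k', i⟩, hy⟩, ht⟩⟩ | ⟨⟨⟨k', i⟩, hy⟩, ⟨⟨⟨k, l⟩, hx⟩, hs⟩⟩
    · simp only [lowerDiagonal, Set.mem_ofPred_eq] at ht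
      subst ht
      exact toSky_of_d rfl
    · simp only [upperDiagonal, Set.mem_ofPred_eq] at hs
      subst hs
      exact toSky_of_u rfl

/-- The isomorphism of `K̂(H,A)` in coordinates with the glued product. -/
def skyIso (H N : ℕ) : SkyGraph.Iso (coordSky H N) (skyK H N) where
  toFun := toSky
  invFun := ofSky
  left_inv := ofSky_toSky
  right_inv := toSky_ofSky
  edge_iff x a y := by
    constructor
    · rintro (⟨⟨⟨⟨k', i⟩, hy⟩, ht⟩, x', y', h, hx, hy⟩ | ⟨⟨⟨⟨k', i⟩, hy⟩, ht⟩, x', y', h, hx, hy⟩)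
      · have h1 : x = _ := (ofSky_toSky x).symm.trans (congrArg ofSky hx)
        have h2 : y = _ := (ofSky_toSky y).symm.trans (congrArg ofSky hy)
        subst h1 h2
        rcases h with ⟨h0, h1, h2⟩ | ⟨h0, h1, h2⟩ | ⟨h0, h1, h2⟩
        · exact Or.inl ⟨h0, rfl, rfl, h1, h2, rfl⟩
        · exact Or.inr (Or.inl ⟨h0, rfl, rfl, h1, h2, rfl⟩)
        · exact Or.inr (Or.inr (Or.inl ⟨h0, rfl, rfl, h1, h2, rfl⟩))
      · have h1 : x = _ := (ofSky_toSky x).symm.trans (congrArg ofSky hx)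
        have h2 : y = _ := (ofSky_toSky y).symm.trans (congrArg ofSky hy)
        subst h1 h2
        rcases h with ⟨h0, h1, h2⟩ | ⟨h0, h1, h2⟩
        · exact Or.inr (Or.inr (Or.inr (Or.inl ⟨h0, rfl, rfl, h1, rfl, h2⟩)))
        · exact Or.inr (Or.inr (Or.inr (Or.inr ⟨h0, rfl, rfl, h1, rfl, h2⟩)))
    · have hu : x.d = 0 → y.d = 0 → y.i = x.i → (upperSail H).E ⟨(x.u, x.l), x.upper_le⟩ a
          ⟨(y.u, y.l), y.upper_le⟩ → (skyK H N).E x.toSky a y.toSky := by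
        intro h1 h2 h3 h4
        refine Or.inl ⟨⟨⟨(0, x.i), by have := x.lower_le; omega⟩, rfl⟩, _, _, h4, toSky_of_d h1, ?_⟩
        rw [toSky_of_d h2]
        simp only [upper, h3]
      have hd : x.u = 0 → y.u = 0 → y.l = x.l → (lowerSail N).E ⟨(x.d, x.i), x.lower_le⟩ a
          ⟨(y.d, y.i), y.lower_le⟩ → (skyK H N).E x.toSky a y.toSky := by
        intro h1 h2 h3 h4
        refine Or.inr ⟨⟨⟨(0, x.l), by have := x.upper_le; omega⟩, rfl⟩, _, _, h4, toSky_of_u h1, ?_⟩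
        rw [toSky_of_u h2]
        simp only [lower, h3]
      rintro (⟨h0, h1, h2, h3, h4, h5⟩ | ⟨h0, h1, h2, h3, h4, h5⟩ | ⟨h0, h1, h2, h3, h4, h5⟩ |
        ⟨h0, h1, h2, h3, h4, h5⟩ | ⟨h0, h1, h2, h3, h4, h5⟩)
      · exact hu h1 h2 h5 (Or.inl ⟨h0, h3, h4⟩)
      · exact hu h1 h2 h5 (Or.inr (Or.inl ⟨h0, h3, h4⟩))
      · exact hu h1 h2 h5 (Or.inr (Or.inr ⟨h0, h3, h4⟩))
      · exact hd h1 h2 h4 (Or.inl ⟨h0, h3, h5⟩)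
      · exact hd h1 h2 h4 (Or.inr ⟨h0, h3, h5⟩)
  X_eq x := by
    by_cases h : x.d = 0
    · rw [toSky_of_d h]
      simp [skyK, upper, upperSail, coordSky, h]
    · have hu : x.u = 0 := x.u_or_d.resolve_right h
      change (skyK H N).X x.toSky = _
      rw [toSky_of_u hu]
      simp [skyK, lower, lowerSail, coordSky, add_comm]
  Y_eq x := by
    by_cases h : x.d = 0
    · rw [toSky_of_d h]
      simp [skyK, upper, upperSail, coordSky, h]
    · have hu : x.u = 0 := x.u_or_d.resolve_right h
      change (skyK H N).Y x.toSky = _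
      rw [toSky_of_u hu]
      simp [skyK, lower, lowerSail, coordSky, hu, add_comm]

end SkyCoord

/-! ### Classification of connected sky graphs from their axioms. -/

/-- The properties of views from the sky on R-graphs; `A` and `B` are the numbers of green edges
before and after the critical vertex. -/
structure SkySystem {W : Type u} (S : SkyGraph W) (A B : W → ℕ) : Prop where
  label_cases : ∀ {p a q}, S.E p a q → a = 0 ∨ a = 1 / 2 ∨ a = 1
  target_unique : ∀ {p a q q'}, S.E p a q → S.E p a q' → q = q'
  source_unique : ∀ {p a q p'}, S.E p a q → S.E p' a q → p = p'
  one_ranks : ∀ {p q}, S.E p 1 q →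
    (S.X q = S.X p + 1 ∧ S.Y q = S.Y p + 1 ∧ A q = A p ∧ B p = B q + 1 ∧
      ¬ ∃ r, S.E r (1 / 2) q) ∨
    (S.X q = S.X p + 2 ∧ S.Y q = S.Y p ∧ A p = A q + 1 ∧ B p = B q + 1 ∧ ∃ r, S.E r (1 / 2) q)
  zero_ranks : ∀ {p q}, S.E p 0 q →
    (S.X p = S.X q + 1 ∧ S.Y p = S.Y q + 1 ∧ A q = A p + 1 ∧ B q = B p ∧
      ¬ ∃ r, S.E p (1 / 2) r) ∨
    (S.X q = S.X p ∧ S.Y p = S.Y q + 2 ∧ A q = A p + 1 ∧ B q = B p + 1 ∧ ∃ r, S.E p (1 / 2) r)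
  half_ranks : ∀ {p q}, S.E p (1 / 2) q →
    S.X q = S.X p + 1 ∧ S.Y p = S.Y q + 1 ∧ A q = A p ∧ B q = B p
  one_out : ∀ {p}, 0 < B p → ∃ q, S.E p 1 q
  half_or_one_in : ∀ {p}, 0 < S.X p → (∃ q, S.E q (1 / 2) p) ∨ ∃ q, S.E q 1 p
  one_in : ∀ {p}, 2 ≤ S.X p → ∃ q, S.E q 1 p
  zero_in : ∀ {p}, 0 < A p → ∃ q, S.E q 0 p
  half_or_zero_out : ∀ {p}, 0 < S.Y p → (∃ q, S.E p (1 / 2) q) ∨ ∃ q, S.E p 0 q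
  zero_out : ∀ {p}, 2 ≤ S.Y p → ∃ q, S.E p 0 q
  rel_a : ∀ {p q s}, S.E p 1 q → S.E p 0 s → (¬ ∃ r, S.E p (1 / 2) r) →
    ∃ c, S.E s 1 c ∧ S.E q 0 c ∧ ¬ ∃ r, S.E r (1 / 2) q
  rel_b : ∀ {p q s}, S.E p 1 q → S.E s (1 / 2) q → ∃ c, S.E c 0 p ∧ S.E c (1 / 2) s
  rel_b_op : ∀ {p q s}, S.E q 0 p → S.E q (1 / 2) s → ∃ c, S.E p 1 c ∧ S.E s (1 / 2) c
  rel_c : ∀ {p q s}, S.E p 1 q → (∃ r, S.E r (1 / 2) q) → S.E p (1 / 2) s →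
    ∃ c, S.E c (1 / 2) q ∧ S.E c 0 s
  rel_c_op : ∀ {p q s}, S.E q 0 p → (∃ r, S.E q (1 / 2) r) → S.E s (1 / 2) p →
    ∃ c, S.E q (1 / 2) c ∧ S.E s 1 c
  rel_verma : ∀ {p q s}, S.E p 1 q → (¬ ∃ r, S.E r (1 / 2) q) → S.E p (1 / 2) s →
    ∃ d e b, S.E q 0 d ∧ S.E d (1 / 2) e ∧ S.E s 1 b ∧ (¬ ∃ r, S.E r (1 / 2) b) ∧ S.E b 0 e

namespace SkyGraph

variable {W : Type u} (S : SkyGraph W)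

/-- The end of the edge labelled `a` that leaves `p`. -/
noncomputable def next (a : ℚ) (p : W) : W :=
  open Classical in if h : ∃ q, S.E p a q then h.choose else p

lemma next_spec {a : ℚ} {p : W} (h : ∃ q, S.E p a q) : S.E p a (S.next a p) := by
  unfold next
  rw [dif_pos h]
  exact h.choose_spec

/-- `p` has all the edges labelled `1/2` that its vertex labels permit. -/
def Upper (p : W) : Prop :=
  (0 < S.X p → ∃ q, S.E q (1 / 2) p) ∧ (0 < S.Y p → ∃ q, S.E p (1 / 2) q)

/-- The edge labelled `1` that leaves `p` does not belong to an upper sail. -/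
def Ground (p : W) : Prop := ∀ q, S.E p 1 q → ¬ ∃ r, S.E r (1 / 2) q

end SkyGraph

namespace SkySystem

variable {W : Type u} {S : SkyGraph W} {A B : W → ℕ} (hS : SkySystem S A B)
include hS

lemma next_eq {a : ℚ} {p q : W} (h : S.E p a q) : S.next a p = q :=
  hS.target_unique (S.next_spec ⟨q, h⟩) h

/-- The target of the 1/2 edge has X at least 2, so an edge labelled 1 enters it, and `rel_b`
extends the chain of 1/2 edges backwards. Such a chain therefore starts only at X = 0. -/
lemma half_in {p : W} (h : ∃ q, S.E p (1 / 2) q) (hX : 0 < S.X p) : ∃ q, S.E q (1 / 2) p := by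
  obtain ⟨s, hs⟩ := h
  have h1 := hS.half_ranks hs
  obtain ⟨r, hr⟩ := hS.one_in (p := s) (by omega)
  obtain ⟨c, -, hc⟩ := hS.rel_b hr hs
  exact ⟨c, hc⟩

lemma half_out {p : W} (h : ∃ q, S.E q (1 / 2) p) (hY : 0 < S.Y p) : ∃ q, S.E p (1 / 2) q := by
  obtain ⟨s, hs⟩ := h
  have h1 := hS.half_ranks hs
  obtain ⟨r, hr⟩ := hS.zero_out (p := s) (by omega)
  obtain ⟨c, -, hc⟩ := hS.rel_b_op hr hs
  exact ⟨c, hc⟩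

/-- Without an outgoing 1/2 edge, an outgoing edge labelled 0 would be of lower type and lower X. -/
lemma upper_of_X {p : W} (h : S.X p = 0) : S.Upper p := by
  refine ⟨fun h' => by omega, fun hY => ?_⟩
  rcases hS.half_or_zero_out hY with h1 | ⟨q, hq⟩
  · exact h1
  · rcases hS.zero_ranks hq with h2 | h2
    · omega
    · exact h2.2.2.2.2

lemma upper_of_half {p q : W} (h : S.E p (1 / 2) q) : S.Upper q :=
  ⟨fun _ => ⟨p, h⟩, hS.half_out ⟨p, h⟩⟩

lemma ground_of_A {p : W} (h : A p = 0) : S.Ground p := by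
  intro q hq hr
  rcases hS.one_ranks hq with h2 | h2
  · exact h2.2.2.2.2 hr
  · omega

/-- An upper-type edge labelled 1 at `q` would be pulled back by `rel_b` and `rel_c_op` to one at
`p`. -/
lemma ground_of_half {p q : W} (hp : S.Ground p) (h : S.E p (1 / 2) q) : S.Ground q := by
  rintro v hv ⟨r, hr⟩
  obtain ⟨c, h1, h2⟩ := hS.rel_b hv hr
  obtain ⟨w, h3, h4⟩ := hS.rel_c_op h1 ⟨_, h2⟩ h
  exact hp w h4 ⟨c, h3⟩

lemma ground_of_zero {p q : W} (hp : ¬ ∃ r, S.E p (1 / 2) r) (h : S.E p 0 q) : S.Ground q := by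
  rintro v hv ⟨r, hr⟩
  obtain ⟨c, h1, h2⟩ := hS.rel_b hv hr
  exact hp ⟨r, by rwa [hS.source_unique h h1]⟩

/-- In an upper sail, the ends of edges labelled `0` lie in an upper sail. -/
lemma upper_of_zero {p q : W} (h : S.E p 0 q) (hp : ∃ r, S.E p (1 / 2) r) : S.Upper q := by
  obtain ⟨r, hr⟩ := hp
  obtain ⟨v, hv, hv'⟩ := hS.rel_b_op h hr
  -- The edge from `q` to `v` is of upper type, since `r` sends a 1/2 edge to `v`. If `q` had no
  -- outgoing 1/2 edge, `rel_a` would make it of lower type.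
  have key : ∀ s, S.E q 0 s → ∃ r, S.E q (1 / 2) r := by
    intro s hs
    by_contra hcon
    obtain ⟨c, -, -, h3⟩ := hS.rel_a hv hs hcon
    exact h3 ⟨_, hv'⟩
  refine ⟨fun hX => ?_, fun hY => ?_⟩
  · rcases hS.half_or_one_in hX with h1 | ⟨t, ht⟩
    · exact h1
    · rcases hS.one_ranks ht with h2 | h2
      · rcases hS.half_or_zero_out (p := q) (by omega) with h3 | ⟨s, hs⟩
        · exact hS.half_in h3 hX
        · exact hS.half_in (key s hs) hX
      · exact h2.2.2.2.2
  · rcases hS.half_or_zero_out hY with h1 | ⟨s, hs⟩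
    · exact h1
    · exact key s hs

end SkySystem

/-- `p` has the properties of the vertex `(u, 0, l, i)` of `K̂(H,N)`. -/
structure IsUpperAt {W : Type u} (S : SkyGraph W) (A B : W → ℕ) (H N u l i : ℕ) (p : W) :
    Prop where
  X : S.X p = l
  Y : S.Y p + l + 2 * u = H
  A : A p = i + u
  B : B p + i = N + u
  upper : S.Upper p

/-- `p` has the properties of the vertex `(0, d, l, i)`, `d > 0`, of `K̂(H,N)`. -/
structure IsLowerAt {W : Type u} (S : SkyGraph W) (A B : W → ℕ) (H N d l i : ℕ) (p : W) :
    Prop where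
  X : S.X p = l + d
  Y : S.Y p + l = H + d
  A : A p = i
  B : B p + i + d = N
  no_out : ¬ ∃ q, S.E p (1 / 2) q
  no_in : ¬ ∃ q, S.E q (1 / 2) p

namespace SkyGraph

variable {W : Type u} (S : SkyGraph W)

/-- The vertex `(0, 0, l, i)` of `K̂(H,N)`, in a graph with the given source. -/
noncomputable def diagVertex (s : W) (l i : ℕ) : W :=
  (S.next (1 / 2))^[l] ((fun p => S.next 0 (S.next 1 p))^[i] s)

noncomputable def upperVertex (s : W) (u l i : ℕ) : W :=
  (S.next 0)^[u] (S.diagVertex s l i)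

noncomputable def lowerVertex (s : W) (d l i : ℕ) : W :=
  (S.next 1)^[d] (S.diagVertex s l i)

end SkyGraph

namespace SkySystem

variable {W : Type u} {S : SkyGraph W} {A B : W → ℕ} (hS : SkySystem S A B)
  {H N : ℕ} {s : W}
include hS

section

variable (hX : S.X s = 0) (hA : A s = 0) (hY : S.Y s = H) (hB : B s = N)
include hX hA hY hB

/-- The diagonal at `l = 0` advances by a lower-type edge labelled 1 followed by one labelled 0.
Being `Ground` fixes the type of the first; its head then has no 1/2 edge at all, which fixes the
second and makes the next diagonal vertex `Ground` again. -/
lemma diag_zero {i : ℕ} (hi : i ≤ N) :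
    IsUpperAt S A B H N 0 0 i (S.diagVertex s 0 i) ∧ S.Ground (S.diagVertex s 0 i) ∧
    (i < N → S.E (S.diagVertex s 0 i) 1 (S.next 1 (S.diagVertex s 0 i)) ∧
      S.E (S.next 1 (S.diagVertex s 0 i)) 0 (S.diagVertex s 0 (i + 1))) := by
  have step : ∀ i p, IsUpperAt S A B H N 0 0 i p → S.Ground p → i < N →
      S.E p 1 (S.next 1 p) ∧ S.E (S.next 1 p) 0 (S.next 0 (S.next 1 p)) ∧
      IsUpperAt S A B H N 0 0 (i + 1) (S.next 0 (S.next 1 p)) ∧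
      S.Ground (S.next 0 (S.next 1 p)) := by
    intro i p hp hg hiN
    have h1 := hp.X
    have h2 := hp.Y
    have h3 := hp.A
    have h4 := hp.B
    have e1 := S.next_spec (hS.one_out (p := p) (by omega))
    have hno := hg _ e1
    have r1 := hS.one_ranks e1
    rw [or_iff_left (fun h => hno h.2.2.2.2)] at r1
    have hno' : ¬ ∃ r, S.E (S.next 1 p) (1 / 2) r := fun h => hno (hS.half_in h (by omega))
    have e2 := S.next_spec ((hS.half_or_zero_out (p := S.next 1 p) (by omega)).resolve_left hno')
    have r2 := hS.zero_ranks e2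
    rw [or_iff_left (fun h => hno' h.2.2.2.2)] at r2
    exact ⟨e1, e2, ⟨by omega, by omega, by omega, by omega, hS.upper_of_X (by omega)⟩,
      hS.ground_of_zero hno' e2⟩
  have hsucc : ∀ i, S.diagVertex s 0 (i + 1) = S.next 0 (S.next 1 (S.diagVertex s 0 i)) :=
    fun i => Function.iterate_succ_apply' _ _ _
  have key : ∀ i ≤ N, IsUpperAt S A B H N 0 0 i (S.diagVertex s 0 i) ∧
      S.Ground (S.diagVertex s 0 i) := by
    intro i
    induction i with
    | zero =>
      exact fun _ => ⟨⟨hX, hY, hA, hB, hS.upper_of_X hX⟩,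
        hS.ground_of_A hA⟩
    | succ i ih =>
      intro hi
      have h1 := ih (by omega)
      have h2 := step i _ h1.1 h1.2 (by omega)
      rw [hsucc]
      exact ⟨h2.2.2.1, h2.2.2.2⟩
  refine ⟨(key i hi).1, (key i hi).2, fun hiN => ?_⟩
  have h2 := step i _ (key i hi).1 (key i hi).2 hiN
  rw [hsucc]
  exact ⟨h2.1, h2.2.1⟩

lemma diag {l i : ℕ} (hl : l ≤ H) (hi : i ≤ N) :
    IsUpperAt S A B H N 0 l i (S.diagVertex s l i) ∧ S.Ground (S.diagVertex s l i) ∧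
    (l < H → S.E (S.diagVertex s l i) (1 / 2) (S.diagVertex s (l + 1) i)) := by
  have hsucc : ∀ l, S.diagVertex s (l + 1) i = S.next (1 / 2) (S.diagVertex s l i) :=
    fun l => Function.iterate_succ_apply' _ _ _
  have step : ∀ l p, IsUpperAt S A B H N 0 l i p → S.Ground p → l < H →
      S.E p (1 / 2) (S.next (1 / 2) p) ∧
      IsUpperAt S A B H N 0 (l + 1) i (S.next (1 / 2) p) ∧ S.Ground (S.next (1 / 2) p) := by
    intro l p hp hg hlt
    have h1 := hp.X
    have h2 := hp.Y
    have h3 := hp.A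
    have h4 := hp.B
    have e := S.next_spec (hp.upper.2 (by omega))
    have r := hS.half_ranks e
    exact ⟨e, ⟨by omega, by omega, by omega, by omega, hS.upper_of_half e⟩,
      hS.ground_of_half hg e⟩
  have key : ∀ l ≤ H, IsUpperAt S A B H N 0 l i (S.diagVertex s l i) ∧
      S.Ground (S.diagVertex s l i) := by
    intro l
    induction l with
    | zero =>
      intro _
      have := hS.diag_zero hX hA hY hB hi
      exact ⟨this.1, this.2.1⟩
    | succ l ih =>
      intro hl
      have h1 := ih (by omega)
      rw [hsucc]
      exact (step l _ h1.1 h1.2 (by omega)).2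
  refine ⟨(key l hl).1, (key l hl).2, fun hlt => ?_⟩
  rw [hsucc]
  exact (step l _ (key l hl).1 (key l hl).2 hlt).1

lemma diag_one {l i : ℕ} (hl : l ≤ H) (hi : i < N) :
    S.E (S.diagVertex s l i) 1 (S.next 1 (S.diagVertex s l i)) := by
  have h := (hS.diag hX hA hY hB hl hi.le).1.B
  exact S.next_spec (hS.one_out (by omega))

/-- The relation `rel_verma` carries the detour with labels 1 and 0 from `l` to `l + 1` along the
1/2 edges; this is what makes the copies of both sails fit along the diagonal. -/
lemma diag_zero_edge {l i : ℕ} (hl : l ≤ H) (hi : i < N) :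
    S.E (S.next 1 (S.diagVertex s l i)) 0 (S.diagVertex s l (i + 1)) := by
  induction l with
  | zero => exact ((hS.diag_zero hX hA hY hB hi.le).2.2 hi).2
  | succ l ih =>
    have h1 := hS.diag hX hA hY hB (l := l) (i := i) (by omega) hi.le
    have h2 := hS.diag hX hA hY hB (l := l) (i := i + 1) (by omega) hi
    have e1 := hS.diag_one hX hA hY hB (l := l) (by omega) hi
    obtain ⟨d, e, b, f1, f2, f3, f4, f5⟩ := hS.rel_verma e1 (h1.2.1 _ e1) (h1.2.2 (by omega))
    obtain rfl := hS.target_unique f1 (ih (by omega))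
    obtain rfl := hS.target_unique f2 (h2.2.2 (by omega))
    rwa [hS.next_eq f3]

/-- The first step down is of lower type by `Ground`. Afterwards the absence of 1/2 edges guarantees
an outgoing 0 edge, and `rel_a` makes the next step lower too. -/
lemma lower {d l i : ℕ} (hd : d + i ≤ N) (hl : l ≤ H) :
    (0 < d → IsLowerAt S A B H N d l i (S.lowerVertex s d l i)) ∧
    (d + 1 + i ≤ N → S.E (S.lowerVertex s d l i) 1 (S.lowerVertex s (d + 1) l i)) := by
  have hsucc : ∀ d, S.lowerVertex s (d + 1) l i = S.next 1 (S.lowerVertex s d l i) :=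
    fun d => Function.iterate_succ_apply' _ _ _
  have step : ∀ d p q, S.X p = l + d → S.Y p + l = H + d → A p = i → B p + i + d = N →
      S.E p 1 q → (¬ ∃ r, S.E r (1 / 2) q) → IsLowerAt S A B H N (d + 1) l i q := by
    intro d p q h1 h2 h3 h4 e hno
    have r1 := hS.one_ranks e
    rw [or_iff_left (fun h => hno h.2.2.2.2)] at r1
    exact ⟨by omega, by omega, by omega, by omega, fun h => hno (hS.half_in h (by omega)), hno⟩
  have h0 := hS.diag hX hA hY hB (l := l) (i := i) hl (by omega)
  have key : ∀ d, d + 1 + i ≤ N →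
      IsLowerAt S A B H N (d + 1) l i (S.lowerVertex s (d + 1) l i) := by
    intro d
    induction d with
    | zero =>
      intro hd
      rw [hsucc]
      have e := hS.diag_one hX hA hY hB (l := l) (i := i) hl (by omega)
      exact step 0 _ _ h0.1.X h0.1.Y h0.1.A h0.1.B e (h0.2.1 _ e)
    | succ d ih =>
      intro hd
      rw [hsucc]
      have h1 := ih (by omega)
      have hB1 := h1.B
      have hY1 := h1.Y
      have e := S.next_spec (hS.one_out (p := S.lowerVertex s (d + 1) l i) (by omega))
      obtain ⟨z, hz⟩ := (hS.half_or_zero_out (by omega)).resolve_left h1.no_out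
      obtain ⟨c, -, -, hc⟩ := hS.rel_a e hz h1.no_out
      exact step (d + 1) _ _ h1.X h1.Y h1.A h1.B e hc
  refine ⟨fun hpos => ?_, fun hd => ?_⟩
  · obtain ⟨d, rfl⟩ := Nat.exists_eq_succ_of_ne_zero hpos.ne'
    exact key d hd
  · rw [hsucc]
    apply S.next_spec
    apply hS.one_out
    rcases Nat.eq_zero_or_pos d with rfl | hpos
    · have := h0.1.B
      change 0 < B (S.diagVertex s l i)
      omega
    · obtain ⟨d, rfl⟩ := Nat.exists_eq_succ_of_ne_zero hpos.ne'
      have := (key d (by omega)).B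
      simp only [Nat.succ_eq_add_one] at *
      omega

/-- Each square of the triangular grid is closed by `rel_a`, starting from the edges next to the
diagonal. -/
lemma lower_zero_edge {d l i : ℕ} (hd : d + 1 + i ≤ N) (hl : l ≤ H) :
    S.E (S.lowerVertex s (d + 1) l i) 0 (S.lowerVertex s d l (i + 1)) := by
  induction d with
  | zero => exact hS.diag_zero_edge hX hA hY hB hl (by omega)
  | succ d ih =>
    have h1 := hS.lower hX hA hY hB (d := d + 1) (l := l) (i := i) (by omega) hl
    have h2 := (hS.lower hX hA hY hB (d := d) (l := l) (i := i + 1) (by omega) hl).2 (by omega)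
    obtain ⟨c, h3, h4, -⟩ := hS.rel_a (h1.2 hd) (ih (by omega)) (h1.1 (by omega)).no_out
    rwa [hS.target_unique h2 h3]

lemma upper {u l i : ℕ} (hu : 2 * u + l ≤ H) (hi : i ≤ N) :
    IsUpperAt S A B H N u l i (S.upperVertex s u l i) ∧
    (2 * (u + 1) + l ≤ H → S.E (S.upperVertex s u l i) 0 (S.upperVertex s (u + 1) l i)) := by
  have hsucc : ∀ u, S.upperVertex s (u + 1) l i = S.next 0 (S.upperVertex s u l i) :=
    fun d => Function.iterate_succ_apply' _ _ _
  have step : ∀ u p, IsUpperAt S A B H N u l i p → 2 * (u + 1) + l ≤ H →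
      S.E p 0 (S.next 0 p) ∧ IsUpperAt S A B H N (u + 1) l i (S.next 0 p) := by
    intro u p hp hlt
    have h1 := hp.X
    have h2 := hp.Y
    have h3 := hp.A
    have h4 := hp.B
    have e := S.next_spec (hS.zero_out (p := p) (by omega))
    have hh := hp.upper.2 (by omega)
    have r := hS.zero_ranks e
    rw [or_iff_right (fun h => h.2.2.2.2 hh)] at r
    exact ⟨e, ⟨by omega, by omega, by omega, by omega, hS.upper_of_zero e hh⟩⟩
  have key : ∀ u, 2 * u + l ≤ H → IsUpperAt S A B H N u l i (S.upperVertex s u l i) := by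
    intro u
    induction u with
    | zero => exact fun hl => (hS.diag hX hA hY hB (by omega) hi).1
    | succ u ih =>
      intro hu
      rw [hsucc]
      exact (step u _ (ih (by omega)) hu).2
  refine ⟨key u hu, fun hlt => ?_⟩
  rw [hsucc]
  exact (step u _ (key u hu) hlt).1

/-- On the preceding etage `rel_b_op` gives a 1/2 edge leaving `(u, l + 1)` in parallel to an
upper-type edge labelled 1 from `(u + 1, l)`. Then `rel_c` and uniqueness of sources and targets
identify the 1/2 neighbour of `(u + 1, l)` with `(u + 1, l + 1)`. -/
lemma upper_half_edge {u l i : ℕ} (hu : 2 * u + l + 1 ≤ H) (hi : i ≤ N) :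
    S.E (S.upperVertex s u l i) (1 / 2) (S.upperVertex s u (l + 1) i) := by
  induction u with
  | zero => exact (hS.diag hX hA hY hB (by omega) hi).2.2 (by omega)
  | succ u ih =>
    have e1 := (hS.upper hX hA hY hB (u := u) (l := l) (i := i) (by omega) hi).2 (by omega)
    have e2 := ih (by omega)
    have h1 := (hS.upper hX hA hY hB (u := u + 1) (l := l) (i := i) (by omega) hi).1
    have e3 := (hS.upper hX hA hY hB (u := u) (l := l + 1) (i := i) (by omega) hi).2 (by omega)
    have hY1 := h1.Y
    obtain ⟨v, hv, hv'⟩ := hS.rel_b_op e1 e2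
    obtain ⟨r, hr⟩ := h1.upper.2 (by omega)
    obtain ⟨w, hw, hw'⟩ := hS.rel_c hv ⟨_, hv'⟩ hr
    obtain rfl := hS.source_unique hw hv'
    rwa [hS.target_unique e3 hw']

lemma upper_one_edge {u l i : ℕ} (hu : 2 * (u + 1) + l ≤ H) (hi : i ≤ N) :
    S.E (S.upperVertex s (u + 1) l i) 1 (S.upperVertex s u (l + 2) i) := by
  have e1 := (hS.upper hX hA hY hB (u := u) (l := l) (i := i) (by omega) hi).2 (by omega)
  have e2 := hS.upper_half_edge hX hA hY hB (u := u) (l := l) (i := i) (by omega) hi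
  have e3 := hS.upper_half_edge hX hA hY hB (u := u) (l := l + 1) (i := i) (by omega) hi
  obtain ⟨v, hv, hv'⟩ := hS.rel_b_op e1 e2
  rwa [hS.target_unique e3 hv']

end

end SkySystem

/-- The vertex with given coordinates, in a graph with the given source. -/
noncomputable def SkyGraph.vertexAt {W : Type u} (S : SkyGraph W) (s : W) {H N : ℕ}
    (c : SkyCoord H N) : W :=
  if c.d = 0 then S.upperVertex s c.u c.l c.i else S.lowerVertex s c.d c.l c.i

namespace SkyGraph

variable {W : Type u} {S : SkyGraph W} {s : W} {H N : ℕ} {c : SkyCoord H N}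

lemma vertexAt_of_d (h : c.d = 0) : S.vertexAt s c = S.upperVertex s c.u c.l c.i := if_pos h

lemma vertexAt_of_u (h : c.u = 0) : S.vertexAt s c = S.lowerVertex s c.d c.l c.i := by
  by_cases hd : c.d = 0
  · rw [vertexAt_of_d hd, h, hd]
    rfl
  · exact if_neg hd

end SkyGraph

namespace SkySystem

variable {W : Type u} {S : SkyGraph W} {A B : W → ℕ} (hS : SkySystem S A B)
  {H N : ℕ} {s : W} (hX : S.X s = 0) (hA : A s = 0) (hY : S.Y s = H) (hB : B s = N)
include hS hX hA hY hB

lemma isUpperAt_vertexAt {c : SkyCoord H N} (h : c.d = 0) :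
    IsUpperAt S A B H N c.u c.l c.i (S.vertexAt s c) := by
  rw [SkyGraph.vertexAt_of_d h]
  exact (hS.upper hX hA hY hB c.upper_le (by have := c.lower_le; omega)).1

lemma isLowerAt_vertexAt {c : SkyCoord H N} (h : 0 < c.d) :
    IsLowerAt S A B H N c.d c.l c.i (S.vertexAt s c) := by
  have hu : c.u = 0 := c.u_or_d.resolve_right h.ne'
  rw [SkyGraph.vertexAt_of_u hu]
  exact (hS.lower hX hA hY hB c.lower_le (by have := c.upper_le; omega)).1 h

lemma vertexAt_ranks (c : SkyCoord H N) : S.X (S.vertexAt s c) = c.l + c.d ∧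
    S.Y (S.vertexAt s c) + c.l + 2 * c.u = H + c.d ∧ A (S.vertexAt s c) = c.i + c.u ∧
    B (S.vertexAt s c) + c.i + c.d = N + c.u := by
  rcases Nat.eq_zero_or_pos c.d with h | h
  · obtain ⟨h1, h2, h3, h4, -⟩ := hS.isUpperAt_vertexAt hX hA hY hB h
    omega
  · obtain ⟨h1, h2, h3, h4, -, -⟩ := hS.isLowerAt_vertexAt hX hA hY hB h
    have hu : c.u = 0 := c.u_or_d.resolve_right h.ne'
    omega

/-- X + Y gives `d - u`, and as one of `u`, `d` is zero, both are known; then X gives `l` and A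
gives `i`. -/
lemma vertexAt_injective : Function.Injective (S.vertexAt s : SkyCoord H N → W) := by
  intro c c' h
  have h1 := hS.vertexAt_ranks hX hA hY hB c
  have h2 := hS.vertexAt_ranks hX hA hY hB c'
  rw [h] at h1
  have h3 := c.u_or_d
  have h4 := c'.u_or_d
  ext <;> omega

lemma edge_vertexAt {x y : SkyCoord H N} {a : ℚ} (h : (coordSky H N).E x a y) :
    S.E (S.vertexAt s x) a (S.vertexAt s y) := by
  have x1 := x.upper_le
  have x2 := x.lower_le
  have y1 := y.upper_le
  have y2 := y.lower_le
  rcases h with (⟨rfl, h1, h2, h3, h4, h5⟩ | ⟨rfl, h1, h2, h3, h4, h5⟩ |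
    ⟨rfl, h1, h2, h3, h4, h5⟩ | ⟨rfl, h1, h2, h3, h4, h5⟩ | ⟨rfl, h1, h2, h3, h4, h5⟩)
  · rw [SkyGraph.vertexAt_of_d h1, SkyGraph.vertexAt_of_d h2, h3, h4, h5]
    exact hS.upper_half_edge hX hA hY hB (by omega) (by omega)
  · rw [SkyGraph.vertexAt_of_d h1, SkyGraph.vertexAt_of_d h2, h3, h4, h5]
    exact (hS.upper hX hA hY hB (by omega) (by omega)).2 (by omega)
  · rw [SkyGraph.vertexAt_of_d h1, SkyGraph.vertexAt_of_d h2, h3, h4, h5]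
    exact hS.upper_one_edge hX hA hY hB (by omega) (by omega)
  · rw [SkyGraph.vertexAt_of_u h1, SkyGraph.vertexAt_of_u h2, h3, h4, h5]
    exact (hS.lower hX hA hY hB (by omega) (by omega)).2 (by omega)
  · rw [SkyGraph.vertexAt_of_u h1, SkyGraph.vertexAt_of_u h2, h3, h4, h5]
    exact hS.lower_zero_edge hX hA hY hB (by omega) (by omega)

lemma exists_coord_out {x : SkyCoord H N} {a : ℚ} {q : W} (h : S.E (S.vertexAt s x) a q) :
    ∃ y, (coordSky H N).E x a y ∧ S.vertexAt s y = q := by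
  suffices hex : ∃ y, (coordSky H N).E x a y by
    obtain ⟨y, hy⟩ := hex
    exact ⟨y, hy, hS.target_unique (hS.edge_vertexAt hX hA hY hB hy) h⟩
  have hr := hS.vertexAt_ranks hX hA hY hB x
  obtain ⟨u, d, l, i, hud, x1, x2⟩ := x
  have x1 : 2 * u + l ≤ H := x1
  have x2 : d + i ≤ N := x2
  simp only at hr
  rcases hS.label_cases h with rfl | rfl | rfl
  · have h0 := hS.zero_ranks h
    rcases Nat.eq_zero_or_pos d with rfl | hd
    · have hup := (hS.isUpperAt_vertexAt hX hA hY hB (c := ⟨u, 0, l, i, hud, x1, x2⟩) rfl).upper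
      have : 2 ≤ S.Y (S.vertexAt s ⟨u, 0, l, i, hud, x1, x2⟩) := by
        rcases h0 with h0 | h0
        · exact absurd (hup.2 (by omega)) h0.2.2.2.2
        · omega
      exact ⟨⟨u + 1, 0, l, i, Or.inr rfl, by omega, x2⟩,
        Or.inr (Or.inl ⟨rfl, rfl, rfl, rfl, rfl, rfl⟩)⟩
    · obtain rfl : u = 0 := by omega
      obtain ⟨d, rfl⟩ := Nat.exists_eq_succ_of_ne_zero hd.ne'
      exact ⟨⟨0, d, l, i + 1, Or.inl rfl, x1, by omega⟩,
        Or.inr (Or.inr (Or.inr (Or.inr ⟨rfl, rfl, rfl, rfl, rfl, rfl⟩)))⟩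
  · have h0 := hS.half_ranks h
    rcases Nat.eq_zero_or_pos d with rfl | hd
    · exact ⟨⟨u, 0, l + 1, i, Or.inr rfl, by omega, x2⟩,
        Or.inl ⟨rfl, rfl, rfl, rfl, rfl, rfl⟩⟩
    · exact absurd ⟨q, h⟩
        (hS.isLowerAt_vertexAt hX hA hY hB (c := ⟨u, d, l, i, hud, x1, x2⟩) hd).no_out
  · have h0 := hS.one_ranks h
    rcases Nat.eq_zero_or_pos u with rfl | hu
    · exact ⟨⟨0, d + 1, l, i, Or.inl rfl, x1, by omega⟩,
        Or.inr (Or.inr (Or.inr (Or.inl ⟨rfl, rfl, rfl, rfl, rfl, rfl⟩)))⟩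
    · obtain rfl : d = 0 := by omega
      obtain ⟨u, rfl⟩ := Nat.exists_eq_succ_of_ne_zero hu.ne'
      exact ⟨⟨u, 0, l + 2, i, Or.inr rfl, by omega, x2⟩,
        Or.inr (Or.inr (Or.inl ⟨rfl, rfl, rfl, rfl, rfl, rfl⟩))⟩

lemma exists_coord_in {y : SkyCoord H N} {a : ℚ} {p : W} (h : S.E p a (S.vertexAt s y)) :
    ∃ x, (coordSky H N).E x a y ∧ S.vertexAt s x = p := by
  suffices hex : ∃ x, (coordSky H N).E x a y by
    obtain ⟨x, hx⟩ := hex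
    exact ⟨x, hx, hS.source_unique (hS.edge_vertexAt hX hA hY hB hx) h⟩
  have hr := hS.vertexAt_ranks hX hA hY hB y
  obtain ⟨u, d, l, i, hud, x1, x2⟩ := y
  have x1 : 2 * u + l ≤ H := x1
  have x2 : d + i ≤ N := x2
  simp only at hr
  rcases hS.label_cases h with rfl | rfl | rfl
  · have h0 := hS.zero_ranks h
    rcases Nat.eq_zero_or_pos u with rfl | hu
    · obtain ⟨i, rfl⟩ := Nat.exists_eq_succ_of_ne_zero (show i ≠ 0 by omega)
      exact ⟨⟨0, d + 1, l, i, Or.inl rfl, x1, by omega⟩,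
        Or.inr (Or.inr (Or.inr (Or.inr ⟨rfl, rfl, rfl, rfl, rfl, rfl⟩)))⟩
    · obtain rfl : d = 0 := by omega
      obtain ⟨u, rfl⟩ := Nat.exists_eq_succ_of_ne_zero hu.ne'
      exact ⟨⟨u, 0, l, i, Or.inr rfl, by omega, x2⟩,
        Or.inr (Or.inl ⟨rfl, rfl, rfl, rfl, rfl, rfl⟩)⟩
  · have h0 := hS.half_ranks h
    rcases Nat.eq_zero_or_pos d with rfl | hd
    · obtain ⟨l, rfl⟩ := Nat.exists_eq_succ_of_ne_zero (show l ≠ 0 by omega)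
      exact ⟨⟨u, 0, l, i, Or.inr rfl, by omega, x2⟩,
        Or.inl ⟨rfl, rfl, rfl, rfl, rfl, rfl⟩⟩
    · exact absurd ⟨p, h⟩
        (hS.isLowerAt_vertexAt hX hA hY hB (c := ⟨u, d, l, i, hud, x1, x2⟩) hd).no_in
  · have h0 := hS.one_ranks h
    rcases Nat.eq_zero_or_pos d with rfl | hd
    · have hup := (hS.isUpperAt_vertexAt hX hA hY hB (c := ⟨u, 0, l, i, hud, x1, x2⟩) rfl).upper
      have : 2 ≤ S.X (S.vertexAt s ⟨u, 0, l, i, hud, x1, x2⟩) := by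
        rcases h0 with h0 | h0
        · exact absurd (hup.1 (by omega)) h0.2.2.2.2
        · omega
      obtain ⟨l, rfl⟩ := Nat.exists_eq_add_of_le (show 2 ≤ l by omega)
      exact ⟨⟨u + 1, 0, l, i, Or.inr rfl, by omega, x2⟩,
        Or.inr (Or.inr (Or.inl ⟨rfl, rfl, rfl, rfl, by simp only []; omega, rfl⟩))⟩
    · obtain rfl : u = 0 := by omega
      obtain ⟨d, rfl⟩ := Nat.exists_eq_succ_of_ne_zero hd.ne'
      exact ⟨⟨0, d, l, i, Or.inl rfl, x1, by omega⟩,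
        Or.inr (Or.inr (Or.inr (Or.inl ⟨rfl, rfl, rfl, rfl, rfl, rfl⟩)))⟩

variable (hconn : ∀ p q : W, Relation.EqvGen (fun p q => ∃ a, S.E p a q) p q)
include hconn

lemma vertexAt_surjective : Function.Surjective (S.vertexAt s : SkyCoord H N → W) := by
  have key : ∀ p q, Relation.EqvGen (fun p q => ∃ a, S.E p a q) p q →
      (p ∈ Set.range (S.vertexAt s : SkyCoord H N → W) ↔
        q ∈ Set.range (S.vertexAt s : SkyCoord H N → W)) := by
    intro p q h
    induction h with
    | rel p q h =>
      obtain ⟨a, h⟩ := h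
      constructor
      · rintro ⟨x, rfl⟩
        obtain ⟨y, -, rfl⟩ := hS.exists_coord_out hX hA hY hB h
        exact ⟨y, rfl⟩
      · rintro ⟨y, rfl⟩
        obtain ⟨x, -, rfl⟩ := hS.exists_coord_in hX hA hY hB h
        exact ⟨x, rfl⟩
    | refl => exact Iff.rfl
    | symm _ _ _ ih => exact ih.symm
    | trans _ _ _ _ _ h1 h2 => exact h1.trans h2
  exact fun q => (key s q (hconn s q)).1
    ⟨⟨0, 0, 0, 0, Or.inl rfl, Nat.zero_le _, Nat.zero_le _⟩, rfl⟩

/-- A connected graph of this kind with the source `s` is `K̂(Y(s), B(s))`. -/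
noncomputable def coordIso : SkyGraph.Iso (coordSky H N) S where
  toEquiv := Equiv.ofBijective (S.vertexAt s)
    ⟨hS.vertexAt_injective hX hA hY hB, hS.vertexAt_surjective hX hA hY hB hconn⟩
  edge_iff x a y := by
    refine ⟨fun h => ?_, hS.edge_vertexAt hX hA hY hB⟩
    obtain ⟨y', hy, he⟩ := hS.exists_coord_out hX hA hY hB h
    rwa [← hS.vertexAt_injective hX hA hY hB he]
  X_eq x := (hS.vertexAt_ranks hX hA hY hB x).1
  Y_eq x := by
    have h1 := hS.vertexAt_ranks hX hA hY hB x
    have h2 := x.upper_le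
    change S.Y (S.vertexAt s x) = H - 2 * x.u - x.l + x.d
    omega

end SkySystem

/-! ### The view of an R-graph satisfies the axioms. -/

namespace BiDigraph

variable {V : Type u} {G : BiDigraph V}

variable (G) in
noncomputable def skyA (p : G.RedString) : ℕ := G.t2 (G.criticalVertex p)
variable (G) in
noncomputable def skyB (p : G.RedString) : ℕ := G.h2 (G.criticalVertex p)

lemma view_one {x y : V} : G.view.E (Quot.mk _ x) 1 (Quot.mk _ y) ↔ G.SkyOne x y := by
  simp only [view, SkyOne, same_iff, greenE_one, eq_comm]

lemma view_half {x y : V} : G.view.E (Quot.mk _ x) (1 / 2) (Quot.mk _ y) ↔ G.SkyHalf x y := by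
  simp only [view, SkyHalf, same_iff, greenE_half, eq_comm]

lemma view_zero {x y : V} : G.view.E (Quot.mk _ x) 0 (Quot.mk _ y) ↔ G.SkyZero x y := by
  simp only [view, SkyZero, same_iff, greenE_zero, eq_comm]

lemma view_X (x : V) : G.view.X (Quot.mk _ x) = G.cX x := rfl
lemma view_Y (x : V) : G.view.Y (Quot.mk _ x) = G.cY x := rfl

lemma exists_redString {P : G.RedString → Prop} : (∃ p, P p) ↔ ∃ x, P (Quot.mk _ x) :=
  ⟨fun ⟨p, hp⟩ => by
    induction p using Quot.ind with
    | mk x => exact ⟨x, hp⟩, fun ⟨x, hx⟩ => ⟨_, hx⟩⟩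

namespace IsRGraph

variable (hG : G.IsRGraph)
include hG

lemma view_label {p q : G.RedString} {a : ℚ} (h : G.view.E p a q) : a = 0 ∨ a = 1 / 2 ∨ a = 1 := by
  obtain ⟨x, y, -, -, h⟩ := h
  rcases hG.green_cases h.1 with h1 | h1 | h1
  · exact Or.inl (h.2.symm.trans (greenE_zero.2 h1).2)
  · exact Or.inr (Or.inl (h.2.symm.trans (greenE_half.2 h1).2))
  · exact Or.inr (Or.inr (h.2.symm.trans (greenE_one.2 h1).2))

lemma skySystem : SkySystem G.view G.skyA G.skyB where
  label_cases := hG.view_label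
  target_unique {p a q q'} h h' := by
    obtain ⟨x, rfl⟩ := Quot.exists_rep p
    obtain ⟨y, rfl⟩ := Quot.exists_rep q
    obtain ⟨y', rfl⟩ := Quot.exists_rep q'
    rw [← same_iff]
    rcases hG.view_label h with rfl | rfl | rfl
    · exact hG.skyZero_target (view_zero.1 h) (view_zero.1 h') (.refl x)
    · exact hG.skyHalf_target (view_half.1 h) (view_half.1 h') (.refl x)
    · exact hG.skyOne_target (view_one.1 h) (view_one.1 h') (.refl x)
  source_unique {p a q p'} h h' := by
    obtain ⟨x, rfl⟩ := Quot.exists_rep p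
    obtain ⟨y, rfl⟩ := Quot.exists_rep q
    obtain ⟨x', rfl⟩ := Quot.exists_rep p'
    rw [← same_iff]
    rcases hG.view_label h with rfl | rfl | rfl
    · exact hG.skyZero_source (view_zero.1 h) (view_zero.1 h') (.refl y)
    · exact hG.skyHalf_source (view_half.1 h) (view_half.1 h') (.refl y)
    · exact hG.skyOne_source (view_one.1 h) (view_one.1 h') (.refl y)
  one_ranks {p q} h := by
    obtain ⟨x, rfl⟩ := Quot.exists_rep p
    obtain ⟨y, rfl⟩ := Quot.exists_rep q
    simp only [exists_redString, view_half]
    exact hG.skyOne_ranks (view_one.1 h)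
  zero_ranks {p q} h := by
    obtain ⟨x, rfl⟩ := Quot.exists_rep p
    obtain ⟨y, rfl⟩ := Quot.exists_rep q
    simp only [exists_redString, view_half]
    exact hG.skyZero_ranks (view_zero.1 h)
  half_ranks {p q} h := by
    obtain ⟨x, rfl⟩ := Quot.exists_rep p
    obtain ⟨y, rfl⟩ := Quot.exists_rep q
    exact hG.skyHalf_ranks (view_half.1 h)
  one_out {p} h := by
    obtain ⟨x, rfl⟩ := Quot.exists_rep p
    simp only [exists_redString, view_one]
    exact hG.exists_skyOne h
  half_or_one_in {p} h := by
    obtain ⟨x, rfl⟩ := Quot.exists_rep p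
    simp only [exists_redString, view_one, view_half]
    exact hG.exists_skyHalf_or_skyOne h
  one_in {p} h := by
    obtain ⟨x, rfl⟩ := Quot.exists_rep p
    simp only [exists_redString, view_one]
    exact hG.exists_skyOne_in h
  zero_in {p} h := by
    obtain ⟨x, rfl⟩ := Quot.exists_rep p
    simp only [exists_redString, view_zero]
    exact hG.exists_skyZero_in h
  half_or_zero_out {p} h := by
    obtain ⟨x, rfl⟩ := Quot.exists_rep p
    simp only [exists_redString, view_zero, view_half]
    exact hG.exists_skyHalf_or_skyZero h
  zero_out {p} h := by
    obtain ⟨x, rfl⟩ := Quot.exists_rep p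
    simp only [exists_redString, view_zero]
    exact hG.exists_skyZero h
  rel_a {p q s} := by
    obtain ⟨x, rfl⟩ := Quot.exists_rep p
    obtain ⟨y, rfl⟩ := Quot.exists_rep q
    obtain ⟨z, rfl⟩ := Quot.exists_rep s
    simp only [exists_redString, view_zero, view_half, view_one]
    exact hG.sky_rel_a
  rel_b {p q s} := by
    obtain ⟨x, rfl⟩ := Quot.exists_rep p
    obtain ⟨y, rfl⟩ := Quot.exists_rep q
    obtain ⟨z, rfl⟩ := Quot.exists_rep s
    simp only [exists_redString, view_zero, view_half, view_one]
    exact hG.sky_rel_b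
  rel_b_op {p q s} := by
    obtain ⟨x, rfl⟩ := Quot.exists_rep p
    obtain ⟨y, rfl⟩ := Quot.exists_rep q
    obtain ⟨z, rfl⟩ := Quot.exists_rep s
    simp only [exists_redString, view_zero, view_half, view_one]
    exact hG.sky_rel_b_op
  rel_c {p q s} := by
    obtain ⟨x, rfl⟩ := Quot.exists_rep p
    obtain ⟨y, rfl⟩ := Quot.exists_rep q
    obtain ⟨z, rfl⟩ := Quot.exists_rep s
    simp only [exists_redString, view_zero, view_half, view_one]
    exact hG.sky_rel_c
  rel_c_op {p q s} := by
    obtain ⟨x, rfl⟩ := Quot.exists_rep p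
    obtain ⟨y, rfl⟩ := Quot.exists_rep q
    obtain ⟨z, rfl⟩ := Quot.exists_rep s
    simp only [exists_redString, view_zero, view_half, view_one]
    exact hG.sky_rel_c_op
  rel_verma {p q s} := by
    obtain ⟨x, rfl⟩ := Quot.exists_rep p
    obtain ⟨y, rfl⟩ := Quot.exists_rep q
    obtain ⟨z, rfl⟩ := Quot.exists_rep s
    simp only [exists_redString, view_zero, view_half, view_one]
    exact hG.sky_rel_verma

end IsRGraph

end BiDigraph

/-! ### Sources, connectedness, and the parameters `H` and `N`. -/

namespace SkySystem

variable {W : Type u} {S : SkyGraph W} {A B : W → ℕ} (hS : SkySystem S A B)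
include hS

/-- The weights 2 and 3 make `2X + 3A` drop along every edge traversed backwards: an upper-type edge
labelled 1 changes it by -4 + 3, a lower-type edge labelled 0 by 2 - 3. -/
lemma exists_source (n : ℕ) : ∀ p, 2 * S.X p + 3 * A p ≤ n → ∃ s, S.X s = 0 ∧ A s = 0 ∧
    Relation.EqvGen (fun p q => ∃ a, S.E p a q) s p := by
  induction n with
  | zero => exact fun p hp => ⟨p, by omega, by omega, .refl p⟩
  | succ n ih =>
    intro p hp
    have step : ∀ q a, S.E q a p → 2 * S.X q + 3 * A q ≤ n → ∃ s, S.X s = 0 ∧ A s = 0 ∧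
        Relation.EqvGen (fun p q => ∃ a, S.E p a q) s p := by
      intro q a h hq
      obtain ⟨s, h1, h2, h3⟩ := ih q hq
      exact ⟨s, h1, h2, .trans _ _ _ h3 (.rel _ _ ⟨a, h⟩)⟩
    rcases Nat.eq_zero_or_pos (A p) with hA | hA
    · rcases Nat.eq_zero_or_pos (S.X p) with hX | hX
      · exact ⟨p, hX, hA, .refl p⟩
      · rcases hS.half_or_one_in hX with ⟨q, hq⟩ | ⟨q, hq⟩
        · have := hS.half_ranks hq
          exact step q _ hq (by omega)
        · have := hS.one_ranks hq
          exact step q _ hq (by omega)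
    · obtain ⟨q, hq⟩ := hS.zero_in hA
      have := hS.zero_ranks hq
      exact step q _ hq (by omega)

lemma not_edge_of_source {p q : W} {a : ℚ} (hX : S.X q = 0) (hA : A q = 0) : ¬ S.E p a q := by
  intro h
  rcases hS.label_cases h with rfl | rfl | rfl
  · have := hS.zero_ranks h
    omega
  · have := hS.half_ranks h
    omega
  · have := hS.one_ranks h
    omega

end SkySystem

/-- The source of `K̂(H,N)`. -/
def SkyCoord.origin (H N : ℕ) : SkyCoord H N := ⟨0, 0, 0, 0, Or.inl rfl, Nat.zero_le _, Nat.zero_le _⟩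

lemma SkyCoord.eq_origin {H N : ℕ} {c : SkyCoord H N} (h : ∀ x a, ¬ (coordSky H N).E x a c) :
    c = SkyCoord.origin H N := by
  obtain ⟨u, d, l, i, hud, h1, h2⟩ := c
  have h1' : 2 * u + l ≤ H := h1
  have h2' : d + i ≤ N := h2
  have hu : u = 0 := by
    by_contra hne
    obtain ⟨u, rfl⟩ := Nat.exists_eq_succ_of_ne_zero hne
    obtain rfl : d = 0 := by omega
    exact h ⟨u, 0, l, i, Or.inr rfl, by omega, h2⟩ 0
      (Or.inr (Or.inl ⟨rfl, rfl, rfl, rfl, rfl, rfl⟩))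
  subst hu
  have hd : d = 0 := by
    by_contra hne
    obtain ⟨d, rfl⟩ := Nat.exists_eq_succ_of_ne_zero hne
    exact h ⟨0, d, l, i, Or.inl rfl, h1, by omega⟩ 1
      (Or.inr (Or.inr (Or.inr (Or.inl ⟨rfl, rfl, rfl, rfl, rfl, rfl⟩))))
  subst hd
  have hi : i = 0 := by
    by_contra hne
    obtain ⟨i, rfl⟩ := Nat.exists_eq_succ_of_ne_zero hne
    exact h ⟨0, 1, l, i, Or.inl rfl, h1, by omega⟩ 0
      (Or.inr (Or.inr (Or.inr (Or.inr ⟨rfl, rfl, rfl, rfl, rfl, rfl⟩))))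
  subst hi
  have hl : l = 0 := by
    by_contra hne
    obtain ⟨l, rfl⟩ := Nat.exists_eq_succ_of_ne_zero hne
    exact h ⟨0, 0, l, 0, Or.inl rfl, by omega, h2⟩ (1 / 2)
      (Or.inl ⟨rfl, rfl, rfl, rfl, rfl, rfl⟩)
  subst hl
  rfl

/-- X + Y equals `H + 2d - 2u`, whose maximum `H + 2N` is attained at `d = N`. -/
lemma coordSky_le_of_iso {H N N' : ℕ} (φ : SkyGraph.Iso (coordSky H N) (coordSky H N')) :
    N ≤ N' := by
  let c : SkyCoord H N := ⟨0, N, 0, 0, Or.inl rfl, Nat.zero_le _, le_rfl⟩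
  have h1 : (φ.toFun c).l + (φ.toFun c).d = 0 + N := φ.X_eq c
  have h2 : H - 2 * (φ.toFun c).u - (φ.toFun c).l + (φ.toFun c).d = H - 2 * 0 - 0 + N := φ.Y_eq c
  have h3 := (φ.toFun c).upper_le
  have h4 := (φ.toFun c).lower_le
  omega

namespace BiDigraph

variable {V : Type u} {W : Type v} {G : BiDigraph V} {G' : BiDigraph W}

lemma sky_eqvGen {x y : V} (h : Relation.EqvGen (fun p q => G.red p q ∨ G.green p q) x y) :
    Relation.EqvGen (fun p q => ∃ a, G.view.E p a q) (Quot.mk _ x) (Quot.mk _ y) := by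
  induction h with
  | rel x y h =>
    rcases h with h | h
    · rw [Quot.sound h]
      exact .refl _
    · exact .rel _ _ ⟨_, x, y, rfl, rfl, h, rfl⟩
  | refl => exact .refl _
  | symm _ _ _ ih => exact .symm _ _ ih
  | trans _ _ _ _ _ h1 h2 => exact .trans _ _ _ h1 h2

lemma eqvGen_of_same {x y : V} (h : G.Same x y) :
    Relation.EqvGen (fun p q => G.red p q ∨ G.green p q) x y := by
  induction h with
  | rel x y h => exact .rel _ _ (Or.inl h)
  | refl => exact .refl _
  | symm _ _ _ ih => exact .symm _ _ ih
  | trans _ _ _ _ _ h1 h2 => exact .trans _ _ _ h1 h2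

lemma eqvGen_of_sky {p q : G.RedString}
    (h : Relation.EqvGen (fun p q => ∃ a, G.view.E p a q) p q) : ∀ x y : V,
    Quot.mk _ x = p → Quot.mk _ y = q →
    Relation.EqvGen (fun p q => G.red p q ∨ G.green p q) x y := by
  induction h with
  | rel p q h =>
    rintro x y rfl rfl
    obtain ⟨a, x', y', h1, h2, h3⟩ := h
    exact .trans _ _ _ (eqvGen_of_same (same_iff.2 h1.symm))
      (.trans _ _ _ (.rel _ _ (Or.inr h3.1)) (eqvGen_of_same (same_iff.2 h2)))
  | refl p =>
    intro x y h1 h2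
    exact eqvGen_of_same (same_iff.2 (h1.trans h2.symm))
  | symm _ _ _ ih => exact fun x y h1 h2 => .symm _ _ (ih y x h2 h1)
  | trans p q r _ _ ih1 ih2 =>
    intro x y h1 h2
    obtain ⟨z, hz⟩ := Quot.exists_rep q
    exact .trans _ _ _ (ih1 x z h1 hz) (ih2 z y hz h2)

namespace IsRGraph

variable (hG : G.IsRGraph)
include hG

lemma isSource_iff {s : V} : G.IsSource s ↔ G.t1 s = 0 ∧ G.t2 s = 0 := by
  constructor
  · intro h
    constructor
    · by_contra hne
      obtain ⟨x, hx⟩ := hG.red_paths.exists_in (Nat.pos_of_ne_zero hne)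
      exact (h x).1 hx
    · by_contra hne
      obtain ⟨x, hx⟩ := hG.green_paths.exists_in (Nat.pos_of_ne_zero hne)
      exact (h x).2 hx
  · rintro ⟨h1, h2⟩ x
    refine ⟨fun hx => ?_, fun hx => ?_⟩
    · have := hG.red_paths.in_rank hx
      omega
    · have := hG.green_paths.in_rank hx
      omega

/-- Up to the critical vertex `t1 + t2` is constant, so it vanishes there too: the source is the
critical vertex of its string. -/
lemma ranks_of_isSource {s : V} (h : G.IsSource s) :
    G.cX s = 0 ∧ G.cA s = 0 ∧ G.cY s = G.h1 s ∧ G.cB s = G.h2 s ∧ G.t1 s = 0 := by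
  rw [hG.isSource_iff] at h
  have h1 := (hG.ranks_of_le (x := s) (by omega)).2
  have h2 := hG.t1_add_h1 s
  omega

lemma exists_isSource (x : V) : ∃ s, G.IsSource s ∧
    Relation.EqvGen (fun p q => G.red p q ∨ G.green p q) s x := by
  obtain ⟨p, h1, h2, h3⟩ := hG.skySystem.exists_source _ (Quot.mk _ x) le_rfl
  obtain ⟨y, rfl⟩ := Quot.exists_rep p
  exact ⟨G.crit y, hG.isSource_iff.2 ⟨h1, h2⟩,
    eqvGen_of_sky h3 _ _ (same_iff.1 (hG.same_crit y).symm) rfl⟩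

lemma eq_of_isSource {s s' : V} (h : G.IsSource s) (h' : G.IsSource s') (hs : G.Same s s') :
    s = s' :=
  hG.eq_of_same hs ((hG.isSource_iff.1 h).1.trans (hG.isSource_iff.1 h').1.symm)

/-- The view from the sky on a connected R-graph. -/
noncomputable def viewIso (hc : G.IsConnected) {s : V} (hs : G.IsSource s) :
    SkyGraph.Iso (coordSky (G.h1 s) (G.h2 s)) G.view :=
  have h := hG.ranks_of_isSource hs
  hG.skySystem.coordIso (s := Quot.mk _ s) h.1 h.2.1 h.2.2.1 h.2.2.2.1 fun p q => by
    obtain ⟨x, rfl⟩ := Quot.exists_rep p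
    obtain ⟨y, rfl⟩ := Quot.exists_rep q
    exact sky_eqvGen (hc.2 x y)

/-- A string with X = A = 0 receives no edge in the view, and the origin is the only such vertex in
coordinates. Hence all sources lie on one string, at position zero. -/
lemma mk_eq_of_isSource {H N : ℕ} (φ : SkyGraph.Iso (coordSky H N) G.view) {s : V}
    (hs : G.IsSource s) : Quot.mk _ s = φ.toEquiv (SkyCoord.origin H N) := by
  have h := hG.ranks_of_isSource hs
  rw [← φ.toEquiv.symm_apply_eq]
  apply SkyCoord.eq_origin
  intro x a hx
  rw [← φ.edge_iff] at hx
  have h1 : φ.toFun (φ.toEquiv.symm (Quot.mk _ s)) = Quot.mk _ s := φ.toEquiv.apply_symm_apply _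
  rw [h1] at hx
  exact hG.skySystem.not_edge_of_source h.1 h.2.1 hx

lemma source_unique {H N : ℕ} (φ : SkyGraph.Iso (coordSky H N) G.view) {s s' : V}
    (hs : G.IsSource s) (hs' : G.IsSource s') : s = s' :=
  hG.eq_of_isSource hs hs' (same_iff.2
    ((hG.mk_eq_of_isSource φ hs).trans (hG.mk_eq_of_isSource φ hs').symm))

lemma isConnected_of_unique_source {s : V} (h : ∀ s', G.IsSource s' → s' = s) :
    G.IsConnected := by
  refine ⟨⟨s⟩, fun x y => ?_⟩
  obtain ⟨a, ha, hx⟩ := hG.exists_isSource x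
  obtain ⟨b, hb, hy⟩ := hG.exists_isSource y
  rw [h a ha] at hx
  rw [h b hb] at hy
  exact .trans _ _ _ (.symm _ _ hx) hy

theorem isK (hc : G.IsConnected) {s : V} (hs : G.IsSource s) : IsK (G.h1 s) (G.h2 s) G :=
  ⟨hG, ⟨(hG.viewIso hc hs).symm.trans (SkyCoord.skyIso _ _)⟩⟩

theorem exists_unique_source (hc : G.IsConnected) :
    ∃ s : V, G.IsSource s ∧ (∀ s' : V, G.IsSource s' → s' = s) ∧ IsK (G.h1 s) (G.h2 s) G := by
  obtain ⟨x⟩ := hc.1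
  obtain ⟨s, hs, -⟩ := hG.exists_isSource x
  exact ⟨s, hs, fun s' hs' => hG.source_unique (hG.viewIso hc hs) hs' hs, hG.isK hc hs⟩

end IsRGraph

theorem connected_of_isK {H N : ℕ} (h : IsK H N G) :
    G.IsConnected ∧ ∀ s : V, G.IsSource s → G.h1 s = H ∧ G.h2 s = N := by
  obtain ⟨hG, ⟨φ'⟩⟩ := h
  let φ : SkyGraph.Iso (coordSky H N) G.view := (SkyCoord.skyIso H N).trans φ'.symm
  have hc : G.IsConnected := by
    obtain ⟨x, -⟩ := Quot.exists_rep (φ.toEquiv (SkyCoord.origin H N))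
    obtain ⟨s, hs, -⟩ := hG.exists_isSource x
    exact hG.isConnected_of_unique_source fun s' hs' => hG.source_unique φ hs' hs
  refine ⟨hc, fun s hs => ?_⟩
  have h1 : G.h1 s = H := by
    rw [← (hG.ranks_of_isSource hs).2.2.1, ← view_Y, hG.mk_eq_of_isSource φ hs]
    exact φ.Y_eq _
  refine ⟨h1, ?_⟩
  -- The vertex labels at the origin do not show the green length. It is found by comparing two
  -- coordinate descriptions of the same view.
  obtain ⟨χ⟩ : Nonempty (SkyGraph.Iso (coordSky H (G.h2 s)) (coordSky H N)) :=
    by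
      have := hG.viewIso hc hs
      rw [h1] at this
      exact ⟨this.trans φ.symm⟩
  exact le_antisymm (coordSky_le_of_iso χ) (coordSky_le_of_iso χ.symm)

/-! ### Reconstruction of an R-graph from its view. -/

section Reconstruction

lemma IsRGraph.red_iff (hG : G.IsRGraph) {x y : V} :
    G.red x y ↔ Quot.mk G.red x = Quot.mk G.red y ∧ G.t1 y = G.t1 x + 1 := by
  constructor
  · exact fun h => ⟨Quot.sound h, hG.red_paths.in_rank h⟩
  · rintro ⟨h1, h2⟩
    have hs : G.Same x y := same_iff.2 h1
    have h3 := hG.red_paths.add_eq_of_eqvGen hs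
    obtain ⟨z, hz⟩ := hG.red_paths.exists_out (x := x) (by omega)
    have h4 := hG.red_paths.in_rank hz
    rwa [hG.eq_of_same (hs.symm.trans (Same.of_red hz)) (by omega)]

/-- Equal X and Y give corresponding strings the same length, so every position exists on the image
string. -/
lemma exists_lift (hG : G.IsRGraph) (hG' : G'.IsRGraph) (φ : SkyGraph.Iso G.view G'.view)
    (x : V) : ∃ y : W, φ.toEquiv (Quot.mk G.red x) = Quot.mk G'.red y ∧ G'.t1 y = G.t1 x := by
  obtain ⟨z, hz⟩ := Quot.exists_rep (φ.toEquiv (Quot.mk G.red x))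
  have h1 : G'.cX z = G.cX x := by
    rw [← view_X, hz]
    exact φ.X_eq _
  have h2 : G'.cY z = G.cY x := by
    rw [← view_Y, hz]
    exact φ.Y_eq _
  have h3 := hG.t1_add_h1 x
  obtain ⟨y, hy, hyt⟩ := hG'.exists_same z (j := G.t1 x) (by omega)
  exact ⟨y, hz.symm.trans (same_iff.1 hy), hyt⟩

lemma green_iff_of_lift (hG : G.IsRGraph) (hG' : G'.IsRGraph) (φ : SkyGraph.Iso G.view G'.view)
    {x y : V} {x' y' : W} (hx : φ.toEquiv (Quot.mk G.red x) = Quot.mk G'.red x')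
    (hy : φ.toEquiv (Quot.mk G.red y) = Quot.mk G'.red y') (hx' : G'.t1 x' = G.t1 x)
    (hy' : G'.t1 y' = G.t1 y) : G'.green x' y' ↔ G.green x y := by
  have hcX : G'.cX x' = G.cX x := by
    rw [← view_X, ← hx]
    exact φ.X_eq _
  have hE : ∀ a, G'.view.E (Quot.mk _ x') a (Quot.mk _ y') ↔
      G.view.E (Quot.mk _ x) a (Quot.mk _ y) := fun a => by
    rw [← hx, ← hy]
    exact φ.edge_iff _ _ _
  have hH : (∃ z, G'.SkyHalf x' z) ↔ ∃ z, G.SkyHalf x z := by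
    simp only [← view_half]
    rw [← exists_redString (P := fun p => G'.view.E (Quot.mk _ x') (1 / 2) p),
      ← exists_redString (P := fun p => G.view.E (Quot.mk _ x) (1 / 2) p),
      ← φ.toEquiv.exists_congr_right, ← hx]
    exact exists_congr fun p => φ.edge_iff _ _ _
  rw [hG.green_iff, hG'.green_iff, hcX, hx', hy', hH, ← view_one, ← view_half, ← view_zero,
    hE, hE, hE, view_one, view_half, view_zero]

lemma Iso.toEquiv_injective :
    Function.Injective (fun ψ : BiDigraph.Iso G G' => ψ.toEquiv) := by
  rintro ⟨e, _, _⟩ ⟨e', _, _⟩ h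
  obtain rfl : e = e' := h
  rfl

/-- The ranks pulled back from `G'` make the red graph of `G` a union of ranked paths, and such
ranks are unique. So an isomorphism is determined by its effect on strings. -/
lemma Iso.t1_eq (hG : G.IsRGraph) (hG' : G'.IsRGraph) (ψ : BiDigraph.Iso G G') (x : V) :
    G'.t1 (ψ.toEquiv x) = G.t1 x := by
  have h' := hG'.red_paths
  have key : RankedPaths G.red (fun x => G'.t1 (ψ.toEquiv x)) (fun x => G'.h1 (ψ.toEquiv x)) :=
    { func := hG.red_paths.func
      inj := hG.red_paths.inj
      out_rank := fun h => h'.out_rank ((ψ.red_iff _ _).2 h)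
      in_rank := fun h => h'.in_rank ((ψ.red_iff _ _).2 h)
      exists_out := fun {x} h => by
        obtain ⟨y, hy⟩ := h'.exists_out h
        refine ⟨ψ.toEquiv.symm y, (ψ.red_iff _ _).1 ?_⟩
        rwa [show ψ.toFun (ψ.toEquiv.symm y) = y from ψ.toEquiv.apply_symm_apply y]
      exists_in := fun {x} h => by
        obtain ⟨y, hy⟩ := h'.exists_in h
        refine ⟨ψ.toEquiv.symm y, (ψ.red_iff _ _).1 ?_⟩
        rwa [show ψ.toFun (ψ.toEquiv.symm y) = y from ψ.toEquiv.apply_symm_apply y] }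
  exact (key.inLen_eq x).symm

theorem existsUnique_iso (hG : G.IsRGraph) (hG' : G'.IsRGraph)
    (φ : SkyGraph.Iso G.view G'.view) : ∃! ψ : BiDigraph.Iso G G', ∀ x : V,
      φ.toEquiv (Quot.mk G.red x) = Quot.mk G'.red (ψ.toEquiv x) := by
  choose f hf hft using exists_lift hG hG' φ
  choose g hg hgt using exists_lift hG' hG φ.symm
  have hg' : ∀ y, Quot.mk G'.red y = φ.toEquiv (Quot.mk G.red (g y)) := fun y =>
    (φ.toEquiv.symm_apply_eq).1 (hg y)
  let e : V ≃ W :=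
    { toFun := f
      invFun := g
      left_inv := fun x => hG.eq_of_same (same_iff.2 (φ.toEquiv.injective
        ((hg' (f x)).symm.trans (hf x).symm))) ((hgt _).trans (hft _))
      right_inv := fun y => hG'.eq_of_same (same_iff.2 ((hf (g y)).symm.trans (hg' y).symm))
        ((hft _).trans (hgt _)) }
  refine ⟨⟨e, fun x y => ?_, fun x y => green_iff_of_lift hG hG' φ (hf x) (hf y) (hft x) (hft y)⟩,
    hf, fun ψ hψ => ?_⟩
  · change G'.red (f x) (f y) ↔ G.red x y
    rw [hG.red_iff, hG'.red_iff, ← hf, ← hf, hft, hft, φ.toEquiv.apply_eq_iff_eq]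
  · exact Iso.toEquiv_injective <| Equiv.ext fun x =>
      hG'.eq_of_same (same_iff.2 ((hψ x).symm.trans (hf x)))
        ((ψ.t1_eq hG hG' x).trans (hft x).symm)

end Reconstruction

end BiDigraph

/-! ### An explicit model of `K(H,N)`. -/

/-- Vertices of `K(H,N)`: the `j`-th vertex of the red string `(u, d, l, i)`. -/
@[ext] structure KVertex (H N : ℕ) where
  u : ℕ
  d : ℕ
  l : ℕ
  i : ℕ
  j : ℕ
  u_or_d : u = 0 ∨ d = 0
  upper_le : 2 * u + l ≤ H
  lower_le : d + i ≤ N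
  -- The string has X + Y = `H + 2d - 2u` edges and its critical vertex is at `j = l + d`.
  j_le : j + 2 * u ≤ H + 2 * d

namespace KVertex

variable {H N : ℕ}

/-- Red edges, and green edges labelled `1`, `1/2` and `0`. -/
def Red (x y : KVertex H N) : Prop :=
  y.u = x.u ∧ y.d = x.d ∧ y.l = x.l ∧ y.i = x.i ∧ y.j = x.j + 1

def GreenOne (x y : KVertex H N) : Prop :=
  x.j ≤ x.l + x.d ∧ y.j = x.j ∧ y.i = x.i ∧
    ((x.u = y.u + 1 ∧ y.d = 0 ∧ y.l = x.l + 2) ∨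
      (x.u = 0 ∧ y.u = 0 ∧ y.d = x.d + 1 ∧ y.l = x.l))

def GreenHalf (x y : KVertex H N) : Prop :=
  x.j = x.l + 1 ∧ x.d = 0 ∧ y.u = x.u ∧ y.d = 0 ∧ y.l = x.l + 1 ∧ y.i = x.i ∧ y.j + 1 = x.j

/-- The thresholds for `x.j` differ because on a string with a 1/2 edge the position `l + 1` is
occupied by that edge, so label 0 starts at `l + 2`; a lower-type edge starts right after the
critical position. -/
def GreenZero (x y : KVertex H N) : Prop :=
  y.j + 2 = x.j ∧ y.l = x.l ∧
    ((x.d = 0 ∧ x.l + 2 ≤ x.j ∧ y.u = x.u + 1 ∧ y.d = 0 ∧ y.i = x.i) ∨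
      (x.u = 0 ∧ y.u = 0 ∧ x.d = y.d + 1 ∧ x.l + x.d + 1 ≤ x.j ∧ y.i = x.i + 1))

/-- The numbers of red and green edges after and before a vertex. -/
def rh (x : KVertex H N) : ℕ := H + 2 * x.d - (2 * x.u + x.j)
-- Truncated subtraction encodes the two halves of a string: this rank stays at A = `i + u` from the
-- critical position on. In `gh` the truncation acts before it instead.
def gt (x : KVertex H N) : ℕ := x.i + x.u + (x.l + x.d - x.j)
def gh (x : KVertex H N) : ℕ := N + x.u - (x.i + x.d) + (x.j - (x.l + x.d))

/-- The involution of `K(H,N)` that reverses all edges. -/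
def rev (x : KVertex H N) : KVertex H N where
  u := x.u
  d := x.d
  l := H - (2 * x.u + x.l)
  i := N - (x.d + x.i)
  j := H + 2 * x.d - (2 * x.u + x.j)
  u_or_d := x.u_or_d
  upper_le := by have := x.upper_le; omega
  lower_le := by have := x.lower_le; omega
  j_le := by have := x.j_le; have := x.upper_le; omega

lemma bounds (x : KVertex H N) : (x.u = 0 ∨ x.d = 0) ∧ 2 * x.u + x.l ≤ H ∧ x.d + x.i ≤ N ∧
    x.j + 2 * x.u ≤ H + 2 * x.d := ⟨x.u_or_d, x.upper_le, x.lower_le, x.j_le⟩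

lemma rev_rev (x : KVertex H N) : x.rev.rev = x := by
  have := x.bounds
  ext <;> simp only [rev] <;> omega

lemma red_rev {x y : KVertex H N} : Red x.rev y.rev ↔ Red y x := by
  have := x.bounds
  have := y.bounds
  simp only [Red, rev]
  omega

lemma one_rev {x y : KVertex H N} : GreenOne x.rev y.rev ↔ GreenZero y x := by
  have := x.bounds
  have := y.bounds
  simp only [GreenOne, GreenZero, rev]
  omega

lemma half_rev {x y : KVertex H N} : GreenHalf x.rev y.rev ↔ GreenHalf y x := by
  have := x.bounds
  have := y.bounds
  simp only [GreenHalf, rev]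
  omega

end KVertex

/-- The digraph `K(H,N)`. -/
def modelK (H N : ℕ) : BiDigraph (KVertex H N) where
  red := KVertex.Red
  green x y := x.GreenOne y ∨ x.GreenHalf y ∨ x.GreenZero y

namespace modelK

open KVertex

variable {H N : ℕ}

lemma red_paths : RankedPaths (modelK H N).red KVertex.j KVertex.rh where
  func {x y z} h h' := by
    simp only [modelK, Red] at h h'
    ext <;> omega
  inj {x y z} h h' := by
    simp only [modelK, Red] at h h'
    ext <;> omega
  out_rank {x y} h := by
    have := y.bounds
    simp only [modelK, Red] at h
    simp only [rh]
    omega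
  in_rank h := h.2.2.2.2
  exists_out {x} h := by
    have := x.bounds
    simp only [rh] at h
    exact ⟨{ x with j := x.j + 1, j_le := by omega }, rfl, rfl, rfl, rfl, rfl⟩
  exists_in {x} h := by
    have := x.bounds
    refine ⟨{ x with j := x.j - 1, j_le := by omega }, rfl, rfl, rfl, rfl, ?_⟩
    simp only []
    omega

lemma green_paths : RankedPaths (modelK H N).green KVertex.gt KVertex.gh where
  func {x y z} h h' := by
    have := x.bounds
    simp only [modelK, GreenOne, GreenHalf, GreenZero] at h h'
    ext <;> omega
  inj {x y z} h h' := by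
    have := x.bounds
    have := y.bounds
    have := z.bounds
    simp only [modelK, GreenOne, GreenHalf, GreenZero] at h h'
    ext <;> omega
  out_rank {x y} h := by
    have := x.bounds
    have := y.bounds
    simp only [modelK, GreenOne, GreenHalf, GreenZero] at h
    simp only [gh]
    omega
  in_rank {x y} h := by
    have := x.bounds
    have := y.bounds
    simp only [modelK, GreenOne, GreenHalf, GreenZero] at h
    simp only [gt]
    omega
  exists_out {x} h := by
    obtain ⟨u, d, l, i, j, h1, h2, h3, h4⟩ := x
    simp only [gh] at h
    by_cases hj : j ≤ l + d
    · rcases Nat.eq_zero_or_pos u with rfl | hu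
      · exact ⟨⟨0, d + 1, l, i, j, by omega, by omega, by omega, by omega⟩, Or.inl
          ⟨hj, rfl, rfl, Or.inr ⟨rfl, rfl, rfl, rfl⟩⟩⟩
      · obtain ⟨u, rfl⟩ := Nat.exists_eq_succ_of_ne_zero hu.ne'
        exact ⟨⟨u, 0, l + 2, i, j, by omega, by omega, by omega, by omega⟩, Or.inl
          ⟨hj, rfl, rfl, Or.inl ⟨rfl, rfl, rfl⟩⟩⟩
    · rcases Nat.eq_zero_or_pos d with rfl | hd
      · rcases eq_or_ne j (l + 1) with rfl | hne
        · exact ⟨⟨u, 0, l + 1, i, l, by omega, by omega, by omega, by omega⟩, Or.inr (Or.inl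
            ⟨rfl, rfl, rfl, rfl, rfl, rfl, rfl⟩)⟩
        · obtain ⟨j, rfl⟩ := Nat.exists_eq_add_of_le' (show 2 ≤ j by omega)
          exact ⟨⟨u + 1, 0, l, i, j, by omega, by omega, by omega, by omega⟩, Or.inr (Or.inr
            ⟨rfl, rfl, Or.inl ⟨rfl, by simp only []; omega, rfl, rfl, rfl⟩⟩)⟩
      · obtain rfl : u = 0 := by omega
        obtain ⟨d, rfl⟩ := Nat.exists_eq_succ_of_ne_zero hd.ne'
        obtain ⟨j, rfl⟩ := Nat.exists_eq_add_of_le' (show 2 ≤ j by omega)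
        exact ⟨⟨0, d, l, i + 1, j, by omega, by omega, by omega, by omega⟩, Or.inr (Or.inr
            ⟨rfl, rfl, Or.inr ⟨rfl, rfl, rfl, by simp only []; omega, rfl⟩⟩)⟩
  exists_in {x} h := by
    obtain ⟨u, d, l, i, j, h1, h2, h3, h4⟩ := x
    simp only [gt] at h
    by_cases hj : l + d ≤ j
    · rcases Nat.eq_zero_or_pos u with rfl | hu
      · obtain ⟨i, rfl⟩ := Nat.exists_eq_succ_of_ne_zero (show i ≠ 0 by omega)
        exact ⟨⟨0, d + 1, l, i, j + 2, by omega, by omega, by omega, by omega⟩, Or.inr (Or.inr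
          ⟨rfl, rfl, Or.inr ⟨rfl, rfl, rfl, by simp only []; omega, rfl⟩⟩)⟩
      · obtain ⟨u, rfl⟩ := Nat.exists_eq_succ_of_ne_zero hu.ne'
        exact ⟨⟨u, 0, l, i, j + 2, by omega, by omega, by omega, by omega⟩, Or.inr (Or.inr
          ⟨rfl, rfl, Or.inl ⟨rfl, by simp only []; omega, rfl, by simp only []; omega, rfl⟩⟩)⟩
    · rcases Nat.eq_zero_or_pos d with rfl | hd
      · rcases eq_or_ne l (j + 1) with rfl | hne
        · exact ⟨⟨u, 0, j, i, j + 1, by omega, by omega, by omega, by omega⟩, Or.inr (Or.inl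
            ⟨rfl, rfl, rfl, rfl, rfl, rfl, rfl⟩)⟩
        · obtain ⟨l, rfl⟩ := Nat.exists_eq_add_of_le' (show 2 ≤ l by omega)
          exact ⟨⟨u + 1, 0, l, i, j, by omega, by omega, by omega, by omega⟩, Or.inl
            ⟨by simp only []; omega, rfl, rfl, Or.inl ⟨rfl, rfl, rfl⟩⟩⟩
      · obtain rfl : u = 0 := by omega
        obtain ⟨d, rfl⟩ := Nat.exists_eq_succ_of_ne_zero hd.ne'
        exact ⟨⟨0, d, l, i, j, by omega, by omega, by omega, by omega⟩, Or.inl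
          ⟨by simp only []; omega, rfl, rfl, Or.inr ⟨rfl, rfl, rfl, rfl⟩⟩⟩

@[simp] lemma t1_eq (x : KVertex H N) : (modelK H N).t1 x = x.j := red_paths.inLen_eq x
@[simp] lemma h1_eq (x : KVertex H N) : (modelK H N).h1 x = x.rh := red_paths.outLen_eq x
@[simp] lemma t2_eq (x : KVertex H N) : (modelK H N).t2 x = x.gt := green_paths.inLen_eq x
@[simp] lemma h2_eq (x : KVertex H N) : (modelK H N).h2 x = x.gh := green_paths.outLen_eq x

lemma r0_iff {x y : KVertex H N} : (modelK H N).R0 x y ↔ x.Red y ∧ x.j < x.l + x.d := by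
  refine and_congr_right fun h => ?_
  simp only [modelK, Red] at h
  simp only [h2_eq, gh]
  omega

lemma r1_iff {x y : KVertex H N} : (modelK H N).R1 x y ↔ x.Red y ∧ x.l + x.d ≤ x.j := by
  refine and_congr_right fun h => ?_
  simp only [modelK, Red] at h
  simp only [h2_eq, gh]
  omega

lemma rh_of_one {x y : KVertex H N} (h : x.GreenOne y) : y.rh = x.rh + 2 := by
  have := x.bounds
  have := y.bounds
  simp only [GreenOne] at h
  simp only [rh]
  omega

lemma rh_of_half {x y : KVertex H N} (h : x.GreenHalf y) : y.rh = x.rh + 1 := by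
  have := x.bounds
  have := y.bounds
  simp only [GreenHalf] at h
  simp only [rh]
  omega

lemma rh_of_zero {x y : KVertex H N} (h : x.GreenZero y) : y.rh = x.rh := by
  have := x.bounds
  have := y.bounds
  simp only [GreenZero] at h
  simp only [rh]
  omega

lemma g1_iff {x y : KVertex H N} : (modelK H N).G1 x y ↔ x.GreenOne y := by
  constructor
  · rintro ⟨h | h | h, h'⟩
    · exact h
    · have := rh_of_half h
      simp only [h1_eq] at h'
      omega
    · have := rh_of_zero h
      simp only [h1_eq] at h'
      omega
  · exact fun h => ⟨Or.inl h, by simp only [h1_eq, rh_of_one h]⟩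

lemma gh_iff {x y : KVertex H N} : (modelK H N).Gh x y ↔ x.GreenHalf y := by
  constructor
  · rintro ⟨h | h | h, h'⟩
    · have := rh_of_one h
      simp only [h1_eq] at h'
      omega
    · exact h
    · have := rh_of_zero h
      simp only [h1_eq] at h'
      omega
  · exact fun h => ⟨Or.inr (Or.inl h), by simp only [h1_eq, rh_of_half h]⟩

lemma g0_iff {x y : KVertex H N} : (modelK H N).G0 x y ↔ x.GreenZero y := by
  constructor
  · rintro ⟨h | h | h, h'⟩
    · have := rh_of_one h
      simp only [h1_eq] at h'
      omega
    · have := rh_of_half h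
      simp only [h1_eq] at h'
      omega
    · exact h
  · exact fun h => ⟨Or.inr (Or.inr h), by simp only [h1_eq, rh_of_zero h]⟩

lemma redE_iff {a : ℚ} {x y : KVertex H N} : (modelK H N).RedE a x y ↔
    a = 0 ∧ x.Red y ∧ x.j < x.l + x.d ∨ a = 1 ∧ x.Red y ∧ x.l + x.d ≤ x.j := by
  constructor
  · intro h
    rcases lt_or_ge x.j (x.l + x.d) with h1 | h1
    · have h2 : (modelK H N).R0 x y := r0_iff.2 ⟨h.1, h1⟩
      exact Or.inl ⟨h.2.symm.trans (BiDigraph.redE_zero.2 h2).2, h.1, h1⟩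
    · have h2 : (modelK H N).R1 x y := r1_iff.2 ⟨h.1, h1⟩
      exact Or.inr ⟨h.2.symm.trans (BiDigraph.redE_one.2 h2).2, h.1, h1⟩
  · rintro (⟨rfl, h⟩ | ⟨rfl, h⟩)
    · exact BiDigraph.redE_zero.2 (r0_iff.2 h)
    · exact BiDigraph.redE_one.2 (r1_iff.2 h)

lemma greenE_iff {a : ℚ} {x y : KVertex H N} : (modelK H N).GreenE a x y ↔
    a = 1 ∧ x.GreenOne y ∨ a = 1 / 2 ∧ x.GreenHalf y ∨ a = 0 ∧ x.GreenZero y := by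
  constructor
  · intro h
    rcases h.1 with h1 | h1 | h1
    · exact Or.inl ⟨h.2.symm.trans (BiDigraph.greenE_one.2 (g1_iff.2 h1)).2, h1⟩
    · exact Or.inr (Or.inl ⟨h.2.symm.trans (BiDigraph.greenE_half.2 (gh_iff.2 h1)).2, h1⟩)
    · exact Or.inr (Or.inr ⟨h.2.symm.trans (BiDigraph.greenE_zero.2 (g0_iff.2 h1)).2, h1⟩)
  · rintro (⟨rfl, h⟩ | ⟨rfl, h⟩ | ⟨rfl, h⟩)
    · exact BiDigraph.greenE_one.2 (g1_iff.2 h)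
    · exact BiDigraph.greenE_half.2 (gh_iff.2 h)
    · exact BiDigraph.greenE_zero.2 (g0_iff.2 h)

/-- The involution realizes the duality `a ↦ 1 - a` inside the model, so the dual relations need no
separate witnesses. -/
lemma redE_rev {a : ℚ} {x y : KVertex H N} :
    (modelK H N).RedE a x.rev y.rev ↔ (modelK H N).RedE (1 - a) y x := by
  have hx := x.bounds
  have hy := y.bounds
  rw [redE_iff, redE_iff, red_rev, sub_eq_zero, sub_eq_self, eq_comm (a := (1 : ℚ)), or_comm]
  refine or_congr (and_congr_right fun _ => and_congr_right fun h => ?_)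
    (and_congr_right fun _ => and_congr_right fun h => ?_) <;>
  · simp only [Red] at h
    simp only [rev]
    omega

lemma zero_rev {x y : KVertex H N} : GreenZero x.rev y.rev ↔ GreenOne y x := by
  rw [← one_rev, rev_rev, rev_rev]

lemma greenE_rev {a : ℚ} {x y : KVertex H N} :
    (modelK H N).GreenE a x.rev y.rev ↔ (modelK H N).GreenE (1 - a) y x := by
  rw [greenE_iff, greenE_iff, one_rev, half_rev, zero_rev]
  have h1 : 1 - a = 1 ↔ a = 0 := by constructor <;> intro h <;> linarith
  have h2 : 1 - a = 1 / 2 ↔ a = 1 / 2 := by constructor <;> intro h <;> linarith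
  have h3 : 1 - a = 0 ↔ a = 1 := by constructor <;> intro h <;> linarith
  rw [h1, h2, h3]
  tauto

lemma rel_a {p q p' s : KVertex H N} (h1 : (modelK H N).G1 p q) (h2 : (modelK H N).R1 p p') (h3 : (modelK H N).G0 p' s) :
    ∃ s' m n c, (modelK H N).G1 s s' ∧ (modelK H N).R0 s' c ∧ (modelK H N).R0 q m ∧ (modelK H N).R1 m n ∧ (modelK H N).G0 n c := by
  simp only [r0_iff, r1_iff, g1_iff, g0_iff] at h1 h2 h3 ⊢
  have hp := p.bounds
  have hq := q.bounds
  have hs := s.bounds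
  simp only [GreenOne, Red, GreenZero] at h1 h2 h3
  -- `p` is critical, so an edge labelled 0 at its successor must be of lower type; this forces `p.u
  -- = 0` and yields the witnesses.
  refine ⟨⟨0, p.d, p.l, s.i, s.j, by omega, by omega, by omega, by omega⟩,
    ⟨0, q.d, q.l, q.i, q.j + 1, by omega, by omega, by omega, by omega⟩,
    ⟨0, q.d, q.l, q.i, q.j + 2, by omega, by omega, by omega, by omega⟩,
    ⟨0, p.d, p.l, s.i, s.j + 1, by omega, by omega, by omega, by omega⟩, ?_⟩
  simp only [GreenOne, Red, GreenZero, true_and, and_true]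
  omega

lemma rel_b {p q q' s : KVertex H N} (h1 : (modelK H N).G1 p q) (h2 : (modelK H N).R0 q q') (h3 : (modelK H N).Gh s q') :
    ∃ u v z m, (modelK H N).R1 u v ∧ (modelK H N).G0 v p ∧ (modelK H N).Gh u z ∧ (modelK H N).R0 z m ∧ (modelK H N).R1 m s := by
  simp only [r0_iff, r1_iff, g1_iff, g0_iff, gh_iff] at h1 h2 h3 ⊢
  have hp := p.bounds
  have hq := q.bounds
  have hs := s.bounds
  simp only [GreenOne, Red, GreenHalf] at h1 h2 h3
  refine ⟨⟨q.u, 0, p.l, p.i, p.l + 1, by omega, by omega, by omega, by omega⟩,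
    ⟨q.u, 0, p.l, p.i, p.l + 2, by omega, by omega, by omega, by omega⟩,
    ⟨q.u, 0, s.l, s.i, p.l, by omega, by omega, by omega, by omega⟩,
    ⟨q.u, 0, s.l, s.i, p.l + 1, by omega, by omega, by omega, by omega⟩, ?_⟩
  simp only [Red, GreenZero, GreenHalf, true_and, and_true]
  omega

lemma rel_c {p q q₁ q₂ p' s : KVertex H N} (h1 : (modelK H N).G1 p q) (h2 : (modelK H N).R0 q q₁)
    (h3 : (modelK H N).R0 q₁ q₂) (h4 : (modelK H N).R1 p p') (h5 : (modelK H N).Gh p' s) :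
    ∃ w₀ w₁ w₂ s', (modelK H N).R1 w₀ w₁ ∧ (modelK H N).R1 w₁ w₂ ∧ (modelK H N).Gh w₁ q₁ ∧ (modelK H N).G0 w₂ s' ∧ (modelK H N).R0 s s' := by
  simp only [r0_iff, r1_iff, g1_iff, g0_iff, gh_iff] at h1 h2 h3 h4 h5 ⊢
  have hp := p.bounds
  have hq := q.bounds
  have hs := s.bounds
  simp only [GreenOne, Red, GreenHalf] at h1 h2 h3 h4 h5
  refine ⟨⟨q.u, 0, s.l, s.i, p.l + 1, by omega, by omega, by omega, by omega⟩,
    ⟨q.u, 0, s.l, s.i, p.l + 2, by omega, by omega, by omega, by omega⟩,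
    ⟨q.u, 0, s.l, s.i, p.l + 3, by omega, by omega, by omega, by omega⟩,
    ⟨s.u, 0, s.l, s.i, p.l + 1, by omega, by omega, by omega, by omega⟩, ?_⟩
  simp only [Red, GreenZero, GreenHalf, true_and, and_true]
  omega

lemma rel_verma {p q q₁ q₂ p' s : KVertex H N} (h1 : (modelK H N).G1 p q) (h2 : (modelK H N).R0 q q₁)
    (h3 : (modelK H N).R1 q₁ q₂) (h4 : (modelK H N).R1 p p') (h5 : (modelK H N).Gh p' s) :
    ∃ d d₁ d₂ b b₁ b₂ b₃ c, (modelK H N).G0 q₂ d ∧ (modelK H N).R1 d d₁ ∧ (modelK H N).Gh d₁ d₂ ∧ (modelK H N).R0 d₂ c ∧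
      (modelK H N).R0 s b ∧ (modelK H N).G1 b b₁ ∧ (modelK H N).R0 b₁ b₂ ∧ (modelK H N).R1 b₂ b₃ ∧ (modelK H N).G0 b₃ c := by
  simp only [r0_iff, r1_iff, g1_iff, g0_iff, gh_iff] at h1 h2 h3 h4 h5 ⊢
  have hp := p.bounds
  have hq := q.bounds
  have hs := s.bounds
  simp only [GreenOne, Red, GreenHalf] at h1 h2 h3 h4 h5
  refine ⟨⟨0, 0, p.l, p.i + 1, p.l, by omega, by omega, by omega, by omega⟩,
    ⟨0, 0, p.l, p.i + 1, p.l + 1, by omega, by omega, by omega, by omega⟩,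
    ⟨0, 0, p.l + 1, p.i + 1, p.l, by omega, by omega, by omega, by omega⟩,
    ⟨0, 0, p.l + 1, p.i, p.l + 1, by omega, by omega, by omega, by omega⟩,
    ⟨0, 1, p.l + 1, p.i, p.l + 1, by omega, by omega, by omega, by omega⟩,
    ⟨0, 1, p.l + 1, p.i, p.l + 2, by omega, by omega, by omega, by omega⟩,
    ⟨0, 1, p.l + 1, p.i, p.l + 3, by omega, by omega, by omega, by omega⟩,
    ⟨0, 0, p.l + 1, p.i + 1, p.l + 1, by omega, by omega, by omega, by omega⟩, ?_⟩
  simp [GreenOne, Red, GreenZero, GreenHalf]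
  omega

lemma localRelations : LocalRelations (modelK H N).RedE (modelK H N).GreenE where
  rel_a p q p' s:= by
    simp only [BiDigraph.redE_zero, BiDigraph.redE_one, BiDigraph.greenE_zero,
      BiDigraph.greenE_one]
    exact rel_a
  rel_b p q q' s:= by
    simp only [BiDigraph.redE_zero, BiDigraph.redE_one, BiDigraph.greenE_zero,
      BiDigraph.greenE_half, BiDigraph.greenE_one]
    exact rel_b
  rel_c p q q₁ q₂ p' s:= by
    simp only [BiDigraph.redE_zero, BiDigraph.redE_one, BiDigraph.greenE_zero,
      BiDigraph.greenE_half, BiDigraph.greenE_one]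
    exact rel_c
  rel_verma p q q₁ q₂ p' s:= by
    simp only [BiDigraph.redE_zero, BiDigraph.redE_one, BiDigraph.greenE_zero,
      BiDigraph.greenE_half, BiDigraph.greenE_one]
    exact rel_verma

end modelK

lemma LocalRelations.comap {V : Type u} {W : Type v} {r g : ℚ → V → V → Prop}
    (h : LocalRelations r g) (e : W ≃ V) :
    LocalRelations (fun a x y => r a (e x) (e y)) (fun a x y => g a (e x) (e y)) where
  rel_a p q p' s h1 h2 h3 := by
    simpa only [e.surjective.exists] using h.rel_a _ _ _ _ h1 h2 h3
  rel_b p q p' s h1 h2 h3 := by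
    simpa only [e.surjective.exists] using h.rel_b _ _ _ _ h1 h2 h3
  rel_c p q q₁ q₂ p' s h1 h2 h3 h4 h5 := by
    simpa only [e.surjective.exists] using h.rel_c _ _ _ _ _ _ h1 h2 h3 h4 h5
  rel_verma p q q₁ q₂ p' s h1 h2 h3 h4 h5 := by
    simpa only [e.surjective.exists] using h.rel_verma _ _ _ _ _ _ h1 h2 h3 h4 h5

namespace modelK

open KVertex

variable {H N : ℕ}

theorem isRGraph : (modelK H N).IsRGraph where
  k0_red := red_paths.componentsAreFinitePaths
  k0_green := green_paths.componentsAreFinitePaths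
  k1_red x y h := by
    simp only [modelK, Red] at h
    simp only [t2_eq, h2_eq, gt, gh]
    omega
  k1_green x y h := by
    have := x.bounds
    have := y.bounds
    simp only [modelK, GreenOne, GreenHalf, GreenZero] at h
    simp only [t1_eq, h1_eq, rh]
    omega
  k2_red x y h := by
    simp only [modelK, Red] at h
    simp only [t2_eq, h2_eq, gt, gh]
    omega
  k2_green x y h := by
    have := x.bounds
    have := y.bounds
    simp only [modelK, GreenOne, GreenHalf, GreenZero] at h
    simp only [t1_eq, h1_eq, rh]
    omega
  k3_red x y z h h' := by
    have h1 : (modelK H N).RedE _ x y := ⟨h, rfl⟩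
    have h2 : (modelK H N).RedE _ y z := ⟨h', rfl⟩
    rw [redE_iff] at h1 h2
    simp only [Red] at h1 h2
    rcases h1 with ⟨e1, h1⟩ | ⟨e1, h1⟩ <;> rcases h2 with ⟨e2, h2⟩ | ⟨e2, h2⟩ <;>
      rw [e1, e2] <;> first | (norm_num; done) | omega
  k3_green x y z h h' := by
    have h1 : (modelK H N).GreenE _ x y := ⟨h, rfl⟩
    have h2 : (modelK H N).GreenE _ y z := ⟨h', rfl⟩
    rw [greenE_iff] at h1 h2
    simp only [GreenOne, GreenHalf, GreenZero] at h1 h2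
    have := x.bounds
    have := y.bounds
    rcases h1 with ⟨e1, h1⟩ | ⟨e1, h1⟩ | ⟨e1, h1⟩ <;>
      rcases h2 with ⟨e2, h2⟩ | ⟨e2, h2⟩ | ⟨e2, h2⟩ <;>
      rw [e1, e2] <;> first | (norm_num; done) | omega
  k4_red_green a b x y z h h' := by
    have hx := x.bounds
    have hy := y.bounds
    have hz := z.bounds
    rw [redE_iff] at h
    rw [greenE_iff] at h'
    simp only [GreenOne, GreenHalf, GreenZero, Red] at h h'
    rcases h with ⟨rfl, h⟩ | ⟨rfl, h⟩
    · rcases h' with ⟨rfl, h'⟩ | ⟨rfl, h'⟩ | ⟨rfl, h'⟩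
      · refine ⟨zero_ne_one, fun _ => ⟨rfl, rfl,
          { z with j := x.j, j_le := by omega }, greenE_iff.2 (Or.inl ⟨rfl, ?_⟩),
          redE_iff.2 (Or.inl ⟨rfl, ?_⟩)⟩⟩
        · simp only [GreenOne, true_and]
          omega
        · simp only [Red, true_and]
          omega
      · omega
      · omega
    · rcases h' with ⟨rfl, h'⟩ | ⟨rfl, h'⟩ | ⟨rfl, h'⟩
      · omega
      · norm_num
      · norm_num
  k4_green_red a b x y z h h' := by
    have hx := x.bounds
    have hy := y.bounds
    have hz := z.bounds
    rw [greenE_iff] at h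
    rw [redE_iff] at h'
    simp only [GreenOne, GreenHalf, GreenZero, Red] at h h'
    rcases h' with ⟨rfl, h'⟩ | ⟨rfl, h'⟩
    · rcases h with ⟨rfl, h⟩ | ⟨rfl, h⟩ | ⟨rfl, h⟩
      · norm_num
      · norm_num
      · omega
    · rcases h with ⟨rfl, h⟩ | ⟨rfl, h⟩ | ⟨rfl, h⟩
      · omega
      · omega
      · refine ⟨one_ne_zero, fun _ => ⟨rfl, rfl,
          { x with j := x.j + 1, j_le := by omega }, redE_iff.2 (Or.inr ⟨rfl, ?_⟩),
          greenE_iff.2 (Or.inr (Or.inr ⟨rfl, ?_⟩))⟩⟩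
        · simp only [Red, true_and, and_true]
          omega
        · simp only [GreenZero]
          omega
  k5 := localRelations
  k5_dual := by
    have h1 : (fun a x y => (modelK H N).RedE (1 - a) y x) =
        fun a x y => (modelK H N).RedE a (rev x) (rev y) := by
      funext a x y
      exact propext redE_rev.symm
    have h2 : (fun a x y => (modelK H N).GreenE (1 - a) y x) =
        fun a x y => (modelK H N).GreenE a (rev x) (rev y) := by
      funext a x y
      exact propext greenE_rev.symm
    rw [h1, h2]
    exact localRelations.comap ⟨rev, rev, rev_rev, rev_rev⟩

/-- The vertex with all coordinates zero is the only source. The model is therefore connected, and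
the classification identifies its view from the two string lengths there. -/
theorem isK (H N : ℕ) : IsK H N (modelK H N) := by
  let o : KVertex H N := ⟨0, 0, 0, 0, 0, Or.inl rfl, Nat.zero_le _, Nat.zero_le _, Nat.zero_le _⟩
  have ho : (modelK H N).IsSource o := isRGraph.isSource_iff.2 ⟨t1_eq o, t2_eq o⟩
  have hu : ∀ s, (modelK H N).IsSource s → s = o := by
    intro s hs
    have h := isRGraph.isSource_iff.1 hs
    simp only [t1_eq, t2_eq, gt] at h
    ext <;> simp only [o] <;> omega
  have hK := isRGraph.isK (isRGraph.isConnected_of_unique_source hu) ho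
  have h1 : (modelK H N).h1 o = H := h1_eq o
  have h2 : (modelK H N).h2 o = N := h2_eq o
  rwa [h1, h2] at hK

end modelK

theorem proposition1 :
    -- every connected R-graph is `K(H,A)`, with `H`, `A` read off at its unique source
    (∀ {V : Type u} (G : BiDigraph V), G.IsRGraph → G.IsConnected →
      ∃ s : V, G.IsSource s ∧ (∀ s' : V, G.IsSource s' → s' = s) ∧ IsK (G.h1 s) (G.h2 s) G) ∧
    -- conversely, each `K̂(H,A)` is the view from the sky on an R-graph `K(H,A)`
    (∀ H A : ℕ, ∃ (V : Type) (G : BiDigraph V), IsK H A G) ∧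
    -- `K(H,A)` is connected with string lengths `H`, `A` at its source
    (∀ (H A : ℕ) {V : Type u} (G : BiDigraph V), IsK H A G →
      G.IsConnected ∧ ∀ s : V, G.IsSource s → G.h1 s = H ∧ G.h2 s = A) ∧
    -- an R-graph is determined by its view from the sky (so `K(H,A)` is unique):
    -- every isomorphism between views is induced by exactly one isomorphism of R-graphs
    (∀ {V : Type u} {W : Type v} (G : BiDigraph V) (G' : BiDigraph W),
      G.IsRGraph → G'.IsRGraph → ∀ φ : SkyGraph.Iso G.view G'.view,
        ∃! ψ : BiDigraph.Iso G G', ∀ x : V,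
          φ.toEquiv (Quot.mk G.red x) = Quot.mk G'.red (ψ.toEquiv x)) := by
  exact ⟨fun G hG hc => hG.exists_unique_source hc,
    fun H A => ⟨KVertex H A, modelK H A, modelK.isK H A⟩,
    fun _ _ _ _ h => BiDigraph.connected_of_isK h,
    fun _ _ hG hG' φ => BiDigraph.existsUnique_iso hG hG' φ⟩
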